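/- Let $X$ be a bounded geometry $\operatorname{CAT}(0)$-cubical space (a connected and simply connected complex of unit cubes glued along faces, in which vertex links are flag complexes, with a uniform bound on the number of edges at a vertex). Fix a base vertex $P$ and a proper weight function $w$, i.e. a function $w>0$ on the set of hyperplanes such that $\{H : w(H)\le M\}$ is finite for every $M$. For a cube $C$ let $\operatorname{Mid}(C)$ be the set of hyperplanes cutting $C$, and for $H\in\operatorname{Mid}(C)$ let $x_H$ be the affine coordinate on $C$ that is $1$ on the codimension-one face separated from $P$ by $H$ and $0$ on the opposite face. Let $w_C=\sum_{H\in \operatorname{Mid}(C)}w(H)x_H$. Let $\operatorname{SAH}(C)$ be the set of hyperplanes that separate $C$ from $P$ and are adjacent to $C$ (disjoint from $C$, but cutting a cube $D_H$ having $C$ as a codimension-one face). Let $\Omega^*_{L^2}(X)=\bigoplus_C\Omega^*_{L^2}(C)$ be the Hilbert space direct sum of the spaces of complex $L^2$-differential forms of all degrees on the cubes, and let $A^*_{L^2}(X)$ be its closed subspace $\bigoplus_C A(C)$, where $A(C)$ is the line of top-degree constant-coefficient forms. Let $\Omega_0^*(C)$ be the space of forms that are smooth on $C$, boundary included, and pull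 back to zero on each proper face. For $s\in[0,1]$ let $A_s(C)\subseteq\Omega^*_0(C)$ be the line spanned by $e^{sw_C}dx_{H_1}\cdots dx_{H_q}$, where $\operatorname{Mid}(C)=\{H_1,\dots,H_q\}$. For a weight function $v$ and a form $\beta$ on $C$ put $$d_v\beta=d\beta+\sum_{H\in\operatorname{Mid}(C)}v(H)\,dx_H\wedge\beta ,\qquad e_v\beta=\sum_{H\in\operatorname{SAH}(C)}v(H)\,e^{v(H)(x_H-1)}dx_H\wedge\beta ,$$ where in the second sum $\beta$ is pulled back to $D_H$ by the orthogonal projection $D_H\to C$. Let $D_{\mathrm{dR},s}=d_{v}+e_{v}+d_{v}^\diamond+e_{v}^\diamond$ with $v=sw$, where $\diamond$ denotes the formal adjoint. Let $D_{\mathrm{JV}}=d_{\mathrm{JV}}+\delta_{\mathrm{JV}}$, where $d_{\mathrm{JV}}\beta=\sum_{H\in\operatorname{SAH}(C)}w(H)\,dx_H\wedge\beta$ for $\beta\in A(C)$, and $\delta_{\mathrm{JV}}\beta=\sum_{H\in\operatorname{Mid}(C)}w(H)\,\iota_H\beta$ is its formal adjoint ($\iota_H$ being contraction with $\partial/\partial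 x_H$, followed by restriction to the face $x_H=1$). Let $\mathcal H(X)$ be the Hilbert $C[0,1]$-module of norm-continuous functions $\beta\colon[0,1]\to\Omega^*_{L^2}(X)$ with $\beta_0\in A^*_{L^2}(X)$, with the pointwise inner product. Let $\mathcal H_0(X)\subseteq\mathcal H(X)$ be the algebraic direct sum over the cubes $C$ of the spaces of functions $\beta\colon[0,1]\to\Omega_0^*(C)$ that are continuous for the $C^\infty$-topology and satisfy $\beta_s\in A_s(C)$ for all sufficiently small $s$. **Theorem.** The formula $$(\mathcal D\beta)_s=\begin{cases}s^{-1}D_{\mathrm{dR},s}\,\beta_s & s\in(0,1]\\ D_{\mathrm{JV}}\,\beta_0 & s=0\end{cases}$$ defines a $C[0,1]$-linear operator $\mathcal D$ from $\mathcal H_0(X)$ to $\mathcal H(X)$. This densely defined operator, with domain $\mathcal H_0(X)$, is a regular and essentially self-adjoint operator on $\mathcal H(X)$: it is closable, and its closure $\overline{\mathcal D}$ satisfies $\overline{\mathcal D}^*=\overline{\mathcal D}$ and is regular (it is closed and densely defined, its adjoint is densely defined, and $1+\overline{\mathcal D}^*\overline{\mathcal D}$ has dense range). -/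

import Mathlib

open MeasureTheory Topology
open scoped ComplexOrder ContDiff unitInterval

/-! ### Unbounded operators on Hilbert modules -/

section HilbertModules

variable {A E : Type*} [Ring A] [AddCommGroup E] [Module A E] [Inner A E]

/-- The graph of the adjoint of a partially defined operator `T` on a Hilbert `A`-module:
`(y, z)` belongs to it when `⟪T x, y⟫ = ⟪x, z⟫` for all `x` in the domain of `T`.
(It is the graph of an operator as soon as the domain of `T` is dense.) -/
def adjointGraph (T : E →ₗ.[A] E) : Set (E × E) :=
  {p | ∀ x : T.domain, inner A (T x) p.1 = inner A (x : E) p.2}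

variable [TopologicalSpace E]

/-- A regular operator on a Hilbert module: a closed, densely defined operator `T` whose adjoint
is densely defined and for which `1 + T⋆ T` has dense range. -/
structure IsRegularOperator (T : E →ₗ.[A] E) : Prop where
  isClosed_graph : IsClosed (T.graph : Set (E × E))
  dense_domain : Dense (T.domain : Set E)
  dense_adjoint_domain : Dense {y : E | ∃ z, (y, z) ∈ adjointGraph T}
  dense_range : Dense {v : E | ∃ (x : T.domain) (z : E), (T x, z) ∈ adjointGraph T ∧ v = x + z}

/-- A self-adjoint operator on a Hilbert module: densely defined and equal to its adjoint. -/
structure IsSelfAdjointOperator (T : E →ₗ.[A] E) : Prop where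
  dense_domain : Dense (T.domain : Set E)
  graph_eq : (T.graph : Set (E × E)) = adjointGraph T

/-- `S` is the closure of `T` (in particular `T` is closable). -/
def IsClosureOf (S T : E →ₗ.[A] E) : Prop :=
  (S.graph : Set (E × E)) = closure (T.graph : Set (E × E))

end HilbertModules

/-! ### Cubical complexes -/

/-- A cubical complex with vertex set `V`, obtained by gluing unit cubes along faces. A cube is
recorded by its finite set of vertices. The vertices of each cube are indexed by some `{0,1}^q`
in such a way that the cubes of the complex contained in it are exactly its faces, a face being
obtained by fixing some of the coordinates; and two cubes that meet do so in a common face. -/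
structure CubicalComplex (V : Type*) where
  cubes : Set (Finset V)
  vertex_mem : ∀ v, {v} ∈ cubes
  exists_chart : ∀ C ∈ cubes, ∃ (q : ℕ) (φ : (Fin q → Bool) → V),
    Function.Injective φ ∧ Set.range φ = (C : Set V) ∧
      ∀ F : Finset V, F ⊆ C → (F ∈ cubes ↔ ∃ (J : Finset (Fin q)) (ε : Fin q → Bool),
        (F : Set V) = φ '' {η | ∀ i, i ∉ J → η i = ε i})
  inter_mem : ∀ C ∈ cubes, ∀ D ∈ cubes, ((C : Set V) ∩ D).Nonempty →
    ∃ F ∈ cubes, (F : Set V) = (C : Set V) ∩ D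

namespace CubicalComplex

variable {V : Type*} (X : CubicalComplex V)

/-- The cubes of the complex, of all dimensions. -/
abbrev Cube : Type _ := {C : Finset V // C ∈ X.cubes}

/-- The edges of the complex: the cubes with two vertices. -/
abbrev Edge : Type _ := {e : Finset V // e ∈ X.cubes ∧ e.card = 2}

/-- The graph formed by the vertices and the edges of the complex. -/
def skeleton : SimpleGraph V where
  Adj u v := u ≠ v ∧ ∃ e : X.Edge, (e.1 : Set V) = {u, v}
  symm := ⟨fun _ _ h => ⟨h.1.symm, h.2.imp fun _ he => he.trans (Set.pair_comm _ _)⟩⟩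
  loopless := ⟨fun _ h => h.1 rfl⟩

/-- Homotopy of edge paths with fixed end points: the equivalence relation generated by removing
backtrackings and by pushing two consecutive edges of a square across that square. -/
inductive PathHomotopic :
    ∀ {u v : V}, X.skeleton.Walk u v → X.skeleton.Walk u v → Prop
  | refl {u v : V} (p : X.skeleton.Walk u v) : PathHomotopic p p
  | symm {u v : V} {p q : X.skeleton.Walk u v} : PathHomotopic p q → PathHomotopic q p
  | trans {u v : V} {p q r : X.skeleton.Walk u v} :
      PathHomotopic p q → PathHomotopic q r → PathHomotopic p r
  | cons {u v x : V} (h : X.skeleton.Adj u v) {p q : X.skeleton.Walk v x} :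
      PathHomotopic p q → PathHomotopic (.cons h p) (.cons h q)
  | backtrack {u v x : V} (h : X.skeleton.Adj u v) (p : X.skeleton.Walk u x) :
      PathHomotopic (.cons h (.cons h.symm p)) p
  | square {a b c d x : V} (hab : X.skeleton.Adj a b) (hbc : X.skeleton.Adj b c)
      (had : X.skeleton.Adj a d) (hdc : X.skeleton.Adj d c)
      (S : X.Cube) (hS : (S.1 : Set V) = {a, b, c, d}) (p : X.skeleton.Walk c x) :
      PathHomotopic (.cons hab (.cons hbc p)) (.cons had (.cons hdc p))

/-- A CAT(0)-cubical space: a connected and simply connected cubical complex in which the link of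
every vertex is a flag complex. The link of `v` has the edges at `v` (that is, the neighbours of
`v`) as its vertices, and the sets of edges at `v` contained in a common cube as its simplices. -/
structure IsCAT0 : Prop where
  connected : X.skeleton.Connected
  simplyConnected : ∀ (v : V) (p : X.skeleton.Walk v v), X.PathHomotopic p .nil
  flag : ∀ (v : V) (S : Finset V), (∀ a ∈ S, X.skeleton.Adj v a) →
    (∀ a ∈ S, ∀ b ∈ S, ∃ C : X.Cube, v ∈ C.1 ∧ a ∈ C.1 ∧ b ∈ C.1) →
    ∃ C : X.Cube, v ∈ C.1 ∧ S ⊆ C.1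

/-- Bounded geometry: a uniform bound on the number of edges containing a given vertex. -/
def BoundedGeometry : Prop :=
  ∃ N : ℕ, ∀ v, {e : X.Edge | v ∈ e.1}.encard ≤ N

/-! ### Hyperplanes -/

/-- The opposite edges of a square are those that are cut by the same midplane of the square. -/
def OppositeInSquare (e f : X.Edge) : Prop :=
  ∃ S : X.Cube, S.1.card = 4 ∧ e.1 ⊆ S.1 ∧ f.1 ⊆ S.1 ∧ Disjoint e.1 f.1

/-- The hyperplanes. A midplane of a cube is determined by the parallel edges of the cube that it
cuts; accordingly a hyperplane is recorded by the set of all edges that it cuts, which is a class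
for the equivalence relation generated by `OppositeInSquare`. -/
def Hyperplane : Type _ := Quot X.OppositeInSquare

variable {X}

/-- The hyperplane that cuts a given edge. -/
def hyperplaneOf (e : X.Edge) : X.Hyperplane := Quot.mk _ e

theorem finite_mid (C : X.Cube) :
    {H : X.Hyperplane | ∃ e : X.Edge, e.1 ⊆ C.1 ∧ hyperplaneOf e = H}.Finite := by
  have h1 : {e : X.Edge | e.1 ⊆ C.1}.Finite := by
    refine Set.Finite.of_finite_image (f := fun e : X.Edge => e.1) ?_
      Subtype.val_injective.injOn
    refine (C.1.powerset.finite_toSet).subset ?_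
    rintro _ ⟨e, he, rfl⟩
    exact Finset.mem_coe.2 (Finset.mem_powerset.2 he)
  exact h1.image hyperplaneOf

/-- `Mid(C)`: the hyperplanes that cut the cube `C`. -/
noncomputable def Mid (C : X.Cube) : Finset X.Hyperplane := (finite_mid C).toFinset

theorem mem_mid {C : X.Cube} {H : X.Hyperplane} :
    H ∈ Mid C ↔ ∃ e : X.Edge, e.1 ⊆ C.1 ∧ hyperplaneOf e = H := by
  simp [Mid]

/-- The graph of vertices and of those edges that are not cut by `H`; its connected components are
the sets of vertices of the components of the complement of `H`. -/
def complementGraph (H : X.Hyperplane) : SimpleGraph V where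
  Adj u v := u ≠ v ∧ ∃ e : X.Edge, (e.1 : Set V) = {u, v} ∧ hyperplaneOf e ≠ H
  symm := ⟨fun _ _ h => ⟨h.1.symm, h.2.imp fun _ he => ⟨he.1.trans (Set.pair_comm _ _), he.2⟩⟩⟩
  loopless := ⟨fun _ h => h.1 rfl⟩

/-- The hyperplane `H` is disjoint from the cube `C` and separates it from the vertex `P`. -/
def Separates (H : X.Hyperplane) (C : X.Cube) (P : V) : Prop :=
  H ∉ Mid C ∧ ∀ v ∈ C.1, ¬ (complementGraph H).Reachable P v

/-- `C` is a codimension-one face of `D`. -/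
def IsFacet (C D : X.Cube) : Prop := C.1 ⊆ D.1 ∧ D.1.card = 2 * C.1.card

/-- `SAH(C)`: the hyperplanes that are adjacent to `C` (disjoint from `C`, but cutting a cube that
has `C` as a codimension-one face) and separate `C` from the base vertex `P`. -/
def SAH (P : V) (C : X.Cube) : Set X.Hyperplane :=
  {H | (H ∉ Mid C ∧ ∃ D : X.Cube, IsFacet C D ∧ H ∈ Mid D) ∧ Separates H C P}

/-- `H ∈ SAH(C)` and `D` is the cube `D_H` that is cut by `H` and has `C` as a codimension-one
face. Equivalently, `H` cuts `D` and `C` is the face `x_H = 1` of `D`. -/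
def Step (P : V) (C : X.Cube) (H : X.Hyperplane) (D : X.Cube) : Prop :=
  H ∈ SAH P C ∧ IsFacet C D ∧ H ∈ Mid D

/-! ### Differential forms

A cube `C` is identified with `[0,1]^{Mid(C)}` by means of its coordinate functions `x_H`,
for `H ∈ Mid(C)`, where `x_H = 1` on the face of `C` that is separated by `H` from the base vertex
and `x_H = 0` on the opposite face. A form on `C` is written as `∑_I f_I dx_I`, where `I` runs
over the subsets of `Mid(C)`, and where the factors of `dx_I = dx_{H_1} ∧ ⋯ ∧ dx_{H_p}` are placed
in increasing order for a fixed linear order on the set of hyperplanes. The `dx_I` are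
orthonormal at each point. -/

/-- The space in which the cube `C` sits as the unit cube. -/
abbrev Coord (C : X.Cube) : Type _ := ↥(Mid C) → ℝ

/-- The cube `C` in its coordinates `x_H`. -/
def unitCube (C : X.Cube) : Set (Coord C) := Set.Icc 0 1

/-- Lebesgue measure on the cube `C`. -/
noncomputable def cubeMeasure (C : X.Cube) : Measure (Coord C) := volume.restrict (unitCube C)

variable (X) in
/-- Families of forms, one on each cube: `β C I` is the coefficient of `dx_I` on `C`. Only the
values for `I ⊆ Mid C`, at the points of `unitCube C`, have a meaning. -/
abbrev FormField : Type _ := ∀ C : X.Cube, Finset X.Hyperplane → Coord C → ℂ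

variable (X) in
/-- The pairs of a cube `C` and a multi-index `I ⊆ Mid C`. -/
abbrev FormIndex : Type _ := {p : X.Cube × Finset X.Hyperplane // p.2 ⊆ Mid p.1}

variable (X) in
/-- `Ω*_{L²}(X)`: the Hilbert space direct sum, over all cubes, of the spaces of square-integrable
forms of all degrees. -/
abbrev OmegaL2 : Type _ := lp (fun p : X.FormIndex => Lp ℂ 2 (cubeMeasure p.1.1)) 2

variable (X) in
/-- `A*_{L²}(X)`: the Hilbert space direct sum, over all cubes, of the one-dimensional spaces of
top-degree forms with constant coefficients. -/
def AL2 : Submodule ℂ X.OmegaL2 where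
  carrier := {ξ | ∀ p : X.FormIndex, (p.1.2 ≠ Mid p.1.1 → ξ p = 0) ∧
    ∃ c : ℂ, ξ p =ᵐ[cubeMeasure p.1.1] fun _ => c}
  zero_mem' := fun p => ⟨fun _ => rfl, 0, by
    exact Lp.coeFn_zero ℂ 2 (cubeMeasure p.1.1)⟩
  add_mem' := by
    intro ξ η hξ hη p
    refine ⟨fun h => ?_, ?_⟩
    · simp [(hξ p).1 h, (hη p).1 h]
    · obtain ⟨c, hc⟩ := (hξ p).2
      obtain ⟨c', hc'⟩ := (hη p).2
      refine ⟨c + c', ?_⟩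
      have h := Lp.coeFn_add (ξ p) (η p)
      filter_upwards [h, hc, hc'] with x hx h1 h2
      simp only [lp.coeFn_add, Pi.add_apply] at hx ⊢
      rw [hx, h1, h2]
  smul_mem' := by
    intro a ξ hξ p
    refine ⟨fun h => ?_, ?_⟩
    · simp [(hξ p).1 h]
    · obtain ⟨c, hc⟩ := (hξ p).2
      refine ⟨a * c, ?_⟩
      have h := Lp.coeFn_smul a (ξ p)
      filter_upwards [h, hc] with x hx h1
      simp only [lp.coeFn_smul, Pi.smul_apply] at hx ⊢
      rw [hx, h1, smul_eq_mul]

/-! ### The Hilbert `C[0,1]`-module -/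

variable (X) in
/-- The module `ℋ(X)` over `C[0,1]`: the norm-continuous functions from `[0,1]` to `Ω*_{L²}(X)`
whose value at `0` lies in `A*_{L²}(X)`. -/
def HilbertModule : Submodule C(I, ℂ) C(I, X.OmegaL2) where
  carrier := {β | β 0 ∈ X.AL2}
  zero_mem' := X.AL2.zero_mem
  add_mem' := fun ha hb => X.AL2.add_mem ha hb
  smul_mem' := fun c _ hx => X.AL2.smul_mem (c 0) hx

instance : IsScalarTower ℂ C(I, ℂ) C(I, X.OmegaL2) :=
  ⟨fun a f β => by ext1 s; exact smul_assoc a (f s) (β s)⟩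

noncomputable instance : NormedAddCommGroup X.HilbertModule := Submodule.normedAddCommGroup _

noncomputable instance : Module C(I, ℂ) X.HilbertModule := Submodule.module _

noncomputable instance : SMul C(I, ℂ) X.HilbertModule := Module.toDistribMulAction.toSMul

noncomputable instance : Module ℂ X.HilbertModule := Submodule.module' _

/-- The `C[0,1]`-valued inner product on `ℋ(X)`, which is the pointwise one. -/
noncomputable def hInner (β γ : X.HilbertModule) : C(I, ℂ) :=
  ⟨fun s => inner ℂ (β.1 s) (γ.1 s), by fun_prop⟩

/-- The norm on `ℋ(X)`, inherited from the supremum norm, is the one associated to the inner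
product. -/
noncomputable instance : CStarModule C(I, ℂ) X.HilbertModule where
  inner := hInner
  inner_add_right := by
    intro x y z; ext s; exact inner_add_right (𝕜 := ℂ) (x.1 s) (y.1 s) (z.1 s)
  inner_self_nonneg := by
    intro x s
    change (0 : ℂ) ≤ inner ℂ (x.1 s) (x.1 s)
    rw [inner_self_eq_norm_sq_to_K]
    simp
  inner_self := by
    intro x
    refine ⟨fun h => ?_, fun h => ?_⟩
    · ext1; ext1 s
      exact inner_self_eq_zero.1 (congrArg (fun f : C(I, ℂ) => f s) h)
    · subst h
      ext s; exact inner_zero_left (𝕜 := ℂ) (0 : X.OmegaL2)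
  inner_op_smul_right := by
    intro a x y; ext s; exact inner_smul_right (𝕜 := ℂ) (x.1 s) (y.1 s) (a s)
  inner_smul_right_complex := by
    intro a x y; ext s; exact inner_smul_right (𝕜 := ℂ) (x.1 s) (y.1 s) a
  star_inner := by
    intro x y; ext s; exact inner_conj_symm (𝕜 := ℂ) (y.1 s) (x.1 s)
  norm_eq_sqrt_norm_inner_self := by
    intro x
    have key : ∀ s, ‖inner ℂ (x.1 s) (x.1 s)‖ = ‖x.1 s‖ ^ 2 := fun s => by
      rw [inner_self_eq_norm_sq_to_K]; simp
    refine le_antisymm ?_ ?_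
    · change ‖x.1‖ ≤ _
      refine (ContinuousMap.norm_le _ (Real.sqrt_nonneg _)).2 fun s => ?_
      refine Real.le_sqrt_of_sq_le ?_
      rw [← key s]
      exact ContinuousMap.norm_coe_le_norm
        (⟨fun s => inner ℂ (x.1 s) (x.1 s), by fun_prop⟩ : C(I, ℂ)) s
    · refine Real.sqrt_le_iff.2 ⟨norm_nonneg _, ?_⟩
      refine (ContinuousMap.norm_le _ (sq_nonneg _)).2 fun s => ?_
      change ‖inner ℂ (x.1 s) (x.1 s)‖ ≤ ‖x.1‖ ^ 2
      rw [key s]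
      exact pow_le_pow_left₀ (norm_nonneg _) (ContinuousMap.norm_coe_le_norm x.1 s) 2

/-! ### The operators

`w : X.Hyperplane → ℝ` is a weight function and `P` is the base vertex. -/

/-- A weight function: a positive function on the set of hyperplanes. -/
def IsWeight (w : X.Hyperplane → ℝ) : Prop := ∀ H, 0 < w H

/-- A proper weight function. -/
def IsProperWeight (w : X.Hyperplane → ℝ) : Prop := ∀ M : ℝ, {H | w H ≤ M}.Finite

section Operators

variable [LinearOrder X.Hyperplane]

/-- The sign in `dx_H ∧ dx_J = ± dx_{J ∪ {H}}`, for `H ∉ J`; it is also the sign in the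
contraction `ι_H dx_{J ∪ {H}} = ± dx_J`. -/
noncomputable def sgn (H : X.Hyperplane) (J : Finset X.Hyperplane) : ℂ := (-1) ^ (J.filter (· < H)).card

/-- The partial derivative `∂f/∂x_H` on the cube `C`, one-sided at the boundary. -/
noncomputable def partialDeriv (C : X.Cube) (H : X.Hyperplane) (f : Coord C → ℂ) (x : Coord C) :
    ℂ :=
  fderivWithin ℝ f (unitCube C) x (fun K => if K.1 = H then 1 else 0)

/-- The point of `D` with the same coordinates as the point `x` of `C`, with `t` for the missing
ones. If `C` is a face of `D` this is the inclusion of `C` into `D` as the face where the missing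
coordinates are `t`; if `D` is a face of `C` it is the orthogonal projection from `C` to `D`. -/
noncomputable def transfer (C D : X.Cube) (t : ℝ) (x : Coord C) : Coord D :=
  fun K => if h : K.1 ∈ Mid C then x ⟨K.1, h⟩ else t

/-- The coordinate `x_H` on `C`. -/
noncomputable def coord (C : X.Cube) (H : X.Hyperplane) (x : Coord C) : ℝ :=
  if h : H ∈ Mid C then x ⟨H, h⟩ else 0

/-- `d_w β = dβ + ∑_{H ∈ Mid(C)} w(H) dx_H ∧ β` on each cube `C`. -/
noncomputable def dW (w : X.Hyperplane → ℝ) (β : X.FormField) : X.FormField := fun C J x =>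
  ∑ H ∈ J, sgn H (J.erase H) *
    (partialDeriv C H (β C (J.erase H)) x + w H * β C (J.erase H) x)

/-- The formal adjoint of `d_w`. -/
noncomputable def dWAdj (w : X.Hyperplane → ℝ) (β : X.FormField) : X.FormField := fun C J x =>
  ∑ H ∈ Mid C \ J, sgn H J *
    (-partialDeriv C H (β C (insert H J)) x + w H * β C (insert H J) x)

/-- `e_w β = ∑_{H ∈ SAH(C)} w(H) e^{w(H) y_H} α_H ∧ β` for `β` a form on `C`, where `y_H = x_H - 1`,
`α_H = dx_H`, and the summand for `H` is a form on the cube `D_H`, to which `β` is pulled back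
from its face `C` by the orthogonal projection. -/
noncomputable def eW (P : V) (w : X.Hyperplane → ℝ) (β : X.FormField) : X.FormField :=
  fun D J x => ∑ᶠ (p : X.Cube × X.Hyperplane) (_ : Step P p.1 p.2 D),
    if p.2 ∈ J then
      (w p.2 : ℂ) * Real.exp (w p.2 * (coord D p.2 x - 1)) * sgn p.2 (J.erase p.2) *
        β p.1 (J.erase p.2) (transfer D p.1 0 x)
    else 0

/-- The formal adjoint of `e_w`: contraction with the vector field dual to `x_H`, multiplication by
`w(H) e^{w(H) y_H}`, and integration over the fibres of the projection from `D_H` to `C`. -/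
noncomputable def eWAdj (P : V) (w : X.Hyperplane → ℝ) (β : X.FormField) : X.FormField :=
  fun C J x => ∑ᶠ (p : X.Cube × X.Hyperplane) (_ : Step P C p.2 p.1),
    sgn p.2 J * ∫ t in (0 : ℝ)..1,
      (w p.2 : ℂ) * Real.exp (w p.2 * (t - 1)) * β p.1 (insert p.2 J) (transfer C p.1 t x)

/-- The de Rham operator `D_dR = d_w + e_w + d_w^⋄ + e_w^⋄`. -/
noncomputable def deRhamOp (P : V) (w : X.Hyperplane → ℝ) (β : X.FormField) : X.FormField :=
  dW w β + eW P w β + dWAdj w β + eWAdj P w β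

/-- The Julg-Valette differential `β ↦ ∑_{H ∈ SAH(C)} w(H) α_H ∧ β`. -/
noncomputable def dJV (P : V) (w : X.Hyperplane → ℝ) (β : X.FormField) : X.FormField :=
  fun D J x => ∑ᶠ (p : X.Cube × X.Hyperplane) (_ : Step P p.1 p.2 D),
    if p.2 ∈ J then
      (w p.2 : ℂ) * sgn p.2 (J.erase p.2) * β p.1 (J.erase p.2) (transfer D p.1 0 x)
    else 0

/-- The formal adjoint of the Julg-Valette differential: the sum over `H ∈ Mid(D)` of `w(H)` times
the contraction `ι_H`, followed by restriction to the face of `D` where `x_H = 1`. -/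
noncomputable def deltaJV (P : V) (w : X.Hyperplane → ℝ) (β : X.FormField) : X.FormField :=
  fun C J x => ∑ᶠ (p : X.Cube × X.Hyperplane) (_ : Step P C p.2 p.1),
    (w p.2 : ℂ) * sgn p.2 J * β p.1 (insert p.2 J) (transfer C p.1 1 x)

/-- The Julg-Valette operator. -/
noncomputable def julgValetteOp (P : V) (w : X.Hyperplane → ℝ) (β : X.FormField) : X.FormField :=
  dJV P w β + deltaJV P w β

/-- The formula for `𝒟`: for `s > 0` it is `s⁻¹ D_{dR,s}`, where `D_{dR,s}` is the de Rham operator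
for the weight function `s • w`, and for `s = 0` it is the Julg-Valette operator. -/
noncomputable def curlyD (P : V) (w : X.Hyperplane → ℝ) (b : I → X.FormField) : I → X.FormField :=
  fun s => if s = 0 then julgValetteOp P w (b 0)
    else fun C J x => ((s : ℝ)⁻¹ : ℂ) * deRhamOp P ((s : ℝ) • w) (b s) C J x

/-- The form `β C` on the cube `C` belongs to `Ω*_0(C)`: it is smooth up to the boundary and pulls
back to zero on each of the boundary faces `x_H = 0` and `x_H = 1`. -/
structure MemOmegaZero (C : X.Cube) (β : X.FormField) : Prop where
  smooth : ∀ J ⊆ Mid C, ContDiffOn ℝ ∞ (β C J) (unitCube C)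
  pullback_eq_zero : ∀ J ⊆ Mid C, ∀ H : ↥(Mid C), H.1 ∉ J → ∀ x ∈ unitCube C,
    x H = 0 ∨ x H = 1 → β C J x = 0

/-- The form `β C` on the cube `C` belongs to `A_s(C)`: it is a multiple of
`e^{s w_C} dx_{H_1} ⋯ dx_{H_q}`, where `Mid(C) = {H_1, …, H_q}` and `w_C = ∑_H w(H) x_H`. -/
def MemA (w : X.Hyperplane → ℝ) (s : ℝ) (C : X.Cube) (β : X.FormField) : Prop :=
  ∃ c : ℂ, ∀ J ⊆ Mid C, ∀ x ∈ unitCube C,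
    β C J x = if J = Mid C then c * Real.exp (s * ∑ H : ↥(Mid C), w H.1 * x H) else 0

/-- The families `b` of forms that constitute `ℋ_0(X)`, the algebraic direct sum over the cubes `C`
of the spaces `ℋ_0(C)`: functions on `[0,1]` with values in `Ω*_0(C)`, continuous for the
`C^∞`-topology, with values in `A_s(C)` for all sufficiently small `s`. -/
structure IsSmoothFamily (w : X.Hyperplane → ℝ) (b : I → X.FormField) : Prop where
  memOmegaZero : ∀ s C, MemOmegaZero C (b s)
  continuous : ∀ C, ∀ J ⊆ Mid C, ∀ (k : ℕ) (s₀ : I),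
    TendstoUniformlyOn (fun s => iteratedFDerivWithin ℝ k (b s C J) (unitCube C))
      (iteratedFDerivWithin ℝ k (b s₀ C J) (unitCube C)) (𝓝 s₀) (unitCube C)
  memA : ∀ C, ∃ δ > (0 : ℝ), ∀ s : I, (s : ℝ) < δ → MemA w s C (b s)
  finite_support : {C : X.Cube | ∃ s, ∃ J ⊆ Mid C, ∃ x ∈ unitCube C, b s C J x ≠ 0}.Finite

/-- `β ∈ ℋ(X)` is the function with values in `Ω*_{L²}(X)` given by the family of forms `b`. -/
def Represents (b : I → X.FormField) (β : X.HilbertModule) : Prop :=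
  ∀ (s : I) (p : X.FormIndex), β.1 s p =ᵐ[cubeMeasure p.1.1] b s p.1.1 p.1.2

/-- The submodule `ℋ_0(X)` of `ℋ(X)`, as a set. -/
def curlyDDomain (w : X.Hyperplane → ℝ) : Set X.HilbertModule :=
  {β | ∃ b, IsSmoothFamily w b ∧ Represents b β}

/-- `𝒟` is the operator on `ℋ(X)` with domain `ℋ_0(X)` that is given by the formula `curlyD`. -/
structure IsCurlyD (P : V) (w : X.Hyperplane → ℝ)
    (T : X.HilbertModule →ₗ.[C(I, ℂ)] X.HilbertModule) : Prop where
  domain_eq : (T.domain : Set X.HilbertModule) = curlyDDomain w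
  apply_eq : ∀ (β : T.domain) (b : I → X.FormField),
    IsSmoothFamily w b → Represents b β → Represents (curlyD P w b) (T β)

end Operators

end CubicalComplex

/-! The frame is the classical criterion for essential self-adjointness. If a densely defined
operator is symmetric and its shifts by `i` and `-i` have dense range, then the shifts of its
closure `S` are onto, because `‖x‖ ≤ ‖Sx ± ix‖`. Self-adjointness follows as over a Hilbert space.
Regularity follows because `1 + S² = (S + i)(S - i)` is then onto as well
(`FibredModule.exists_selfAdjoint_closure`). The range of a shift is a `C[0,1]`-submodule, so a
partition of unity reduces its density to density in the fibre over each `s`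
(`FibredModule.dense_of_fibrewise`).

In a fibre, density comes from splitting the operator into finite-dimensional blocks. On an interval
take the functions `sin(nπt)` with `n ≥ 1`, their images under `d/dt + v`, and the exponential
`e^{vt}`, which `-d/dt + v` kills and to which frequency `0` is assigned. Multiplying such profiles
over the directions of a cube gives an eigenform. With `v = sw`, the operators `d_v` and `d_v^⋄`
change the degree only in directions of nonzero frequency. The operators `e_v` and `e_v^⋄` create or
integrate out only directions of frequency `0`: the factor `e^{v(x-1)}` in `e_v` is a multiple of
`e^{vx}`, and the fibre integral of a profile of nonzero frequency against it vanishes. So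
frequencies never change, and the eigenforms reachable from a given one live on the cubes obtained
by steps upward from a cube `B` whose hyperplanes are exactly those of nonzero frequency. Bounded
geometry makes these cubes finite in number (`finite_above`). On a finite-dimensional invariant
space a symmetric operator does not have `±i` as an eigenvalue, so every eigenform lies in the fibre
of the range of either shift (`IsEigenIndex.mem_fibre_shiftedRange`). By Stone–Weierstrass the
eigenforms span a dense subspace of each fibre; over `s = 0` only the constant top-degree forms
occur (`mem_closure_of_eigenForm_mem`).

It remains to see that `𝒟` is a symmetric operator with values in `ℋ(X)`. Forms in `A_s(C)` are
killed by `d_v` and `d_v^⋄`, so the singular part of `s⁻¹ D_{dR,s}` disappears for small `s`. In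
`e_v` and `e_v^⋄` the weight `sw` supplies a factor `s` that cancels `s⁻¹`. The resulting formula
(`curlyD_eq`) makes sense at `s = 0` and is the Julg-Valette operator there, because integrating a
constant along a fibre is the same as restricting it to an end. Symmetry for `s > 0` is integration
by parts and Fubini (`pairing_deRhamOp`), and at `s = 0` it follows by continuity. Symmetry and
density of the domain also make `𝒟` single-valued and linear.

The combinatorial input is that a hyperplane cutting a cube selects exactly one face of it away from
`P`, and that two upward steps can be interchanged (`exists_step_down`, `Step.down_unique`,
`step_swap`). This rests on the geometry of half-spaces, which is extracted from flagness and simple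
connectivity. The key point is that two reduced edge paths with the same ends differ by pushing
edges across squares (`IsReduced.swapEq`). It yields the quadrangle condition, and with it a
description of the two sides of a hyperplane by distances (`reachable_iff_sameSide`). -/

section FibredModules

/-- A normed `C[0,1]`-module `E` of continuous functions on `[0,1]` with values in a Hilbert space
`H`, with the supremum norm. -/
structure FibredModule (E H : Type*) [NormedAddCommGroup E] [Module C(I, ℂ) E] [Inner C(I, ℂ) E]
    [NormedAddCommGroup H] [InnerProductSpace ℂ H] where
  ev : I → E →+ H
  ev_smul : ∀ (s : I) (f : C(I, ℂ)) (x : E), ev s (f • x) = f s • ev s x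
  continuous_ev : ∀ x : E, Continuous fun s => ev s x
  norm_le_iff : ∀ (x : E) {c : ℝ}, 0 ≤ c → (‖x‖ ≤ c ↔ ∀ s, ‖ev s x‖ ≤ c)
  inner_apply : ∀ (s : I) (x y : E), inner C(I, ℂ) x y s = inner ℂ (ev s x) (ev s y)

/-! ### Symmetric operators on modules of continuous functions. -/

namespace FibredModule

variable {E H : Type*} [NormedAddCommGroup E] [Module C(I, ℂ) E] [Inner C(I, ℂ) E]
    [NormedAddCommGroup H] [InnerProductSpace ℂ H] (𝓔 : FibredModule E H)

theorem norm_ev_le (x : E) (s : I) : ‖𝓔.ev s x‖ ≤ ‖x‖ :=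
  (𝓔.norm_le_iff x (norm_nonneg x)).1 le_rfl s

theorem ev_const_smul (s : I) (a : ℂ) (x : E) : 𝓔.ev s (algebraMap ℂ C(I, ℂ) a • x) = a • 𝓔.ev s x :=
  𝓔.ev_smul s _ x

/-- No compatibility of the norm with the module structure is assumed. It follows because the norm
is the supremum of the norms in the fibres. -/
theorem continuous_smul (𝓔 : FibredModule E H) (f : C(I, ℂ)) : Continuous fun x : E => f • x := by
  refine (LipschitzWith.of_dist_le_mul (K := ‖f‖₊) fun x y => ?_).continuous
  rw [dist_eq_norm, dist_eq_norm, 𝓔.norm_le_iff _ (by positivity)]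
  intro s
  rw [← smul_sub, 𝓔.ev_smul, norm_smul]
  exact mul_le_mul (f.norm_coe_le_norm s) (𝓔.norm_ev_le _ s) (norm_nonneg _) (norm_nonneg _)

theorem continuous_ev_left (s : I) : Continuous (𝓔.ev s) :=
  (LipschitzWith.of_dist_le_mul (K := 1) fun x y => by
    rw [dist_eq_norm, dist_eq_norm, ← map_sub]
    simpa using 𝓔.norm_ev_le (x - y) s).continuous

theorem continuous_inner (s : I) :
    Continuous fun p : E × E => inner ℂ (𝓔.ev s p.1) (𝓔.ev s p.2) :=
  ((𝓔.continuous_ev_left s).comp continuous_fst).inner ((𝓔.continuous_ev_left s).comp continuous_snd)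

theorem ext_ev {x y : E} (h : ∀ s, 𝓔.ev s x = 𝓔.ev s y) : x = y := by
  rw [← sub_eq_zero, ← norm_le_zero_iff, 𝓔.norm_le_iff _ le_rfl]
  intro s
  rw [map_sub, h, sub_self, norm_zero]

/-- A `C[0,1]`-submodule of `E` is dense as soon as it is fibrewise dense. -/
theorem dense_of_fibrewise (R : Submodule C(I, ℂ) E)
    (h : ∀ (s : I) (γ : E) (ε : ℝ), 0 < ε → ∃ r ∈ R, ‖𝓔.ev s r - 𝓔.ev s γ‖ < ε) :
    Dense (R : Set E) := by
  intro γ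
  rw [Metric.mem_closure_iff]
  intro ε hε
  choose r hrR hr using fun s => h s γ (ε / 2) (half_pos hε)
  -- The approximation chosen at `s` stays good on the neighbourhood `U s`. Finitely many of these
  -- cover `[0,1]`, and a partition of unity subordinate to them glues the approximations by convex
  -- combinations, which does not increase the error.
  let U : I → Set I := fun s => {t | ‖𝓔.ev t (r s) - 𝓔.ev t γ‖ < ε / 2}
  have hU : ∀ s, IsOpen (U s) := fun s =>
    isOpen_lt ((𝓔.continuous_ev (r s)).sub (𝓔.continuous_ev γ)).norm continuous_const
  obtain ⟨F, hF⟩ := isCompact_univ.elim_finite_subcover U hU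
    fun s _ => Set.mem_iUnion.2 ⟨s, hr s⟩
  obtain ⟨ρ, hρ⟩ := PartitionOfUnity.exists_isSubordinate (s := (Set.univ : Set I)) isClosed_univ
    (fun i : F => U i.1) (fun i => hU i) (fun x hx => by
      have := hF hx
      simp only [Set.mem_iUnion] at this ⊢
      obtain ⟨i, hi, hx⟩ := this
      exact ⟨⟨i, hi⟩, hx⟩)
  let c : F → C(I, ℂ) := fun i => ⟨fun s => ((ρ i s : ℝ) : ℂ), by fun_prop⟩
  refine ⟨∑ i : F, c i • r i.1, R.sum_mem fun i _ => R.smul_mem _ (hrR i), ?_⟩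
  rw [dist_comm, dist_eq_norm]
  refine lt_of_le_of_lt ((𝓔.norm_le_iff _ (half_pos hε).le).2 fun s => ?_) (half_lt_self hε)
  have hsum : ∑ i : F, ρ i s = 1 := by
    rw [← finsum_eq_sum_of_fintype]; exact ρ.sum_eq_one (Set.mem_univ s)
  have e1 : 𝓔.ev s ((∑ i : F, c i • r i.1) - γ) =
      ∑ i : F, (ρ i s : ℂ) • (𝓔.ev s (r i.1) - 𝓔.ev s γ) := by
    simp only [smul_sub, Finset.sum_sub_distrib, ← Finset.sum_smul]
    rw [← Complex.ofReal_sum, hsum, Complex.ofReal_one, one_smul, map_sub, map_sum]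
    simp only [𝓔.ev_smul]
    rfl
  rw [e1]
  calc _ ≤ ∑ i : F, ρ i s * (ε / 2) := norm_sum_le_of_le _ fun i _ => by
        rw [norm_smul, Complex.norm_real, Real.norm_of_nonneg (ρ.nonneg i s)]
        by_cases h0 : ρ i s = 0
        · simp [h0]
        · refine mul_le_mul_of_nonneg_left (le_of_lt ?_) (ρ.nonneg i s)
          exact hρ i (subset_tsupport _ h0)
    _ = ε / 2 := by rw [← Finset.sum_mul, hsum, one_mul]

theorem eq_zero_of_inner_eq_zero {D : Set E} (hD : Dense D) {y : E}
    (h : ∀ z ∈ D, ∀ s, inner ℂ (𝓔.ev s y) (𝓔.ev s z) = 0) : y = 0 := by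
  have h2 : ∀ z : E, ∀ s, inner ℂ (𝓔.ev s y) (𝓔.ev s z) = 0 := by
    intro z s
    have hc : IsClosed {z : E | inner ℂ (𝓔.ev s y) (𝓔.ev s z) = 0} :=
      isClosed_eq ((𝓔.continuous_inner s).comp (continuous_const.prodMk continuous_id))
        continuous_const
    exact hc.closure_subset_iff.2 (fun z hz => h z hz s) (hD z)
  exact 𝓔.ext_ev fun s => by rw [map_zero, inner_self_eq_zero.1 (h2 y s)]

/-- The closure of the graph of an operator on `E`, as a submodule. -/
def graphClosure (T : E →ₗ.[C(I, ℂ)] E) :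
    Submodule C(I, ℂ) (E × E) where
  carrier := closure (T.graph : Set (E × E))
  zero_mem' := subset_closure T.graph.zero_mem
  add_mem' := fun ha hb => map_mem_closure₂ continuous_add ha hb fun _ h1 _ h2 => T.graph.add_mem h1 h2
  smul_mem' := fun c _ hx => map_mem_closure
    (((𝓔.continuous_smul c).comp continuous_fst).prodMk
      ((𝓔.continuous_smul c).comp continuous_snd)) hx fun _ h1 => T.graph.smul_mem c h1

/-- A closed submodule of `E × E` that is symmetric as a relation. -/
def IsSymmetricRelation (G : Set (E × E)) : Prop :=
  ∀ p ∈ G, ∀ q ∈ G, ∀ s : I, inner ℂ (𝓔.ev s p.2) (𝓔.ev s q.1) = inner ℂ (𝓔.ev s p.1) (𝓔.ev s q.2)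

theorem IsSymmetricRelation.closure {G : Set (E × E)}
    (hG : 𝓔.IsSymmetricRelation G) : 𝓔.IsSymmetricRelation (closure G) := by
  have hcl : ∀ s, IsClosed {r : (E × E) ×
      (E × E) |
      inner ℂ (𝓔.ev s r.1.2) (𝓔.ev s r.2.1) = inner ℂ (𝓔.ev s r.1.1) (𝓔.ev s r.2.2)} := fun s =>
    isClosed_eq
      ((𝓔.continuous_inner s).comp
        ((continuous_snd.comp continuous_fst).prodMk (continuous_fst.comp continuous_snd)))
      ((𝓔.continuous_inner s).comp
        ((continuous_fst.comp continuous_fst).prodMk (continuous_snd.comp continuous_snd)))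
  intro p hp q hq s
  have : (p, q) ∈ _root_.closure (G ×ˢ G) := by
    rw [closure_prod_eq]; exact ⟨hp, hq⟩
  exact (hcl s).closure_subset_iff.2 (fun r hr => hG r.1 hr.1 r.2 hr.2 s) this

/-- The hypothesis says that the inner product is real, so the cross term with `±i x` is purely
imaginary and drops out. -/
theorem norm_add_smul_sq {H : Type*} [NormedAddCommGroup H] [InnerProductSpace ℂ H] {x y : H} (h : inner ℂ y x = inner ℂ x y) {a : ℂ}
    (ha : a = Complex.I ∨ a = -Complex.I) : ‖y + a • x‖ ^ 2 = ‖y‖ ^ 2 + ‖x‖ ^ 2 := by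
  rw [norm_add_sq (𝕜 := ℂ), norm_smul, inner_smul_right]
  have hna : ‖a‖ = 1 := by rcases ha with rfl | rfl <;> simp
  have him : (inner ℂ y x).im = 0 := by
    have := inner_conj_symm (𝕜 := ℂ) y x
    rw [← h] at this
    exact Complex.conj_eq_iff_im.1 this
  have : RCLike.re (a * inner ℂ y x) = 0 := by
    rcases ha with rfl | rfl <;> simp [him]
  rw [this, hna]; ring

/-- This lower bound, from Pythagoras in each fibre, is what gives the shifts of a closed symmetric
relation closed range. -/
theorem IsSymmetricRelation.norm_le {G : Set (E × E)}
    (hG : 𝓔.IsSymmetricRelation G) {a : ℂ} (ha : a = Complex.I ∨ a = -Complex.I)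
    {p : E × E} (hp : p ∈ G) :
    ‖p.1‖ ≤ ‖p.2 + algebraMap ℂ C(I, ℂ) a • p.1‖ := by
  rw [𝓔.norm_le_iff _ (norm_nonneg _)]
  intro s
  refine le_trans ?_ (𝓔.norm_ev_le _ s)
  rw [map_add, 𝓔.ev_const_smul]
  have e2 := norm_add_smul_sq (hG p hp p hp s) ha
  nlinarith [norm_nonneg (𝓔.ev s p.2 + a • 𝓔.ev s p.1), norm_nonneg (𝓔.ev s p.1), sq_nonneg ‖𝓔.ev s p.2‖]

/-- By the lower bound, convergence of the values of the shift forces convergence of the arguments.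
So the range is closed as well as dense. -/
theorem surjective_add_smul [CompleteSpace E] (G : Submodule C(I, ℂ) (E × E))
    (hcl : IsClosed (G : Set (E × E)))
    (hG : 𝓔.IsSymmetricRelation (G : Set (E × E)))
    {a : ℂ} (ha : a = Complex.I ∨ a = -Complex.I)
    (hd : Dense {v | ∃ p ∈ G, p.2 + algebraMap ℂ C(I, ℂ) a • p.1 = v}) (v : E) :
    ∃ p ∈ G, p.2 + algebraMap ℂ C(I, ℂ) a • p.1 = v := by
  obtain ⟨u, hu, hlim⟩ := mem_closure_iff_seq_limit.1 (hd v)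
  choose x hxG hx using hu
  have hcau : CauchySeq fun n => (x n).1 := by
    rw [Metric.cauchySeq_iff']
    intro ε hε
    obtain ⟨N, hN⟩ := Metric.cauchySeq_iff'.1 hlim.cauchySeq ε hε
    refine ⟨N, fun n hn => lt_of_le_of_lt ?_ (hN n hn)⟩
    rw [dist_eq_norm, dist_eq_norm]
    refine (IsSymmetricRelation.norm_le 𝓔 hG ha (G.sub_mem (hxG n) (hxG N))).trans (le_of_eq ?_)
    congr 1
    rw [← hx n, ← hx N]
    simp only [Prod.fst_sub, Prod.snd_sub, smul_sub]
    abel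
  obtain ⟨y, hy⟩ := cauchySeq_tendsto_of_complete hcau
  have hy2 : Filter.Tendsto (fun n => (x n).2) Filter.atTop
      (𝓝 (v - algebraMap ℂ C(I, ℂ) a • y)) := by
    have h3 := hlim.sub (((𝓔.continuous_smul (algebraMap ℂ C(I, ℂ) a)).tendsto y).comp hy)
    refine h3.congr fun n => ?_
    rw [← hx n]
    exact add_sub_cancel_right _ _
  exact ⟨(y, v - algebraMap ℂ C(I, ℂ) a • y),
    hcl.mem_of_tendsto (hy.prodMk_nhds hy2) (Filter.Eventually.of_forall hxG),
    sub_add_cancel _ _⟩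

/-- This is maximality. Surjectivity of the shift by `i` gives `q` in the relation with the same
shifted value as `p`. The difference `q.1 - p.1` is then orthogonal to the range of the shift by
`-i`, which is everything, so `p = q`. -/
theorem mem_of_symmetric_of_surjective {G : Set (E × E)}
    (hG : 𝓔.IsSymmetricRelation G)
    (hsurj : ∀ a : ℂ, a = Complex.I ∨ a = -Complex.I → ∀ v, ∃ p ∈ G,
      p.2 + algebraMap ℂ C(I, ℂ) a • p.1 = v)
    {p : E × E}
    (hp : ∀ r ∈ G, ∀ s : I, inner ℂ (𝓔.ev s r.2) (𝓔.ev s p.1) = inner ℂ (𝓔.ev s r.1) (𝓔.ev s p.2)) : p ∈ G := by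
  obtain ⟨q, hq, hqe⟩ := hsurj Complex.I (Or.inl rfl) (p.2 + algebraMap ℂ C(I, ℂ) Complex.I • p.1)
  have hqs : ∀ s, 𝓔.ev s q.2 + Complex.I • 𝓔.ev s q.1 = 𝓔.ev s p.2 + Complex.I • 𝓔.ev s p.1 := fun s => by
    simpa only [map_add, 𝓔.ev_const_smul] using congrArg (𝓔.ev s) hqe
  have h1 : q.1 - p.1 = 0 := by
    refine 𝓔.eq_zero_of_inner_eq_zero dense_univ fun z _ s => ?_
    obtain ⟨r, hr, hrz⟩ := hsurj (-Complex.I) (Or.inr rfl) z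
    have hz : 𝓔.ev s z = 𝓔.ev s r.2 + (-Complex.I) • 𝓔.ev s r.1 :=
      by rw [← hrz, map_add, 𝓔.ev_const_smul]
    rw [hz]
    have ea := hp r hr s
    have eb := hG r hr q hq s
    rw [map_sub]
    rw [← inner_conj_symm, map_eq_zero, inner_sub_right, inner_add_left, inner_add_left, ea, eb,
      inner_smul_left, inner_smul_left]
    have e3 : 𝓔.ev s q.2 = 𝓔.ev s p.2 + Complex.I • 𝓔.ev s p.1 - Complex.I • 𝓔.ev s q.1 :=
      eq_sub_of_add_eq (hqs s)
    rw [e3, inner_sub_right, inner_add_right, inner_smul_right, inner_smul_right]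
    simp only [map_neg, Complex.conj_I]
    ring
  have h2 : q.1 = p.1 := sub_eq_zero.1 h1
  have h3 : q.2 = p.2 := by
    rw [h2] at hqe
    exact add_right_cancel hqe
  have : q = p := Prod.ext h2 h3
  rwa [← this]

theorem regular_of_symmetric_of_surjective (S : E →ₗ.[C(I, ℂ)] E)
    (hcl : IsClosed (S.graph : Set (E × E)))
    (hdense : Dense (S.domain : Set E))
    (hG : 𝓔.IsSymmetricRelation (S.graph : Set (E × E)))
    (hsurj : ∀ a : ℂ, a = Complex.I ∨ a = -Complex.I → ∀ v, ∃ p ∈ S.graph,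
      p.2 + algebraMap ℂ C(I, ℂ) a • p.1 = v) :
    IsRegularOperator S ∧ IsSelfAdjointOperator S := by
  have hadj : (S.graph : Set (E × E)) = adjointGraph S := by
    refine Set.Subset.antisymm ?_ ?_
    · intro p hp x
      ext s
      rw [𝓔.inner_apply, 𝓔.inner_apply]
      exact hG _ (S.mem_graph x) p hp s
    · intro p hp
      refine 𝓔.mem_of_symmetric_of_surjective hG hsurj fun r hr s => ?_
      obtain ⟨x, hx1, hx2⟩ := S.mem_graph_iff.1 hr
      have := congrArg (fun f : C(I, ℂ) => f s) (hp x)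
      rw [hx1, hx2] at this
      simpa only [𝓔.inner_apply] using this
  have hSadj : ∀ x : S.domain, ((x : E), S x) ∈ adjointGraph S := fun x => by
    rw [← hadj]; exact S.mem_graph x
  refine ⟨⟨hcl, hdense, ?_, ?_⟩, ⟨hdense, hadj⟩⟩
  · exact hdense.mono fun y hy => ⟨_, hSadj ⟨y, hy⟩⟩
  · intro v
    refine subset_closure ?_
    -- Solving `(S + i) p₁ = v` and then `(S - i) q₁ = p₁` gives `(1 + S²) q₁ = v`. That `S q₁` lies
    -- in the domain again is seen from `S q₁ = p₁ + i q₁`.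
    obtain ⟨p, hp, hpv⟩ := hsurj Complex.I (Or.inl rfl) v
    obtain ⟨q, hq, hqv⟩ := hsurj (-Complex.I) (Or.inr rfl) p.1
    have e : q.2 = p.1 + algebraMap ℂ C(I, ℂ) Complex.I • q.1 := by
      rw [← hqv, map_neg, neg_smul, neg_add_cancel_right]
    have h2 : (q.2, p.2 + algebraMap ℂ C(I, ℂ) Complex.I • q.2) ∈ S.graph := by
      rw [show (q.2, p.2 + algebraMap ℂ C(I, ℂ) Complex.I • q.2) =
        p + algebraMap ℂ C(I, ℂ) Complex.I • q from Prod.ext e rfl]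
      exact S.graph.add_mem hp (S.graph.smul_mem _ hq)
    obtain ⟨x, hx1, hx2⟩ := S.mem_graph_iff.1 hq
    refine ⟨x, p.2 + algebraMap ℂ C(I, ℂ) Complex.I • q.2, ?_, ?_⟩
    · rw [hx2, ← hadj]; exact h2
    · have h3 : algebraMap ℂ C(I, ℂ) Complex.I • q.2 =
          algebraMap ℂ C(I, ℂ) Complex.I • p.1 - q.1 := by
        rw [e, smul_add, smul_smul, ← map_mul, Complex.I_mul_I, map_neg, map_one, neg_smul,
          one_smul, sub_eq_add_neg]
      rw [hx1, ← hpv, h3]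
      abel

/-- A symmetric, densely defined operator `T` on `E` such that `T ± i` have dense range is
essentially self-adjoint and regular. -/
theorem exists_selfAdjoint_closure [CompleteSpace E] (T : E →ₗ.[C(I, ℂ)] E)
    (hdense : Dense (T.domain : Set E))
    (hsymm : 𝓔.IsSymmetricRelation (T.graph : Set (E × E)))
    (hrange : ∀ a : ℂ, a = Complex.I ∨ a = -Complex.I →
      Dense (Set.range fun x : T.domain => T x + algebraMap ℂ C(I, ℂ) a • (x : E))) :
    ∃ S : E →ₗ.[C(I, ℂ)] E,
      IsClosureOf S T ∧ IsRegularOperator S ∧ IsSelfAdjointOperator S := by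
  have hGcl : IsClosed (𝓔.graphClosure T : Set (E × E)) := isClosed_closure
  have hGsymm : 𝓔.IsSymmetricRelation (𝓔.graphClosure T : Set (E × E)) :=
    IsSymmetricRelation.closure 𝓔 hsymm
  -- Closability: by symmetry a limit value over `0` is orthogonal to the dense domain.
  have hfun : ∀ p ∈ 𝓔.graphClosure T, p.1 = 0 → p.2 = 0 := by
    intro p hp h0
    refine 𝓔.eq_zero_of_inner_eq_zero hdense fun z hz s => ?_
    have := hGsymm p hp (z, T ⟨z, hz⟩) (subset_closure (T.mem_graph ⟨z, hz⟩)) s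
    rw [h0] at this
    rw [this]
    exact (congrArg (fun h : H => inner ℂ h _) (map_zero (𝓔.ev s))).trans (inner_zero_left _)
  have hgr : (𝓔.graphClosure T).toLinearPMap.graph = 𝓔.graphClosure T :=
    (𝓔.graphClosure T).toLinearPMap_graph_eq hfun
  refine ⟨(𝓔.graphClosure T).toLinearPMap, by rw [IsClosureOf, hgr]; rfl,
    𝓔.regular_of_symmetric_of_surjective _ (by rw [hgr]; exact hGcl) ?_ (by rw [hgr]; exact hGsymm) ?_⟩
  · refine hdense.mono fun x hx => ?_
    exact Submodule.mem_map.2 ⟨(x, T ⟨x, hx⟩), subset_closure (T.mem_graph ⟨x, hx⟩), rfl⟩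
  · intro a ha
    rw [hgr]
    refine 𝓔.surjective_add_smul _ hGcl hGsymm ha ((hrange a ha).mono ?_)
    rintro _ ⟨x, rfl⟩
    exact ⟨(x, T x), subset_closure (T.mem_graph x), rfl⟩

end FibredModule

end FibredModules

/-! ### Completeness of `ℋ(X)`. -/

namespace CubicalComplex

variable {V : Type*} {X : CubicalComplex V}

/-- The conditions are imposed on one component at a time. Each asks that the component vanish or
lie on the line of constants, and a line is closed because it is finite-dimensional. -/
theorem isClosed_AL2 : IsClosed (X.AL2 : Set X.OmegaL2) := by
  have key : (X.AL2 : Set X.OmegaL2) = ⋂ p : X.FormIndex,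
      {ξ : X.OmegaL2 | p.1.2 ≠ Mid p.1.1 → ξ p = 0} ∩
      {ξ : X.OmegaL2 | ξ p ∈ Submodule.span ℂ {indicatorConstLp 2 (μ := cubeMeasure p.1.1)
        MeasurableSet.univ (by
          rw [cubeMeasure, Measure.restrict_apply_univ]
          exact (isCompact_Icc (a := (0 : Coord p.1.1)) (b := 1)).measure_lt_top.ne) (1 : ℂ)}} := by
    ext ξ
    simp only [Set.mem_iInter]
    refine forall_congr' fun p => and_congr Iff.rfl ?_
    simp only [Set.mem_ofPred_eq, Submodule.mem_span_singleton]
    refine exists_congr fun c => ?_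
    constructor
    · intro h
      refine Lp.ext ?_
      refine (Lp.coeFn_smul _ _).trans ?_
      filter_upwards [indicatorConstLp_coeFn (p := 2) (μ := cubeMeasure p.1.1)
        (hs := MeasurableSet.univ) (hμs := (by
          rw [cubeMeasure, Measure.restrict_apply_univ]
          exact (isCompact_Icc (a := (0 : Coord p.1.1)) (b := 1)).measure_lt_top.ne)) (c := (1 : ℂ)), h]
        with x hx hc
      simp [hx, hc]
    · intro h
      rw [← h]
      refine (Lp.coeFn_smul _ _).trans ?_
      filter_upwards [indicatorConstLp_coeFn (p := 2) (μ := cubeMeasure p.1.1)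
        (hs := MeasurableSet.univ) (hμs := (by
          rw [cubeMeasure, Measure.restrict_apply_univ]
          exact (isCompact_Icc (a := (0 : Coord p.1.1)) (b := 1)).measure_lt_top.ne)) (c := (1 : ℂ))]
        with x hx
      simp [hx]
  have hc : ∀ p : X.FormIndex, Continuous fun ξ : X.OmegaL2 => ξ p := fun p =>
    (lp.lipschitzWith_one_eval 2 p).continuous
  rw [key]
  refine isClosed_iInter fun p => IsClosed.inter ?_ ?_
  · by_cases h : p.1.2 ≠ Mid p.1.1
    · simp only [h, true_imp_iff, ne_eq, not_false_eq_true]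
      exact isClosed_eq (hc p) continuous_const
    · simp [h]
  · exact (Submodule.closed_of_finiteDimensional _).preimage (hc p)

instance : CompleteSpace X.HilbertModule := by
  have h : IsClosed (X.HilbertModule : Set C(I, X.OmegaL2)) :=
    isClosed_AL2.preimage (continuous_eval_const (0 : I))
  exact h.completeSpace_coe


variable (X) in
/-- `ℋ(X)` as a module of continuous functions with values in `Ω*_{L²}(X)`. -/
noncomputable def fibred : FibredModule X.HilbertModule X.OmegaL2 where
  ev s :=
    { toFun := fun β => β.1 s
      map_zero' := rfl
      map_add' := fun _ _ => rfl }
  ev_smul _ _ _ := rfl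
  continuous_ev β := β.1.continuous
  norm_le_iff β _ hc := ContinuousMap.norm_le β.1 hc
  inner_apply _ _ _ := rfl

theorem exists_selfAdjoint_closure (T : X.HilbertModule →ₗ.[C(I, ℂ)] X.HilbertModule)
    (hdense : Dense (T.domain : Set X.HilbertModule))
    (hsymm : X.fibred.IsSymmetricRelation (T.graph : Set (X.HilbertModule × X.HilbertModule)))
    (hrange : ∀ a : ℂ, a = Complex.I ∨ a = -Complex.I →
      Dense (Set.range fun x : T.domain => T x + algebraMap ℂ C(I, ℂ) a • (x : X.HilbertModule))) :
    ∃ S : X.HilbertModule →ₗ.[C(I, ℂ)] X.HilbertModule,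
      IsClosureOf S T ∧ IsRegularOperator S ∧ IsSelfAdjointOperator S :=
  X.fibred.exists_selfAdjoint_closure T hdense hsymm hrange

end CubicalComplex

/-! ### Charts of cubes, squares and the cube condition. -/

namespace CubicalComplex

section Charts

variable {V : Type*} {X : CubicalComplex V}

/-- Change the coordinate `i` of a vertex of `{0,1}^q`. -/
def flipAt {q : ℕ} (η : Fin q → Bool) (i : Fin q) : Fin q → Bool := fun k => if k = i then !η k else η k

theorem flipAt_self {q : ℕ} (η : Fin q → Bool) (i : Fin q) : flipAt η i i = !η i := by simp [flipAt]

theorem flipAt_of_ne {q : ℕ} (η : Fin q → Bool) {i k : Fin q} (h : k ≠ i) : flipAt η i k = η k := by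
  simp [flipAt, h]

theorem flipAt_flipAt {q : ℕ} (η : Fin q → Bool) (i : Fin q) : flipAt (flipAt η i) i = η := by
  ext k; by_cases h : k = i <;> simp [flipAt, h]

theorem flipAt_comm {q : ℕ} (η : Fin q → Bool) (i j : Fin q) :
    flipAt (flipAt η i) j = flipAt (flipAt η j) i := by
  ext k
  by_cases h : k = i <;> by_cases h' : k = j <;> subst_vars <;> simp [flipAt, *]

theorem flipAt_ne {q : ℕ} (η : Fin q → Bool) (i : Fin q) : flipAt η i ≠ η := fun h => by
  have := congrFun h i
  rw [flipAt_self] at this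
  simp at this

theorem flipAt_injective {q : ℕ} (η : Fin q → Bool) {i j : Fin q} (h : flipAt η i = flipAt η j) : i = j := by
  by_contra hij
  have := congrFun h i
  rw [flipAt_self, flipAt_of_ne _ hij] at this
  simp at this

theorem eq_flipAt {q : ℕ} {η η' : Fin q → Bool} {i : Fin q} (hne : η ≠ η')
    (h : ∀ k, k ≠ i → η' k = η k) : η' = flipAt η i := by
  ext k
  by_cases hk : k = i
  · subst hk
    rw [flipAt_self]
    by_contra h2
    refine hne (funext fun l => ?_)
    by_cases hl : l = k
    · subst hl
      revert h2
      cases η l <;> cases η' l <;> simp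
    · exact (h l hl).symm
  · rw [flipAt_of_ne _ hk, h k hk]

theorem ne_flipAt_flipAt {q : ℕ} (η : Fin q → Bool) {i j : Fin q} (h : i ≠ j) :
    η ≠ flipAt (flipAt η i) j := fun e => by
  have := congrFun e i
  rw [flipAt_of_ne _ h, flipAt_self] at this
  simp at this

variable (X) in
/-- A chart of a cube, in the sense of the definition of a cubical complex. -/
structure IsChart (C : Finset V) {q : ℕ} (φ : (Fin q → Bool) → V) : Prop where
  inj : Function.Injective φ
  range_eq : Set.range φ = (C : Set V)
  face_iff : ∀ F : Finset V, F ⊆ C → (F ∈ X.cubes ↔ ∃ (J : Finset (Fin q)) (ε : Fin q → Bool),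
        (F : Set V) = φ '' {η | ∀ i, i ∉ J → η i = ε i})

theorem exists_isChart {C : Finset V} (hC : C ∈ X.cubes) :
    ∃ (q : ℕ) (φ : (Fin q → Bool) → V), X.IsChart C φ := by
  obtain ⟨q, φ, h1, h2, h3⟩ := X.exists_chart C hC
  exact ⟨q, φ, h1, h2, h3⟩

theorem card_of_eq_image {q : ℕ} {φ : (Fin q → Bool) → V} (hφ : Function.Injective φ) {F : Finset V}
    {J : Finset (Fin q)} {ε : Fin q → Bool} (h : (F : Set V) = φ '' {η | ∀ i, i ∉ J → η i = ε i}) :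
    F.card = 2 ^ J.card := by
  classical
  have h1 : F = (Fintype.piFinset fun i => if i ∈ J then Finset.univ else {ε i}).image φ := by
    ext v
    rw [← Finset.mem_coe, h]
    simp only [Set.mem_image, Set.mem_ofPred_eq, Finset.mem_image, Fintype.mem_piFinset]
    refine exists_congr fun η => and_congr_left fun _ => forall_congr' fun i => ?_
    by_cases hi : i ∈ J <;> simp [hi]
  rw [h1, Finset.card_image_of_injective _ hφ, Fintype.card_piFinset]
  calc _ = ∏ i : Fin q, if i ∈ J then 2 else 1 := by
        refine Finset.prod_congr rfl fun i _ => ?_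
        by_cases hi : i ∈ J <;> simp [hi]
    _ = 2 ^ J.card := by rw [Finset.prod_ite_mem]; simp

namespace IsChart

variable {C : Finset V} {q : ℕ} {φ : (Fin q → Bool) → V} (hφ : X.IsChart C φ)
include hφ

theorem mem (η : Fin q → Bool) : φ η ∈ C := by
  rw [← Finset.mem_coe, ← hφ.range_eq]; exact ⟨η, rfl⟩

theorem exists_eq {v : V} (hv : v ∈ C) : ∃ η, φ η = v := by
  rwa [← Finset.mem_coe, ← hφ.range_eq] at hv

theorem card_eq : C.card = 2 ^ q := by
  have h := card_of_eq_image (F := C) (J := Finset.univ) (ε := fun _ => true) hφ.inj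
    (by rw [← hφ.range_eq]; simp)
  simpa using h

/-- The face through a given vertex in given directions. -/
theorem exists_face (η : Fin q → Bool) (J : Finset (Fin q)) :
    ∃ F : X.Cube, F.1 ⊆ C ∧ F.1.card = 2 ^ J.card ∧ ∀ η', φ η' ∈ F.1 ↔ ∀ i, i ∉ J → η' i = η i := by
  classical
  have hfin : (φ '' {η' | ∀ i, i ∉ J → η' i = η i}).Finite := Set.toFinite _
  have hsub : hfin.toFinset ⊆ C := by
    intro v hv
    obtain ⟨η', -, rfl⟩ := hfin.mem_toFinset.1 hv
    exact hφ.mem η'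
  refine ⟨⟨hfin.toFinset, (hφ.face_iff _ hsub).2 ⟨J, η, by simp⟩⟩, hsub,
    card_of_eq_image hφ.inj (ε := η) (by simp), fun η' => ?_⟩
  simp only [Set.Finite.mem_toFinset, Set.mem_image, Set.mem_ofPred_eq]
  constructor
  · rintro ⟨η'', h, e⟩
    rw [← hφ.inj e]; exact h
  · exact fun h => ⟨η', h, rfl⟩

/-- A subcube is a face in the directions of a set of coordinates. -/
theorem exists_directions (F : X.Cube) (hF : F.1 ⊆ C) :
    ∃ J : Finset (Fin q), F.1.card = 2 ^ J.card ∧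
      ∀ η, φ η ∈ F.1 → ∀ η', φ η' ∈ F.1 ↔ ∀ i, i ∉ J → η' i = η i := by
  obtain ⟨J, ε, h⟩ := (hφ.face_iff F.1 hF).1 F.2
  refine ⟨J, card_of_eq_image hφ.inj h, fun η hη η' => ?_⟩
  have key : ∀ η, φ η ∈ F.1 ↔ ∀ i, i ∉ J → η i = ε i := fun η => by
    rw [← Finset.mem_coe, h]
    constructor
    · rintro ⟨η'', h, e⟩
      rw [← hφ.inj e]; exact h
    · exact fun h => ⟨η, h, rfl⟩
  rw [key] at hη ⊢
  exact forall₂_congr fun i hi => by rw [hη i hi]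

theorem adj_flipAt (η : Fin q → Bool) (i : Fin q) : X.skeleton.Adj (φ η) (φ (flipAt η i)) := by
  refine ⟨fun h => flipAt_ne η i (hφ.inj h).symm, ?_⟩
  obtain ⟨F, hF, hcard, hmem⟩ := hφ.exists_face η {i}
  refine ⟨⟨F.1, F.2, by simpa using hcard⟩, ?_⟩
  ext v
  constructor
  · intro hv
    obtain ⟨η', rfl⟩ := hφ.exists_eq (hF hv)
    have h := (hmem η').1 hv
    by_cases he : η = η'
    · exact Or.inl (by rw [he])
    · exact Or.inr (by rw [eq_flipAt he fun k hk => h k (by simpa using hk)]; rfl)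
  · rintro (rfl | rfl)
    · exact (hmem η).2 fun _ _ => rfl
    · exact (hmem _).2 fun k hk => flipAt_of_ne η (by simpa using hk)

theorem exists_flipAt_of_adj {η : Fin q → Bool} {v : V} (h : X.skeleton.Adj (φ η) v) (hv : v ∈ C) :
    ∃ i, v = φ (flipAt η i) := by
  obtain ⟨η', rfl⟩ := hφ.exists_eq hv
  obtain ⟨hne, e, he⟩ := h
  have hsub : e.1 ⊆ C := by
    intro u hu
    have : u ∈ (e.1 : Set V) := hu
    rw [he] at this
    rcases this with rfl | rfl
    · exact hφ.mem _
    · exact hv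
  obtain ⟨J, hJ, hmem⟩ := hφ.exists_directions ⟨e.1, e.2.1⟩ hsub
  rw [e.2.2] at hJ
  have hJ1 : J.card = 1 := by
    have : 2 ^ 1 = 2 ^ J.card := hJ
    exact (Nat.pow_right_injective le_rfl this).symm
  obtain ⟨i, rfl⟩ := Finset.card_eq_one.1 hJ1
  have h1 : φ η ∈ e.1 := by
    rw [← Finset.mem_coe, he]; exact Or.inl rfl
  have h2 : φ η' ∈ e.1 := by
    rw [← Finset.mem_coe, he]; exact Or.inr rfl
  refine ⟨i, congrArg φ (eq_flipAt (fun h => hne (by rw [h])) fun k hk => ?_)⟩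
  exact (hmem η h1 η').1 h2 k (by simpa using hk)

end IsChart

theorem exists_card_eq_two_pow (C : X.Cube) : ∃ q, C.1.card = 2 ^ q := by
  obtain ⟨q, φ, h⟩ := exists_isChart C.2
  exact ⟨q, h.card_eq⟩

variable (X) in
/-- `a`, `b`, `c`, `d` are the vertices of a square, in cyclic order. -/
structure Square (a b c d : V) : Prop where
  ab : X.skeleton.Adj a b
  bc : X.skeleton.Adj b c
  ad : X.skeleton.Adj a d
  dc : X.skeleton.Adj d c
  bd : b ≠ d
  ac : a ≠ c
  exists_cube : ∃ S : X.Cube, (S.1 : Set V) = {a, b, c, d}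

theorem Square.swap {a b c d : V} (h : X.Square a b c d) : X.Square a d c b :=
  ⟨h.ad, h.dc, h.ab, h.bc, h.bd.symm, h.ac, by
    obtain ⟨S, hS⟩ := h.exists_cube
    refine ⟨S, hS.trans ?_⟩
    ext; simp; tauto⟩

theorem Square.rotate {a b c d : V} (h : X.Square a b c d) : X.Square b a d c :=
  ⟨h.ab.symm, h.ad, h.bc, h.dc.symm, h.ac, h.bd, by
    obtain ⟨S, hS⟩ := h.exists_cube
    refine ⟨S, hS.trans ?_⟩
    ext; simp; tauto⟩

theorem Square.opposite {a b c d : V} (h : X.Square a b c d) : X.Square c b a d :=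
  h.rotate.swap.rotate

theorem Square.card {a b c d : V} (h : X.Square a b c d) {S : X.Cube}
    (hS : (S.1 : Set V) = {a, b, c, d}) : S.1.card = 4 := by
  classical
  have : S.1 = {a, b, c, d} := by
    ext v; rw [← Finset.mem_coe, hS]; simp
  rw [this]
  have h1 := h.ab.1
  have h2 := h.bc.1
  have h3 := h.ad.1
  have h4 := h.dc.1
  have h5 := h.bd
  have h6 := h.ac
  rw [Finset.card_insert_of_notMem, Finset.card_insert_of_notMem, Finset.card_insert_of_notMem,
    Finset.card_singleton] <;> simp <;> tauto

theorem IsChart.square {C : Finset V} {q : ℕ} {φ : (Fin q → Bool) → V} (hφ : X.IsChart C φ)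
    (η : Fin q → Bool) {i j : Fin q} (hij : i ≠ j) :
    X.Square (φ η) (φ (flipAt η i)) (φ (flipAt (flipAt η i) j)) (φ (flipAt η j)) := by
  refine ⟨hφ.adj_flipAt _ _, hφ.adj_flipAt _ _, hφ.adj_flipAt _ _, ?_,
    fun h => hij (flipAt_injective η (hφ.inj h)), fun h => ne_flipAt_flipAt η hij (hφ.inj h), ?_⟩
  · rw [flipAt_comm]; exact hφ.adj_flipAt _ _
  · obtain ⟨F, hF, hcard, hmem⟩ := hφ.exists_face η {i, j}
    refine ⟨F, ?_⟩
    ext v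
    constructor
    · intro hv
      obtain ⟨η', rfl⟩ := hφ.exists_eq (hF hv)
      have h := (hmem η').1 hv
      have hk : ∀ k, k ≠ j → k ≠ i → η' k = η k := fun k h1 h2 => h k (by simp [h1, h2])
      by_cases hi : η' i = η i
      · have h2 : ∀ k, k ≠ j → η' k = η k := fun k hkj => by
          by_cases hki : k = i
          · rw [hki, hi]
          · exact hk k hkj hki
        by_cases he : η = η'
        · exact Or.inl (by rw [he])
        · exact Or.inr (Or.inr (Or.inr (by rw [eq_flipAt he h2]; rfl)))
      · have h2 : ∀ k, k ≠ j → η' k = flipAt η i k := fun k hkj => by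
          by_cases hki : k = i
          · rw [hki, flipAt_self]
            revert hi
            cases η i <;> cases η' i <;> simp
          · rw [flipAt_of_ne _ hki, hk k hkj hki]
        by_cases he : flipAt η i = η'
        · exact Or.inr (Or.inl (by rw [he]))
        · exact Or.inr (Or.inr (Or.inl (by rw [eq_flipAt he h2])))
    · rintro (rfl | rfl | rfl | rfl) <;> refine (hmem _).2 fun k hk => ?_ <;>
        simp only [Finset.mem_insert, Finset.mem_singleton, not_or] at hk <;>
        simp [flipAt, hk.1, hk.2]

/-- Both cardinalities are powers of two, so a subcube with more than half of the vertices is the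
whole cube. -/
theorem eq_of_card_lt {C F : X.Cube} (h : F.1 ⊆ C.1) (hc : C.1.card < 2 * F.1.card) : F = C := by
  obtain ⟨m, hm⟩ := exists_card_eq_two_pow F
  obtain ⟨n, hn⟩ := exists_card_eq_two_pow C
  refine Subtype.ext (Finset.eq_of_subset_of_card_le h ?_)
  rw [hm, hn, ← pow_succ'] at hc
  rw [hm, hn]
  exact Nat.pow_le_pow_right two_pos (Nat.lt_succ_iff.1 ((Nat.pow_lt_pow_iff_right one_lt_two).1 hc))

/-- The intersection of the two squares is a cube containing three of the four vertices of the
first, hence all of them. -/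
theorem Square.fourth_unique {a b c c' d : V} (h : X.Square a b c d) (h' : X.Square a b c' d) :
    c = c' := by
  classical
  obtain ⟨S, hS⟩ := h.exists_cube
  obtain ⟨S', hS'⟩ := h'.exists_cube
  have memS : ∀ v, v ∈ S.1 ↔ v = a ∨ v = b ∨ v = c ∨ v = d := fun v => by
    rw [← Finset.mem_coe, hS]; simp
  have memS' : ∀ v, v ∈ S'.1 ↔ v = a ∨ v = b ∨ v = c' ∨ v = d := fun v => by
    rw [← Finset.mem_coe, hS']; simp
  obtain ⟨F, hF, hFe⟩ := X.inter_mem S.1 S.2 S'.1 S'.2 ⟨a, by simp [memS], by simp [memS']⟩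
  have memF : ∀ v, v ∈ F ↔ v ∈ S.1 ∧ v ∈ S'.1 := fun v => by
    rw [← Finset.mem_coe, hFe]; simp
  have h3 : ({a, b, d} : Finset V) ⊆ F := by
    intro v hv
    simp only [Finset.mem_insert, Finset.mem_singleton] at hv
    rw [memF, memS, memS']; tauto
  have h4 : ({a, b, d} : Finset V).card = 3 := by
    rw [Finset.card_insert_of_notMem, Finset.card_insert_of_notMem, Finset.card_singleton]
    · simpa using h.bd
    · simpa using ⟨h.ab.1, h.ad.1⟩
  have h5 := Finset.card_le_card h3
  have h6 : (⟨F, hF⟩ : X.Cube) = S := eq_of_card_lt (fun v hv => ((memF v).1 hv).1)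
    (by rw [h.card hS]; change 4 < 2 * F.card; omega)
  have h7 : c ∈ S'.1 := ((memF c).1 (by
    have : F = S.1 := congrArg Subtype.val h6
    rw [this, memS]; tauto)).2
  rw [memS'] at h7
  rcases h7 with e | e | e | e
  · exact absurd e.symm h.ac
  · exact absurd e.symm h.bc.1
  · exact e
  · exact absurd e.symm h.dc.1

theorem Square.side_unique {a b b' c d : V} (h : X.Square a b c d) (h' : X.Square a b' c d) :
    b = b' := by
  have h1 : X.Square d a b c := h.swap.rotate
  have h2 : X.Square d a b' c := h'.swap.rotate
  exact h1.fourth_unique h2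

/-- The cube condition: three squares at a vertex that pairwise share an edge span a cube. -/
theorem IsCAT0.exists_cube_corner (hX : X.IsCAT0) {b v c₁ c₂ a d e : V} (h1 : X.Square b v a c₁)
    (h2 : X.Square b v d c₂) (h3 : X.Square b c₁ e c₂) :
    ∃ f, X.Square v a f d ∧ X.Square e c₁ a f ∧ X.Square e c₂ d f := by
  classical
  have hcube : ∀ {a b c d : V}, X.Square a b c d → ∃ C : X.Cube, a ∈ C.1 ∧ b ∈ C.1 ∧ d ∈ C.1 := by
    intro a b c d h
    obtain ⟨S, hS⟩ := h.exists_cube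
    refine ⟨S, ?_, ?_, ?_⟩ <;> rw [← Finset.mem_coe, hS] <;> simp
  have hcomm : ∀ {a b d : V}, (∃ C : X.Cube, a ∈ C.1 ∧ b ∈ C.1 ∧ d ∈ C.1) →
      ∃ C : X.Cube, a ∈ C.1 ∧ d ∈ C.1 ∧ b ∈ C.1 := by
    rintro a b d ⟨C, h1, h2, h3⟩; exact ⟨C, h1, h3, h2⟩
  have hself : ∀ {a b d : V}, (∃ C : X.Cube, a ∈ C.1 ∧ b ∈ C.1 ∧ d ∈ C.1) →
      ∃ C : X.Cube, a ∈ C.1 ∧ b ∈ C.1 ∧ b ∈ C.1 := by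
    rintro a b d ⟨C, h1, h2, h3⟩; exact ⟨C, h1, h2, h2⟩
  -- The three squares say that the neighbours `v`, `c₁`, `c₂` are pairwise adjacent in the link of
  -- `b`.
  obtain ⟨C, hbC, hSC⟩ := hX.flag b {v, c₁, c₂} (by
    intro x hx
    simp only [Finset.mem_insert, Finset.mem_singleton] at hx
    rcases hx with rfl | rfl | rfl
    · exact h1.ab
    · exact h1.ad
    · exact h2.ad) (by
    intro x hx y hy
    simp only [Finset.mem_insert, Finset.mem_singleton] at hx hy
    rcases hx with rfl | rfl | rfl <;> rcases hy with rfl | rfl | rfl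
    · exact hself (hcube h1)
    · exact hcube h1
    · exact hcube h2
    · exact hcomm (hcube h1)
    · exact hself (hcube h3)
    · exact hcube h3
    · exact hcomm (hcube h2)
    · exact hcomm (hcube h3)
    · exact hself (hcomm (hcube h2)))
  obtain ⟨q, φ, hφ⟩ := exists_isChart C.2
  obtain ⟨η, rfl⟩ := hφ.exists_eq hbC
  obtain ⟨i, rfl⟩ := hφ.exists_flipAt_of_adj h1.ab (hSC (by simp))
  obtain ⟨j, rfl⟩ := hφ.exists_flipAt_of_adj h1.ad (hSC (by simp))
  obtain ⟨k, rfl⟩ := hφ.exists_flipAt_of_adj h2.ad (hSC (by simp))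
  have hij : i ≠ j := fun h => h1.bd (by rw [h])
  have hik : i ≠ k := fun h => h2.bd (by rw [h])
  have hjk : j ≠ k := fun h => h3.bd (by rw [h])
  -- By uniqueness of the fourth vertex, the given squares are coordinate squares of the chart. The
  -- vertex opposite to `b` in the 3-cube is the required `f`.
  obtain rfl := h1.fourth_unique (hφ.square η hij)
  obtain rfl := h2.fourth_unique (hφ.square η hik)
  obtain rfl := h3.fourth_unique (hφ.square η hjk)
  refine ⟨φ (flipAt (flipAt (flipAt η i) j) k), hφ.square _ hjk, ?_, ?_⟩
  · have := (hφ.square (flipAt η j) hik).swap.rotate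
    rwa [flipAt_comm η j i] at this
  · have := (hφ.square (flipAt η k) hij).swap.rotate
    rwa [flipAt_comm η k j, flipAt_comm η k i, flipAt_comm _ k j] at this

end Charts

end CubicalComplex

/-! ### Edge paths up to swaps, and the quadrangle condition. -/

namespace CubicalComplex

section Geodesics

variable {V : Type*} {X : CubicalComplex V}

open SimpleGraph

variable (X) in
/-- The equivalence relation on edge paths that is generated by pushing two consecutive edges of a
square across that square. -/
inductive SwapEq : ∀ {u v : V}, X.skeleton.Walk u v → X.skeleton.Walk u v → Prop
  | refl {u v : V} (p : X.skeleton.Walk u v) : SwapEq p p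
  | symm {u v : V} {p q : X.skeleton.Walk u v} : SwapEq p q → SwapEq q p
  | trans {u v : V} {p q r : X.skeleton.Walk u v} : SwapEq p q → SwapEq q r → SwapEq p r
  | cons {u v x : V} (h : X.skeleton.Adj u v) {p q : X.skeleton.Walk v x} :
      SwapEq p q → SwapEq (.cons h p) (.cons h q)
  | square {a b c d x : V} (hs : X.Square a b c d) (p : X.skeleton.Walk c x) :
      SwapEq (.cons hs.ab (.cons hs.bc p)) (.cons hs.ad (.cons hs.dc p))

theorem SwapEq.length_eq {u v : V} {p q : X.skeleton.Walk u v} (h : X.SwapEq p q) :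
    p.length = q.length := by
  induction h with
  | refl => rfl
  | symm _ ih => exact ih.symm
  | trans _ _ h1 h2 => exact h1.trans h2
  | cons h _ ih => simpa using ih
  | square hs p => rfl

variable (X) in
/-- Two edge paths agree up to swaps in the following explicit way: either they begin with the same
edge and continue equivalently, or they begin with the two initial edges of a square and can be
continued across that square. -/
inductive InitialSwap : ∀ {u v : V}, X.skeleton.Walk u v → X.skeleton.Walk u v → Prop
  | nil {u : V} : InitialSwap (.nil : X.skeleton.Walk u u) .nil
  | same {u v x : V} (h : X.skeleton.Adj u v) {p q : X.skeleton.Walk v x} :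
      X.SwapEq p q → InitialSwap (.cons h p) (.cons h q)
  | square {a b c d x : V} (hs : X.Square a b c d) {p : X.skeleton.Walk b x}
      {q : X.skeleton.Walk d x} (r : X.skeleton.Walk c x) : X.SwapEq p (.cons hs.bc r) →
      X.SwapEq q (.cons hs.dc r) → InitialSwap (.cons hs.ab p) (.cons hs.ad q)

theorem InitialSwap.refl {u v : V} (p : X.skeleton.Walk u v) : X.InitialSwap p p := by
  cases p with
  | nil => exact .nil
  | cons h p => exact .same h (.refl p)

theorem InitialSwap.symm {u v : V} {p q : X.skeleton.Walk u v} (h : X.InitialSwap p q) :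
    X.InitialSwap q p := by
  cases h with
  | nil => exact .nil
  | same h e => exact .same h e.symm
  | square hs r e1 e2 => exact .square hs.swap r e2 e1

/-- The hard case is two squares at the initial vertex that share the first edge of `q`. The
hypothesis for shorter paths compares the two resulting continuations of `q`. If they begin alike,
the two squares coincide. Otherwise they span a third square, the cube condition completes the
corner to a 3-cube, and the face of it containing the first edges of `p` and `t` relates these two
paths. -/
theorem InitialSwap.trans (hX : X.IsCAT0) {n : ℕ}
    (ih : ∀ {u v : V} {p q : X.skeleton.Walk u v}, p.length < n → X.SwapEq p q → X.InitialSwap p q)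
    {u v : V} {p q t : X.skeleton.Walk u v} (hn : q.length = n)
    (h : X.InitialSwap p q) (h' : X.InitialSwap q t) : X.InitialSwap p t := by
  cases h with
  | nil => exact h'
  | same h e =>
    cases h' with
    | same _ e' => exact .same h (e.trans e')
    | square hs r e1 e2 => exact .square hs r (e.trans e1) e2
  | @square a c₁ b _ hs p q r₁ e1 e2 =>
    cases h' with
    | same _ e' => exact .square hs r₁ e1 (e'.symm.trans e2)
    | @square _ c₂ d _ hs' _ t r₂ f1 f2 =>
      have h3 : X.InitialSwap (.cons hs.dc r₁) (.cons hs'.bc r₂) := by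
        refine ih ?_ (e2.symm.trans f1)
        rw [← e2.length_eq, ← hn]
        simp
      have key : ∀ {c₁ c₂ : V} (hs : X.Square u a c₁ b) (hs' : X.Square u b c₂ d)
          (h1 : X.skeleton.Adj b c₁) (h2 : X.skeleton.Adj b c₂) (r₁ : X.skeleton.Walk c₁ v)
          (r₂ : X.skeleton.Walk c₂ v), X.SwapEq p (.cons hs.bc r₁) → X.SwapEq t (.cons hs'.dc r₂) →
          X.InitialSwap (.cons h1 r₁) (.cons h2 r₂) →
          X.InitialSwap (.cons hs.ab p) (.cons hs'.ad t) := by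
        intro c₁ c₂ hs hs' h1 h2 r₁ r₂ e1 f2 h3
        cases h3 with
        | same _ e3 =>
          obtain rfl := hs.side_unique hs'.swap
          exact .same _ (e1.trans ((SwapEq.cons _ e3).trans f2.symm))
        | @square _ e _ _ hs3 _ _ r₃ g1 g2 =>
          obtain ⟨f, k1, k2, k3⟩ := hX.exists_cube_corner hs.swap.rotate hs'.rotate hs3
          exact .square k1 (.cons k2.ad.symm r₃)
            (e1.trans ((SwapEq.cons _ g1).trans (SwapEq.square k2.opposite r₃)))
            (f2.trans ((SwapEq.cons _ g2).trans (SwapEq.square k3.opposite r₃)))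
      exact key hs hs' hs.dc hs'.bc r₁ r₂ e1 f2 h3

/-- A chain of swaps of any length reduces to at most one swap of the two initial edges, modulo
swaps further along. This makes swap equivalence tractable: it gives left cancellation, and a square
whenever equivalent paths begin differently. -/
theorem SwapEq.initialSwap (hX : X.IsCAT0) {u v : V} {p q : X.skeleton.Walk u v} (h : X.SwapEq p q) :
    X.InitialSwap p q := by
  obtain ⟨n, hn⟩ : ∃ n, p.length = n := ⟨_, rfl⟩
  induction n using Nat.strong_induction_on generalizing u v p q with
  | _ n ih =>
    induction h with
    | refl p => exact .refl p
    | symm e h => exact (h (e.length_eq.trans hn)).symm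
    | trans e1 e2 h1 h2 =>
      have hq := e1.length_eq.symm.trans hn
      exact InitialSwap.trans hX (fun hlt e => ih _ hlt e rfl) hq (h1 hn) (h2 hq)
    | cons h e _ => exact .same h e
    | square hs p => exact .square hs p (.refl _) (.refl _)


theorem SwapEq.cancel (hX : X.IsCAT0) {u v x : V} {h h' : X.skeleton.Adj u v} {p q : X.skeleton.Walk v x}
    (e : X.SwapEq (.cons h p) (.cons h' q)) : X.SwapEq p q := by
  cases e.initialSwap hX with
  | same _ e => exact e
  | square hs => exact absurd rfl hs.bd

theorem SwapEq.exists_square (hX : X.IsCAT0) {u a b x : V} {ha : X.skeleton.Adj u a}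
    {hb : X.skeleton.Adj u b} {p : X.skeleton.Walk a x} {q : X.skeleton.Walk b x}
    (e : X.SwapEq (.cons ha p) (.cons hb q)) (hab : a ≠ b) :
    ∃ (c : V) (hs : X.Square u a c b) (r : X.skeleton.Walk c x),
      X.SwapEq p (.cons hs.bc r) ∧ X.SwapEq q (.cons hs.dc r) := by
  cases e.initialSwap hX with
  | same _ e => exact absurd rfl hab
  | square hs r e1 e2 => exact ⟨_, hs, r, e1, e2⟩

/-- An edge path is reduced if no sequence of swaps leads to a backtracking. -/
def IsReduced : ∀ {u v : V}, X.skeleton.Walk u v → Prop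
  | _, _, .nil => True
  | _, _, .cons h p => IsReduced p ∧ ∀ q, ¬ X.SwapEq p (.cons h.symm q)

/-- Suppose the paths begin along the two sides of a square with vertices `u`, `a`, `c`, `b`. If the
second one could turn back from `b` to `u`, there would be a square on the edges from `b` to `c` and
to `u`. It must be the same square, and then the first path could turn back from `c` to `a`. -/
theorem IsReduced.of_swapEq (hX : X.IsCAT0) {u v : V} {p q : X.skeleton.Walk u v} (hp : IsReduced p)
    (h : X.SwapEq p q) : IsReduced q := by
  obtain ⟨n, hn⟩ : ∃ n, p.length = n := ⟨_, rfl⟩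
  induction n using Nat.strong_induction_on generalizing u v p q with
  | _ n ih =>
    cases h.initialSwap hX with
    | nil => exact hp
    | same h e =>
      refine ⟨ih _ (by rw [← hn]; simp) hp.1 e rfl, fun r hr => hp.2 r (e.trans hr)⟩
    | @square a c b _ hs p q r e1 e2 =>
      have h1 : IsReduced (.cons hs.bc r) := ih _ (by rw [← hn]; simp) hp.1 e1 rfl
      have h2 : IsReduced (.cons hs.dc r) := by
        refine ⟨h1.1, fun t ht => hp.2 (.cons hs.ad t) ?_⟩
        exact e1.trans ((SwapEq.cons _ ht).trans (SwapEq.square hs.rotate.swap t))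
      have hl : (Walk.cons hs.dc r).length < n := by
        rw [← hn, Walk.length_cons, Walk.length_cons, e1.length_eq, Walk.length_cons]; omega
      refine ⟨ih _ hl h2 e2.symm rfl, fun t ht => ?_⟩
      obtain ⟨f, hs', r', g1, g2⟩ := (e2.symm.trans ht).exists_square hX hs.ac.symm
      obtain rfl : f = a := by
        have h3 : X.Square b c a u := hs.swap.rotate.swap
        exact hs'.fourth_unique h3
      exact h1.2 r' g1

open Classical in
/-- Extend an edge path by an edge at its initial vertex, or else remove this edge. -/
noncomputable def prolong {u v x : V} (h : X.skeleton.Adj v u) (p : X.skeleton.Walk v x) :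
    X.skeleton.Walk u x :=
  if H : ∃ q, X.SwapEq p (.cons h q) then H.choose else .cons h.symm p

theorem prolong_of_swapEq (hX : X.IsCAT0) {u v x : V} {h : X.skeleton.Adj v u}
    {p : X.skeleton.Walk v x} {q : X.skeleton.Walk u x} (e : X.SwapEq p (.cons h q)) :
    X.SwapEq (prolong h p) q := by
  have H : ∃ q, X.SwapEq p (.cons h q) := ⟨q, e⟩
  rw [prolong, dif_pos H]
  exact SwapEq.cancel hX (H.choose_spec.symm.trans e)

theorem prolong_of_not {u v x : V} {h : X.skeleton.Adj v u} {p : X.skeleton.Walk v x}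
    (e : ∀ q, ¬ X.SwapEq p (.cons h q)) : prolong h p = .cons h.symm p := by
  rw [prolong, dif_neg (not_exists.2 e)]

theorem IsReduced.prolong (hX : X.IsCAT0) {u v x : V} (h : X.skeleton.Adj v u)
    {p : X.skeleton.Walk v x} (hp : IsReduced p) : IsReduced (prolong h p) := by
  by_cases H : ∃ q, X.SwapEq p (.cons h q)
  · obtain ⟨q, hq⟩ := H
    exact (hp.of_swapEq hX hq).1.of_swapEq hX (prolong_of_swapEq hX hq).symm
  · rw [prolong_of_not (not_exists.1 H)]
    exact ⟨hp, not_exists.1 H⟩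

theorem SwapEq.prolong (hX : X.IsCAT0) {u v x : V} (h : X.skeleton.Adj v u)
    {p q : X.skeleton.Walk v x} (e : X.SwapEq p q) :
    X.SwapEq (prolong h p) (CubicalComplex.prolong h q) := by
  by_cases H : ∃ r, X.SwapEq p (.cons h r)
  · obtain ⟨r, hr⟩ := H
    exact (prolong_of_swapEq hX hr).trans (prolong_of_swapEq hX (e.symm.trans hr)).symm
  · rw [prolong_of_not (not_exists.1 H), prolong_of_not fun r hr => H ⟨r, e.trans hr⟩]
    exact .cons _ e

/-- Invariance under backtracking. Reducedness ensures that an edge removed by the first step is put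
back by the second instead of cancelling again. -/
theorem prolong_prolong (hX : X.IsCAT0) {u v x : V} (h : X.skeleton.Adj v u)
    {p : X.skeleton.Walk v x} (hp : IsReduced p) : X.SwapEq (prolong h.symm (prolong h p)) p := by
  by_cases H : ∃ q, X.SwapEq p (.cons h q)
  · obtain ⟨q, hq⟩ := H
    refine ((prolong_of_swapEq hX hq).prolong hX h.symm).trans ?_
    have := (hp.of_swapEq hX hq).2
    rw [prolong_of_not this]
    exact hq.symm
  · rw [prolong_of_not (not_exists.1 H)]
    exact prolong_of_swapEq hX (.refl _)

theorem prolong_square_aux (hX : X.IsCAT0) {a b c d x : V} (hs : X.Square a b c d)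
    {p : X.skeleton.Walk a x} {q : X.skeleton.Walk b x}
    (hq : X.SwapEq p (.cons hs.ab q)) (hd : ∀ q, ¬ X.SwapEq p (.cons hs.ad q)) :
    X.SwapEq (prolong hs.bc (prolong hs.ab p)) (prolong hs.dc (prolong hs.ad p)) := by
  have h1 : ∀ t, ¬ X.SwapEq q (.cons hs.bc t) := fun t ht =>
    hd (.cons hs.dc t) (hq.trans ((SwapEq.cons _ ht).trans (.square hs t)))
  refine ((prolong_of_swapEq hX hq).prolong hX hs.bc).trans ?_
  rw [prolong_of_not h1, prolong_of_not hd]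
  refine (prolong_of_swapEq hX ((SwapEq.cons _ hq).trans ?_)).symm
  exact SwapEq.square hs.swap.rotate q

/-- Invariance under squares. The cases are whether `p` can be made to begin with each of the two
sides at `a`. If with both, it begins with a swap across this very square, and both edges are
removed on either route. If with exactly one, the routes agree by `prolong_square_aux`. If with
neither, both routes add two edges and differ by a swap. -/
theorem prolong_square (hX : X.IsCAT0) {a b c d x : V} (hs : X.Square a b c d)
    {p : X.skeleton.Walk a x} :
    X.SwapEq (prolong hs.bc (prolong hs.ab p)) (prolong hs.dc (prolong hs.ad p)) := by
  by_cases H : ∃ q, X.SwapEq p (.cons hs.ab q) <;> by_cases H' : ∃ q, X.SwapEq p (.cons hs.ad q)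
  · obtain ⟨q, hq⟩ := H
    obtain ⟨q', hq'⟩ := H'
    obtain ⟨f, hs', r, e1, e2⟩ := (hq.symm.trans hq').exists_square hX hs.bd
    obtain rfl := hs'.fourth_unique hs
    refine (((prolong_of_swapEq hX hq).trans e1).prolong hX hs.bc).trans ?_
    refine SwapEq.trans ?_ (((prolong_of_swapEq hX hq').trans e2).prolong hX hs.dc).symm
    exact (prolong_of_swapEq hX (.refl _)).trans (prolong_of_swapEq hX (.refl _)).symm
  · obtain ⟨q, hq⟩ := H
    exact prolong_square_aux hX hs hq (not_exists.1 H')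
  · obtain ⟨q, hq⟩ := H'
    exact (prolong_square_aux hX hs.swap hq (not_exists.1 H)).symm
  · rw [prolong_of_not (not_exists.1 H), prolong_of_not (not_exists.1 H')]
    have key : ∀ {b d : V} (hs : X.Square a b c d), (¬ ∃ q, X.SwapEq p (.cons hs.ad q)) →
        ∀ t, ¬ X.SwapEq (.cons hs.ab.symm p) (.cons hs.bc t) := by
      intro b d hs H' t ht
      obtain ⟨f, hs', r, e1, e2⟩ := ht.exists_square hX hs.ac
      obtain rfl := hs'.fourth_unique hs.rotate
      exact H' ⟨_, e1⟩
    rw [prolong_of_not (key hs H'), prolong_of_not (key hs.swap H)]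
    exact SwapEq.square hs.opposite p

/-- The action of edge paths on reduced edge paths by `prolong`. -/
noncomputable def transport : ∀ {u v x : V}, X.skeleton.Walk v u → X.skeleton.Walk v x → X.skeleton.Walk u x
  | _, _, _, .nil, p => p
  | _, _, _, .cons h w, p => transport w (prolong h p)

theorem transport_congr (hX : X.IsCAT0) {u v x : V} (w : X.skeleton.Walk v u)
    {p q : X.skeleton.Walk v x} (h : X.SwapEq p q) : X.SwapEq (transport w p) (transport w q) := by
  induction w with
  | nil => exact h
  | cons h' w ih => exact ih (h.prolong hX h')

theorem transport_append {u v x y : V} (w : X.skeleton.Walk v u) (w' : X.skeleton.Walk u y)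
    (p : X.skeleton.Walk v x) : transport (w.append w') p = transport w' (transport w p) := by
  induction w with
  | nil => rfl
  | cons h' w ih => exact ih _ _

/-- Homotopic paths act in the same way on classes of reduced paths, since the generating moves do.
This amounts to constructing the universal cover out of reduced paths. -/
theorem transport_homotopic (hX : X.IsCAT0) {u v : V} {w w' : X.skeleton.Walk v u}
    (h : X.PathHomotopic w w') : ∀ {x : V} {p : X.skeleton.Walk v x}, IsReduced p →
    X.SwapEq (transport w p) (transport w' p) := by
  induction h with
  | refl => exact fun _ => .refl _
  | symm _ ih => exact fun hp => (ih hp).symm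
  | trans _ _ h1 h2 => exact fun hp => (h1 hp).trans (h2 hp)
  | cons h _ ih => exact fun hp => ih (hp.prolong hX h)
  | backtrack h w => exact fun hp => transport_congr hX w (prolong_prolong hX h hp)
  | @square a b c d x hab hbc had hdc S hS w =>
    intro y p hp
    by_cases hbd : b = d
    · subst hbd; exact .refl _
    -- The definition of homotopy allows degenerate squares. For `b ≠ d`, the equality `a = c` would
    -- give a cube with three vertices, which is not a power of two.
    · have hac : a ≠ c := by
        rintro rfl
        classical
        obtain ⟨q, hq⟩ := exists_card_eq_two_pow S
        have h1 : S.1 = {a, b, d} := by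
          ext v; rw [← Finset.mem_coe, hS]; simp; tauto
        rw [h1, Finset.card_insert_of_notMem (by simpa using ⟨hab.1, had.1⟩),
          Finset.card_insert_of_notMem (by simpa using hbd), Finset.card_singleton] at hq
        rcases q with _ | _ | q
        · simp at hq
        · simp at hq
        · rw [pow_succ, pow_succ] at hq; omega
      exact transport_congr hX w (prolong_square hX ⟨hab, hbc, had, hdc, hbd, hac, S, hS⟩)

/-- Building a reduced path up edge by edge from its end never removes an edge, so the path is
recovered. -/
theorem transport_reverse_nil (hX : X.IsCAT0) {u v : V} {p : X.skeleton.Walk u v} (hp : IsReduced p) :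
    X.SwapEq (transport p.reverse (.nil : X.skeleton.Walk v v)) p := by
  induction p with
  | nil => exact .refl _
  | cons h p ih =>
    rw [Walk.reverse_cons, transport_append]
    refine (transport_congr hX _ (ih hp.1)).trans ?_
    change X.SwapEq (prolong h.symm p) _
    rw [prolong_of_not hp.2]
    exact .refl _

/-- Two reduced paths with the same end points differ by swaps. -/
theorem IsReduced.swapEq (hX : X.IsCAT0) {u v : V} {p q : X.skeleton.Walk u v} (hp : IsReduced p)
    (hq : IsReduced q) : X.SwapEq p q := by
  -- The loop made of `q` reversed followed by `p` acts trivially. Hence transporting `q` along `p`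
  -- gives the trivial path, and transporting back along `p` reversed identifies `q` with `p`.
  have h1 := transport_homotopic hX (hX.simplyConnected v (q.reverse.append p))
    (p := (.nil : X.skeleton.Walk v v)) trivial
  rw [transport_append] at h1
  have h2 : X.SwapEq (transport p q) .nil :=
    (transport_congr hX p (transport_reverse_nil hX hq)).symm.trans h1
  have h3 : X.SwapEq (transport p.reverse (transport p q)) q := by
    rw [← transport_append]
    have h4 : X.PathHomotopic (p.append p.reverse) .nil := hX.simplyConnected _ _
    exact transport_homotopic hX h4 hq
  exact (transport_reverse_nil hX hp).symm.trans ((transport_congr hX _ h2).symm.trans h3)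

/-- Swaps preserve the length, so a backtracking reached by swaps could be removed to give a path
shorter than the distance. -/
theorem isReduced_of_length_eq_dist {u v : V} {p : X.skeleton.Walk u v}
    (h : p.length = X.skeleton.dist u v) : IsReduced p := by
  induction p with
  | nil => trivial
  | @cons u w v h' p ih =>
    rw [Walk.length_cons] at h
    have h1 : X.skeleton.dist w v ≤ p.length := dist_le p
    have h2 : X.skeleton.dist u v ≤ X.skeleton.dist w v + 1 := by
      have hr : X.skeleton.Reachable w v := ⟨p⟩
      obtain ⟨r, hr⟩ := hr.exists_walk_length_eq_dist
      rw [← hr]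
      exact dist_le (.cons h' r)
    refine ⟨ih (by omega), fun q hq => ?_⟩
    have h3 := hq.length_eq
    rw [Walk.length_cons] at h3
    have h4 := dist_le q
    omega

theorem IsCAT0.exists_geodesic (hX : X.IsCAT0) (u v : V) :
    ∃ p : X.skeleton.Walk u v, p.length = X.skeleton.dist u v :=
  hX.connected.exists_walk_length_eq_dist u v

/-- The quadrangle condition. -/
theorem IsCAT0.quadrangle (hX : X.IsCAT0) {P v a b : V} (ha : X.skeleton.Adj v a)
    (hb : X.skeleton.Adj v b) (hab : a ≠ b)
    (hda : X.skeleton.dist v P = X.skeleton.dist a P + 1)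
    (hdb : X.skeleton.dist v P = X.skeleton.dist b P + 1) :
    ∃ c, X.Square v a c b ∧ X.skeleton.dist c P < X.skeleton.dist a P := by
  obtain ⟨p, hp⟩ := hX.exists_geodesic a P
  obtain ⟨q, hq⟩ := hX.exists_geodesic b P
  -- Both ways from `v` to `P` are geodesics, hence reduced and swap-equivalent. They begin with
  -- different edges, so these edges span a square across which both paths can be pushed.
  have h1 : IsReduced (.cons ha p) := isReduced_of_length_eq_dist (by rw [Walk.length_cons]; omega)
  have h2 : IsReduced (.cons hb q) := isReduced_of_length_eq_dist (by rw [Walk.length_cons]; omega)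
  obtain ⟨c, hs, r, e1, e2⟩ := (h1.swapEq hX h2).exists_square hX hab
  refine ⟨c, hs, ?_⟩
  have := e1.length_eq
  rw [Walk.length_cons] at this
  have := dist_le r
  omega

/-- Together with simple connectivity this makes every loop even. The graph is then bipartite, and
distances to a fixed vertex change by exactly one along an edge. -/
theorem PathHomotopic.length_mod_two {u v : V} {p q : X.skeleton.Walk u v} (h : X.PathHomotopic p q) :
    p.length % 2 = q.length % 2 := by
  induction h with
  | refl => rfl
  | symm _ ih => exact ih.symm
  | trans _ _ h1 h2 => exact h1.trans h2
  | cons h _ ih => simp only [Walk.length_cons]; omega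
  | backtrack h w => simp only [Walk.length_cons]; omega
  | square => simp only [Walk.length_cons]

theorem IsCAT0.dist_ne (hX : X.IsCAT0) {u v : V} (P : V) (h : X.skeleton.Adj u v) :
    X.skeleton.dist u P ≠ X.skeleton.dist v P := by
  intro he
  obtain ⟨p, hp⟩ := hX.exists_geodesic u P
  obtain ⟨q, hq⟩ := hX.exists_geodesic v P
  have := (hX.simplyConnected u ((Walk.cons h q).append p.reverse)).length_mod_two
  rw [Walk.length_append, Walk.length_reverse, Walk.length_cons, Walk.length_nil] at this
  omega

theorem IsCAT0.dist_adj (hX : X.IsCAT0) {u v : V} (P : V) (h : X.skeleton.Adj u v) :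
    X.skeleton.dist u P = X.skeleton.dist v P + 1 ∨ X.skeleton.dist v P = X.skeleton.dist u P + 1 := by
  have h1 : ∀ {u v : V}, X.skeleton.Adj u v → X.skeleton.dist u P ≤ X.skeleton.dist v P + 1 := by
    intro u v h
    obtain ⟨q, hq⟩ := hX.exists_geodesic v P
    have := dist_le (Walk.cons h q)
    rw [Walk.length_cons] at this
    omega
  have h2 := h1 h
  have h3 := h1 h.symm
  have h4 := hX.dist_ne P h
  omega

end Geodesics

end CubicalComplex

/-! ### Half-spaces of hyperplanes, and the faces selected by them. -/

namespace CubicalComplex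

section Hyperplanes

variable {V : Type*} {X : CubicalComplex V}

/-- The vertices `a` and `b` are joined by an edge that is cut by `H`. -/
def Crosses (H : X.Hyperplane) (a b : V) : Prop :=
  ∃ e : X.Edge, (e.1 : Set V) = {a, b} ∧ hyperplaneOf e = H

theorem Crosses.symm {H : X.Hyperplane} {a b : V} (h : Crosses H a b) : Crosses H b a :=
  h.imp fun _ he => ⟨he.1.trans (Set.pair_comm _ _), he.2⟩

theorem Crosses.unique {H K : X.Hyperplane} {a b : V} (h : Crosses H a b) (h' : Crosses K a b) :
    H = K := by
  obtain ⟨e, he, rfl⟩ := h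
  obtain ⟨f, hf, rfl⟩ := h'
  have : e = f := Subtype.ext (Finset.coe_injective (he.trans hf.symm))
  rw [this]

theorem edge_eq_pair (e : X.Edge) : ∃ a b, a ≠ b ∧ (e.1 : Set V) = {a, b} := by
  classical
  obtain ⟨a, b, hab, h⟩ := Finset.card_eq_two.1 e.2.2
  exact ⟨a, b, hab, by rw [h]; simp⟩

theorem Crosses.adj {H : X.Hyperplane} {a b : V} (h : Crosses H a b) : X.skeleton.Adj a b := by
  obtain ⟨e, he, -⟩ := h
  refine ⟨?_, e, he⟩
  rintro rfl
  have h1 : e.1 = {a} := by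
    ext v; rw [← Finset.mem_coe, he]; simp
  have := e.2.2
  rw [h1] at this
  simp at this

theorem exists_crosses_of_hyperplane (H : X.Hyperplane) : ∃ a b, Crosses H a b := by
  induction H using Quot.ind with
  | mk e =>
    obtain ⟨a, b, -, h⟩ := edge_eq_pair e
    exact ⟨a, b, e, h, rfl⟩

theorem complementGraph_adj {H : X.Hyperplane} {a b : V} :
    (complementGraph H).Adj a b ↔ X.skeleton.Adj a b ∧ ¬ Crosses H a b := by
  constructor
  · rintro ⟨hne, e, he, hH⟩
    refine ⟨⟨hne, e, he⟩, fun h => hH ?_⟩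
    exact Crosses.unique ⟨e, he, rfl⟩ h
  · rintro ⟨⟨hne, e, he⟩, h⟩
    exact ⟨hne, e, he, fun hH => h ⟨e, he, hH⟩⟩

theorem mem_mid_iff_crosses {C : X.Cube} {H : X.Hyperplane} :
    H ∈ Mid C ↔ ∃ a ∈ C.1, ∃ b ∈ C.1, Crosses H a b := by
  rw [mem_mid]
  constructor
  · rintro ⟨e, he, hH⟩
    obtain ⟨a, b, -, h⟩ := edge_eq_pair e
    refine ⟨a, he ?_, b, he ?_, e, h, hH⟩ <;> rw [← Finset.mem_coe, h] <;> simp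
  · rintro ⟨a, ha, b, hb, e, he, hH⟩
    refine ⟨e, fun v hv => ?_, hH⟩
    rw [← Finset.mem_coe, he] at hv
    rcases hv with rfl | rfl
    · exact ha
    · exact hb

theorem mid_mono {C D : X.Cube} (h : C.1 ⊆ D.1) {H : X.Hyperplane} (hH : H ∈ Mid C) : H ∈ Mid D := by
  rw [mem_mid] at *
  obtain ⟨e, he, h'⟩ := hH
  exact ⟨e, he.trans h, h'⟩

theorem Square.crosses {H : X.Hyperplane} {a b c d : V} (h : X.Square a b c d) (hH : Crosses H a b) :
    Crosses H d c := by
  obtain ⟨e, he, rfl⟩ := hH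
  obtain ⟨-, f, hf⟩ := h.dc
  obtain ⟨S, hS⟩ := h.exists_cube
  refine ⟨f, hf, (Quot.sound ⟨S, h.card hS, ?_, ?_, ?_⟩ : hyperplaneOf e = hyperplaneOf f).symm⟩
  · rw [← Finset.coe_subset, he, hS]
    rintro v (rfl | rfl) <;> simp
  · rw [← Finset.coe_subset, hf, hS]
    rintro v (rfl | rfl) <;> simp
  · rw [← Finset.disjoint_coe, he, hf, Set.disjoint_left]
    have h1 := h.ad.1
    have h2 := h.bc.1
    have h3 := h.bd
    have h4 := h.ac
    rintro v (rfl | rfl) (rfl | rfl) <;> tauto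

theorem exists_square_of_opposite {e f : X.Edge} (h : X.OppositeInSquare e f) :
    ∃ a b c d, X.Square a b c d ∧ (e.1 : Set V) = {a, b} ∧ (f.1 : Set V) = {d, c} := by
  obtain ⟨S, hcard, heS, hfS, hdisj⟩ := h
  obtain ⟨q, φ, hφ⟩ := exists_isChart S.2
  have hq : q = 2 := by
    have := hφ.card_eq
    rw [hcard, show 4 = 2 ^ 2 from rfl] at this
    exact (Nat.pow_right_injective le_rfl this).symm
  subst hq
  obtain ⟨a, b, hab, he⟩ := edge_eq_pair e
  obtain ⟨c', d', hcd, hf⟩ := edge_eq_pair f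
  have ha : a ∈ S.1 := heS (by rw [← Finset.mem_coe, he]; simp)
  have hb : b ∈ S.1 := heS (by rw [← Finset.mem_coe, he]; simp)
  have hc : c' ∈ S.1 := hfS (by rw [← Finset.mem_coe, hf]; simp)
  have hd : d' ∈ S.1 := hfS (by rw [← Finset.mem_coe, hf]; simp)
  obtain ⟨η, rfl⟩ := hφ.exists_eq ha
  obtain ⟨i, rfl⟩ := hφ.exists_flipAt_of_adj (⟨hab, e, he⟩ : X.skeleton.Adj _ _) hb
  obtain ⟨k, hk⟩ : ∃ k : Fin 2, i ≠ k := by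
    fin_cases i
    · exact ⟨1, by simp⟩
    · exact ⟨0, by simp⟩
  have hall : ∀ l : Fin 2, l ≠ k → l = i := by
    intro l hl
    rw [Fin.ext_iff, ne_eq, Fin.ext_iff] at *
    have h1 := i.2
    have h2 := k.2
    have h3 := l.2
    omega
  have hs := hφ.square η hk
  have key : ∀ v ∈ f.1, v = φ (flipAt η k) ∨ v = φ (flipAt (flipAt η i) k) := by
    intro v hv
    obtain ⟨η', rfl⟩ := hφ.exists_eq (hfS hv)
    have hve : φ η' ∉ e.1 := fun h => Finset.disjoint_left.1 hdisj h hv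
    rw [← Finset.mem_coe, he, Set.mem_insert_iff, Set.mem_singleton_iff, not_or] at hve
    have h1 : η ≠ η' := fun h => hve.1 (by rw [h])
    have h2 : flipAt η i ≠ η' := fun h => hve.2 (by rw [h])
    by_cases hi : η' i = η i
    · exact Or.inl (congrArg φ (eq_flipAt h1 fun l hl => by rw [hall l hl, hi]))
    · refine Or.inr (congrArg φ (eq_flipAt h2 fun l hl => ?_))
      rw [hall l hl, flipAt_self]
      revert hi
      cases η i <;> cases η' i <;> simp
  refine ⟨_, _, _, _, hs, he, ?_⟩
  have hc2 := key c' (by rw [← Finset.mem_coe, hf]; simp)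
  have hd2 := key d' (by rw [← Finset.mem_coe, hf]; simp)
  rw [hf]
  rcases hc2 with rfl | rfl <;> rcases hd2 with rfl | rfl
  · exact absurd rfl hcd
  · rfl
  · exact Set.pair_comm _ _
  · exact absurd rfl hcd

variable (X) in
/-- The vertex `x` is closer to `a` than to `b`. -/
def Closer (a b x : V) : Prop := X.skeleton.dist a x < X.skeleton.dist b x

/-- Otherwise `a` and `c` would both be one step closer to `x` than `b`. The quadrangle condition
then yields a square on the edges from `b` to `a` and `c` whose fourth vertex is closer still. That
vertex is `d`, which is not closer. -/
theorem Square.closer (hX : X.IsCAT0) {a b c d : V} (h : X.Square a b c d) {x : V}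
    (hx : X.Closer a b x) : X.Closer d c x := by
  unfold Closer at *
  have h1 := hX.dist_adj x h.ab
  have h2 := hX.dist_adj x h.bc
  have h3 := hX.dist_adj x h.ad
  have h4 := hX.dist_adj x h.dc
  by_contra hcon
  obtain ⟨z, hz, hlt⟩ := hX.quadrangle (P := x) h.ab.symm h.bc h.ac (by omega) (by omega)
  obtain rfl := hz.fourth_unique h.rotate
  omega

theorem closer_iff_of_square (hX : X.IsCAT0) {a b c d : V} (h : X.Square a b c d) {x : V} :
    X.Closer a b x ↔ X.Closer d c x :=
  ⟨h.closer hX, (h.swap.rotate.swap).closer hX⟩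

theorem closer_swap (hX : X.IsCAT0) {a b : V} (h : X.skeleton.Adj a b) (x : V) :
    X.Closer b a x ↔ ¬ X.Closer a b x := by
  have := hX.dist_ne x h
  unfold Closer
  omega

/-- The edge `e` does not separate `x` from `y`. -/
def EdgeSame (e : X.Edge) (x y : V) : Prop :=
  ∀ a b, (e.1 : Set V) = {a, b} → (X.Closer a b x ↔ X.Closer a b y)

theorem edgeSame_iff (hX : X.IsCAT0) {e : X.Edge} {a b : V} (hab : a ≠ b)
    (he : (e.1 : Set V) = {a, b}) {x y : V} :
    EdgeSame e x y ↔ (X.Closer a b x ↔ X.Closer a b y) := by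
  refine ⟨fun h => h a b he, fun h c d hcd => ?_⟩
  rw [he] at hcd
  rcases Set.pair_eq_pair_iff.1 hcd with ⟨rfl, rfl⟩ | ⟨rfl, rfl⟩
  · exact h
  · have h1 : X.skeleton.Adj a b := ⟨hab, e, he⟩
    rw [closer_swap hX h1, closer_swap hX h1, h]

theorem edgeSame_of_opposite (hX : X.IsCAT0) {e f : X.Edge} (h : X.OppositeInSquare e f) (x y : V) :
    EdgeSame e x y ↔ EdgeSame f x y := by
  obtain ⟨a, b, c, d, hs, he, hf⟩ := exists_square_of_opposite h
  rw [edgeSame_iff hX hs.ab.1 he, edgeSame_iff hX hs.dc.1 hf, closer_iff_of_square hX hs,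
    closer_iff_of_square hX hs]

/-- The hyperplane `H` does not separate `x` from `y`. -/
def SameSide (H : X.Hyperplane) (x y : V) : Prop :=
  ∀ a b, Crosses H a b → (X.Closer a b x ↔ X.Closer a b y)

/-- A single edge cut by `H` decides sides, because all edges cut by `H` are linked by passages
across squares, and each of these preserves the partition. -/
theorem sameSide_iff (hX : X.IsCAT0) {H : X.Hyperplane} {a b : V} (h : Crosses H a b) {x y : V} :
    SameSide H x y ↔ (X.Closer a b x ↔ X.Closer a b y) := by
  refine ⟨fun hs => hs a b h, fun hs c d hcd => ?_⟩
  obtain ⟨e, he, rfl⟩ := id h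
  obtain ⟨f, hf, hef⟩ := id hcd
  have key : ∀ e f : X.Edge, Relation.EqvGen X.OppositeInSquare e f →
      (EdgeSame e x y ↔ EdgeSame f x y) := by
    intro e f h
    induction h with
    | rel _ _ h => exact edgeSame_of_opposite hX h x y
    | refl => exact Iff.rfl
    | symm _ _ _ ih => exact ih.symm
    | trans _ _ _ _ _ h1 h2 => exact h1.trans h2
  have h2 := key f e (Quot.eqvGen_exact hef)
  rw [edgeSame_iff hX h.adj.1 he, edgeSame_iff hX hcd.adj.1 hf] at h2
  exact h2.2 hs

theorem SameSide.refl (H : X.Hyperplane) (x : V) : SameSide H x x := fun _ _ _ => Iff.rfl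

theorem SameSide.symm {H : X.Hyperplane} {x y : V} (h : SameSide H x y) : SameSide H y x :=
  fun a b hab => (h a b hab).symm

theorem SameSide.trans {H : X.Hyperplane} {x y z : V} (h : SameSide H x y) (h' : SameSide H y z) :
    SameSide H x z :=
  fun a b hab => (h a b hab).trans (h' a b hab)

theorem sameSide_of_not (hX : X.IsCAT0) {H : X.Hyperplane} {x y z : V} (h : ¬ SameSide H x y)
    (h' : ¬ SameSide H x z) : SameSide H y z := by
  obtain ⟨a, b, hab⟩ := exists_crosses_of_hyperplane H
  rw [sameSide_iff hX hab] at *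
  tauto

theorem exists_adj_dist (hX : X.IsCAT0) {x a : V} (h : X.skeleton.dist x a ≠ 0) :
    ∃ z, X.skeleton.Adj x z ∧ X.skeleton.dist x a = X.skeleton.dist z a + 1 := by
  obtain ⟨p, hp⟩ := hX.exists_geodesic x a
  cases p with
  | nil => rw [SimpleGraph.Walk.length_nil] at hp; exact absurd hp.symm h
  | cons h' p =>
    refine ⟨_, h', ?_⟩
    have h1 := SimpleGraph.dist_le p
    rw [SimpleGraph.Walk.length_cons] at hp
    have := hX.dist_adj a h'
    omega

theorem eq_of_dist_eq_zero (hX : X.IsCAT0) {x a : V} (h : X.skeleton.dist x a = 0) : x = a :=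
  (hX.connected x a).dist_eq_zero_iff.1 h

/-- An edge joining the two sides of `ab` is parallel to `ab`. The quadrangle condition gives a
square that moves it one step closer to `ab`, and the induction is on the distance to `a`. -/
theorem crosses_of_closer (hX : X.IsCAT0) {H : X.Hyperplane} {a b : V} (hab : Crosses H a b) (n : ℕ) :
    ∀ {x y : V}, X.skeleton.Adj x y → X.skeleton.dist x a = n → X.Closer a b x → X.Closer b a y →
      Crosses H x y := by
  induction n with
  | zero =>
    intro x y hxy hn hx hy
    have h0 := eq_of_dist_eq_zero hX hn
    subst h0
    have h1 := hX.dist_adj b hxy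
    have h2 := hX.dist_adj x hxy
    unfold Closer at hx hy
    have h3 := hX.dist_adj x hab.adj
    rw [SimpleGraph.dist_self] at *
    rw [SimpleGraph.dist_comm (u := b) (v := y), SimpleGraph.dist_comm (u := x) (v := y)] at hy
    have h4 : y = b := eq_of_dist_eq_zero hX (by omega)
    rwa [h4]
  | succ n ih =>
    intro x y hxy hn hx hy
    unfold Closer at hx hy
    rw [SimpleGraph.dist_comm (u := a) (v := x), SimpleGraph.dist_comm (u := b) (v := x)] at hx
    rw [SimpleGraph.dist_comm (u := a) (v := y), SimpleGraph.dist_comm (u := b) (v := y)] at hy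
    have e1 := hX.dist_adj a hxy
    have e2 := hX.dist_adj b hxy
    have e3 := hX.dist_adj x hab.adj
    have e4 := hX.dist_adj y hab.adj
    rw [SimpleGraph.dist_comm (u := a) (v := x), SimpleGraph.dist_comm (u := b) (v := x)] at e3
    rw [SimpleGraph.dist_comm (u := a) (v := y), SimpleGraph.dist_comm (u := b) (v := y)] at e4
    obtain ⟨z, hyz, hz⟩ := exists_adj_dist hX (x := y) (a := b) (by omega)
    have e5 := hX.dist_adj a hyz
    have e6 := hX.dist_adj z hab.adj
    rw [SimpleGraph.dist_comm (u := a) (v := z), SimpleGraph.dist_comm (u := b) (v := z)] at e6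
    obtain ⟨u, hs, hu⟩ := hX.quadrangle (P := a) hxy.symm hyz (by rintro rfl; omega) (by omega)
      (by omega)
    have e7 := hX.dist_adj a hs.dc
    have e8 := hX.dist_adj b hs.dc
    have e9 := hX.dist_adj b hs.bc
    refine hs.opposite.swap.crosses (ih hs.dc.symm (by omega) ?_ ?_)
    · unfold Closer
      rw [SimpleGraph.dist_comm (u := a) (v := u), SimpleGraph.dist_comm (u := b) (v := u)]
      omega
    · unfold Closer
      rw [SimpleGraph.dist_comm (u := a) (v := z), SimpleGraph.dist_comm (u := b) (v := z)]
      omega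

/-- An edge is cut by `H` if and only if `H` separates its end points. -/
theorem sameSide_iff_not_crosses (hX : X.IsCAT0) {H : X.Hyperplane} {x y : V}
    (h : X.skeleton.Adj x y) : SameSide H x y ↔ ¬ Crosses H x y := by
  constructor
  · intro hs hc
    rw [sameSide_iff hX hc] at hs
    unfold Closer at hs
    have h1 := hX.dist_adj x h
    have h2 := hX.dist_adj y h
    simp only [SimpleGraph.dist_self] at *
    omega
  · intro hc
    by_contra hs
    obtain ⟨a, b, hab⟩ := exists_crosses_of_hyperplane H
    rw [sameSide_iff hX hab] at hs
    have hx := closer_swap hX hab.adj x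
    have hy := closer_swap hX hab.adj y
    by_cases h1 : X.Closer a b x
    · exact hc (crosses_of_closer hX hab _ h rfl h1 (by tauto))
    · exact hc (crosses_of_closer hX hab _ h.symm rfl (by tauto) (by tauto)).symm

/-- A geodesic towards `a` from a vertex closer to `a` than to `b` stays among such vertices, so it
never crosses `H`. -/
theorem reachable_of_closer (hX : X.IsCAT0) {H : X.Hyperplane} {a b : V} (hab : Crosses H a b) (n : ℕ) :
    ∀ {x : V}, X.skeleton.dist x a = n → X.Closer a b x → (complementGraph H).Reachable x a := by
  induction n with
  | zero =>
    intro x hn hx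
    rw [eq_of_dist_eq_zero hX hn]
  | succ n ih =>
    intro x hn hx
    obtain ⟨z, hxz, hz⟩ := exists_adj_dist hX (x := x) (a := a) (by omega)
    have h1 := hX.dist_adj b hxz
    have hz2 : X.Closer a b z := by
      unfold Closer at *
      rw [SimpleGraph.dist_comm (u := a) (v := x), SimpleGraph.dist_comm (u := b) (v := x)] at hx
      rw [SimpleGraph.dist_comm (u := a) (v := z), SimpleGraph.dist_comm (u := b) (v := z)]
      omega
    refine SimpleGraph.Reachable.trans (SimpleGraph.Adj.reachable ?_) (ih (by omega) hz2)
    rw [complementGraph_adj]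
    refine ⟨hxz, (sameSide_iff_not_crosses hX hxz).1 ?_⟩
    rw [sameSide_iff hX hab]
    tauto

/-- This converts separation, defined by components of the complement, into the metric form. In that
form it is immediate that there are just two sides. -/
theorem reachable_iff_sameSide (hX : X.IsCAT0) {H : X.Hyperplane} {x y : V} :
    (complementGraph H).Reachable x y ↔ SameSide H x y := by
  constructor
  · rintro ⟨p⟩
    induction p with
    | nil => exact .refl H _
    | cons h p ih =>
      rw [complementGraph_adj] at h
      exact ((sameSide_iff_not_crosses hX h.1).2 h.2).trans ih
  · intro h
    obtain ⟨a, b, hab⟩ := exists_crosses_of_hyperplane H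
    rw [sameSide_iff hX hab] at h
    by_cases hx : X.Closer a b x
    · exact (reachable_of_closer hX hab _ rfl hx).trans (reachable_of_closer hX hab _ rfl (h.1 hx)).symm
    · have hx' := (closer_swap hX hab.adj x).2 hx
      have hy' := (closer_swap hX hab.adj y).2 fun hy => hx (h.2 hy)
      exact (reachable_of_closer hX hab.symm _ rfl hx').trans
        (reachable_of_closer hX hab.symm _ rfl hy').symm

/-- A hyperplane cuts at most one of the edges at a given vertex. -/
theorem Crosses.eq_of_left (hX : X.IsCAT0) {H : X.Hyperplane} {v a b : V} (ha : Crosses H v a)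
    (hb : Crosses H v b) : a = b := by
  have h := mt (sameSide_iff_not_crosses hX hb.adj).1 (not_not.2 hb)
  rw [sameSide_iff hX ha] at h
  unfold Closer at h
  have h1 := hX.dist_adj v ha.adj
  have h2 := hX.dist_adj b ha.adj
  have h3 := hX.dist_adj v hb.adj
  rw [SimpleGraph.dist_self] at *
  rw [SimpleGraph.dist_comm (u := v) (v := b)] at *
  exact eq_of_dist_eq_zero hX (by omega)

theorem separates_iff (hX : X.IsCAT0) {H : X.Hyperplane} {C : X.Cube} {P : V} :
    Separates H C P ↔ H ∉ Mid C ∧ ∀ v ∈ C.1, ¬ SameSide H P v := by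
  simp only [Separates, reachable_iff_sameSide hX]

namespace IsChart

variable {C : X.Cube} {q : ℕ} {φ : (Fin q → Bool) → V} (hφ : X.IsChart C.1 φ)
include hφ

/-- Parallel edges of a cube are cut by the same hyperplane. The set `S` bounds where the base
points may differ, and its coordinates are changed one at a time across squares. -/
theorem crosses_flipAt {H : X.Hyperplane} {i : Fin q} (S : Finset (Fin q)) :
    ∀ {η η' : Fin q → Bool}, (∀ k, k ∉ S → η' k = η k) → Crosses H (φ η) (φ (flipAt η i)) →
      Crosses H (φ η') (φ (flipAt η' i)) := by
  induction S using Finset.induction_on with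
  | empty =>
    intro η η' h hc
    rwa [funext fun k => h k (Finset.notMem_empty k)]
  | insert j S _ ih =>
    intro η η' h hc
    by_cases hj : η' j = η j
    · refine ih (fun k hk => ?_) hc
      by_cases hkj : k = j
      · rw [hkj, hj]
      · exact h k (by simp [hk, hkj])
    · refine ih (η := flipAt η j) (fun k hk => ?_) ?_
      · by_cases hkj : k = j
        · rw [hkj, flipAt_self]
          revert hj
          cases η j <;> cases η' j <;> simp
        · rw [flipAt_of_ne _ hkj, h k (by simp [hk, hkj])]
      · by_cases hij : i = j
        · subst hij
          rw [flipAt_flipAt]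
          exact hc.symm
        · have := (hφ.square η hij).crosses hc
          rwa [flipAt_comm] at this

theorem crosses_flipAt' {H : X.Hyperplane} {i : Fin q} {η : Fin q → Bool}
    (h : Crosses H (φ η) (φ (flipAt η i))) (η' : Fin q → Bool) :
    Crosses H (φ η') (φ (flipAt η' i)) :=
  hφ.crosses_flipAt Finset.univ (by simp) h

theorem direction_unique (hX : X.IsCAT0) {H : X.Hyperplane} {i j : Fin q} {η η' : Fin q → Bool}
    (h : Crosses H (φ η) (φ (flipAt η i))) (h' : Crosses H (φ η') (φ (flipAt η' j))) : i = j := by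
  have h1 := hφ.crosses_flipAt' h' η
  exact flipAt_injective η (hφ.inj (h.eq_of_left hX h1))

theorem exists_direction {H : X.Hyperplane} {a b : V} (ha : a ∈ C.1) (hb : b ∈ C.1)
    (h : Crosses H a b) : ∃ i η, a = φ η ∧ b = φ (flipAt η i) := by
  obtain ⟨η, rfl⟩ := hφ.exists_eq ha
  obtain ⟨i, rfl⟩ := hφ.exists_flipAt_of_adj h.adj hb
  exact ⟨i, η, rfl, rfl⟩

theorem mem_mid_iff {H : X.Hyperplane} :
    H ∈ Mid C ↔ ∃ i, ∀ η, Crosses H (φ η) (φ (flipAt η i)) := by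
  rw [mem_mid_iff_crosses]
  constructor
  · rintro ⟨a, ha, b, hb, h⟩
    obtain ⟨i, η, rfl, rfl⟩ := hφ.exists_direction ha hb h
    exact ⟨i, hφ.crosses_flipAt' h⟩
  · rintro ⟨i, h⟩
    exact ⟨_, hφ.mem (fun _ => true), _, hφ.mem _, h _⟩

theorem sameSide_of_forall (hX : X.IsCAT0) {H : X.Hyperplane} (S : Finset (Fin q)) :
    ∀ {η η' : Fin q → Bool}, (∀ k, k ∉ S → η' k = η k) →
      (∀ k ∈ S, ¬ Crosses H (φ η) (φ (flipAt η k))) → SameSide H (φ η) (φ η') := by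
  induction S using Finset.induction_on with
  | empty =>
    intro η η' h hc
    rw [funext fun k => h k (Finset.notMem_empty k)]
    exact .refl _ _
  | insert j S _ ih =>
    intro η η' h hc
    by_cases hj : η' j = η j
    · refine ih (fun k hk => ?_) fun k hk => hc k (Finset.mem_insert_of_mem hk)
      by_cases hkj : k = j
      · rw [hkj, hj]
      · exact h k (by simp [hk, hkj])
    · refine ((sameSide_iff_not_crosses hX (hφ.adj_flipAt η j)).2
        (hc j (Finset.mem_insert_self _ _))).trans (ih (η := flipAt η j) (fun k hk => ?_) ?_)
      · by_cases hkj : k = j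
        · rw [hkj, flipAt_self]
          revert hj
          cases η j <;> cases η' j <;> simp
        · rw [flipAt_of_ne _ hkj, h k (by simp [hk, hkj])]
      · exact fun k hk hcr => hc k (Finset.mem_insert_of_mem hk) (hφ.crosses_flipAt' hcr η)

/-- Changing any coordinate other than `i` does not cross `H`, since a hyperplane cuts a cube in
only one direction. -/
theorem sameSide_iff_eq (hX : X.IsCAT0) {H : X.Hyperplane} {i : Fin q}
    (h : ∀ η, Crosses H (φ η) (φ (flipAt η i))) {η η' : Fin q → Bool} :
    SameSide H (φ η) (φ η') ↔ η' i = η i := by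
  have key : ∀ {η η' : Fin q → Bool}, η' i = η i → SameSide H (φ η) (φ η') := by
    intro η η' he
    refine hφ.sameSide_of_forall hX (Finset.univ.erase i) (fun k hk => ?_) fun k hk hc => ?_
    · have : k = i := by simpa using hk
      rw [this, he]
    · exact Finset.ne_of_mem_erase hk (hφ.direction_unique hX hc (h η))
  refine ⟨fun hs => ?_, key⟩
  by_contra hne
  have h1 : SameSide H (φ (flipAt η i)) (φ η') := key (by
    rw [flipAt_self]
    revert hne
    cases η i <;> cases η' i <;> simp)
  exact (sameSide_iff_not_crosses hX (h η).adj).1 (hs.trans h1.symm) (h η)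

end IsChart

theorem sameSide_of_notMem_mid (hX : X.IsCAT0) {C : X.Cube} {H : X.Hyperplane} (h : H ∉ Mid C)
    {u v : V} (hu : u ∈ C.1) (hv : v ∈ C.1) : SameSide H u v := by
  obtain ⟨q, φ, hφ⟩ := exists_isChart C.2
  obtain ⟨η, rfl⟩ := hφ.exists_eq hu
  obtain ⟨η', rfl⟩ := hφ.exists_eq hv
  refine hφ.sameSide_of_forall hX Finset.univ (by simp) fun k _ hc => h ?_
  exact hφ.mem_mid_iff.2 ⟨k, hφ.crosses_flipAt' hc⟩

theorem Cube.nonempty (C : X.Cube) : ∃ v, v ∈ C.1 := by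
  obtain ⟨q, φ, hφ⟩ := exists_isChart C.2
  exact ⟨_, hφ.mem fun _ => true⟩

theorem step_of (hX : X.IsCAT0) {P : V} {C D : X.Cube} {H : X.Hyperplane} (hCD : IsFacet C D)
    (hD : H ∈ Mid D) (hC : H ∉ Mid C) {v : V} (hv : v ∈ C.1) (hs : ¬ SameSide H P v) :
    Step P C H D := by
  refine ⟨⟨⟨hC, D, hCD, hD⟩, (separates_iff hX).2 ⟨hC, fun u hu h => hs ?_⟩⟩, hCD, hD⟩
  exact h.trans (sameSide_of_notMem_mid hX hC hu hv)

theorem Step.notMem {P : V} {C D : X.Cube} {H : X.Hyperplane} (h : Step P C H D) : H ∉ Mid C :=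
  h.1.1.1

theorem Step.not_sameSide (hX : X.IsCAT0) {P : V} {C D : X.Cube} {H : X.Hyperplane}
    (h : Step P C H D) {v : V} (hv : v ∈ C.1) : ¬ SameSide H P v :=
  ((separates_iff hX).1 h.1.2).2 v hv

/-- The coordinates of a codimension-one face. -/
theorem Step.exists_chart {P : V} {C D : X.Cube} {H : X.Hyperplane}
    (h : Step P C H D) {q : ℕ} {φ : (Fin q → Bool) → V} (hφ : X.IsChart D.1 φ) :
    ∃ (i : Fin q) (η : Fin q → Bool), φ η ∈ C.1 ∧ (∀ η, Crosses H (φ η) (φ (flipAt η i))) ∧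
      ∀ η', φ η' ∈ C.1 ↔ η' i = η i := by
  obtain ⟨J, hJ, hmem⟩ := hφ.exists_directions C h.2.1.1
  obtain ⟨v, hv⟩ := C.nonempty
  obtain ⟨η, rfl⟩ := hφ.exists_eq (h.2.1.1 hv)
  have hq := hφ.card_eq
  rw [h.2.1.2, hJ, ← pow_succ'] at hq
  have hq' : J.card + 1 = q := Nat.pow_right_injective le_rfl hq
  have h1 : Jᶜ.card = 1 := by rw [Finset.card_compl, Fintype.card_fin]; omega
  obtain ⟨i, hi⟩ := Finset.card_eq_one.1 h1
  have hiJ : ∀ k, k ∉ J ↔ k = i := fun k => by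
    rw [← Finset.mem_compl, hi, Finset.mem_singleton]
  have hmem' : ∀ η', φ η' ∈ C.1 ↔ η' i = η i := fun η' => by
    rw [hmem η hv]; simp [hiJ]
  obtain ⟨j, hj⟩ := hφ.mem_mid_iff.1 h.2.2
  obtain rfl : j = i := by
    by_contra hji
    refine h.notMem (mem_mid_iff_crosses.2 ⟨_, hv, _, ?_, hj η⟩)
    rw [hmem', flipAt_of_ne _ (Ne.symm hji)]
  exact ⟨j, η, hv, hj, hmem'⟩

/-- The face of a step is the half of `D` on the far side of `H` from `P`. Hence `D` and `H`
determine it, and steps can be compared by comparing sides. -/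
theorem Step.mem_iff (hX : X.IsCAT0) {P : V} {C D : X.Cube} {H : X.Hyperplane}
    (h : Step P C H D) {v : V} : v ∈ C.1 ↔ v ∈ D.1 ∧ ¬ SameSide H P v := by
  refine ⟨fun hv => ⟨h.2.1.1 hv, h.not_sameSide hX hv⟩, fun ⟨hv, hs⟩ => ?_⟩
  obtain ⟨q, φ, hφ⟩ := exists_isChart D.2
  obtain ⟨i, η, hη, hi, hmem⟩ := h.exists_chart hφ
  obtain ⟨η', rfl⟩ := hφ.exists_eq hv
  rw [hmem, ← hφ.sameSide_iff_eq hX hi]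
  exact sameSide_of_not hX (h.not_sameSide hX hη) hs

theorem Step.mid_iff {P : V} {C D : X.Cube} {H : X.Hyperplane}
    (h : Step P C H D) {K : X.Hyperplane} : K ∈ Mid D ↔ K = H ∨ K ∈ Mid C := by
  constructor
  · intro hK
    obtain ⟨q, φ, hφ⟩ := exists_isChart D.2
    obtain ⟨i, η, hη, hi, hmem⟩ := h.exists_chart hφ
    obtain ⟨j, hj⟩ := hφ.mem_mid_iff.1 hK
    by_cases hij : j = i
    · subst hij
      exact Or.inl ((hj η).unique (hi η))
    · refine Or.inr (mem_mid_iff_crosses.2 ⟨_, hη, _, ?_, hj η⟩)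
      rw [hmem, flipAt_of_ne _ (Ne.symm hij)]
  · rintro (rfl | hK)
    · exact h.2.2
    · exact mid_mono h.2.1.1 hK

/-- As `H` separates the ends of the edges of `D` that it cuts, some vertex of `D` is on the far
side from `P`. The face of `D` through it in the remaining directions is the one wanted. -/
theorem exists_step_down (hX : X.IsCAT0) (P : V) {D : X.Cube} {H : X.Hyperplane} (hH : H ∈ Mid D) :
    ∃ C, Step P C H D := by
  obtain ⟨q, φ, hφ⟩ := exists_isChart D.2
  obtain ⟨i, hi⟩ := hφ.mem_mid_iff.1 hH
  obtain ⟨η, hη⟩ : ∃ η, ¬ SameSide H P (φ η) := by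
    by_contra hcon
    push Not at hcon
    have h1 := (hcon fun _ => true).symm.trans (hcon (flipAt (fun _ => true) i))
    exact (sameSide_iff_not_crosses hX (hi _).adj).1 h1 (hi _)
  obtain ⟨F, hF, hcard, hmem⟩ := hφ.exists_face η (Finset.univ.erase i)
  have hmem' : ∀ η', φ η' ∈ F.1 ↔ η' i = η i := fun η' => by
    rw [hmem]; simp
  refine ⟨F, step_of hX ⟨hF, ?_⟩ hH ?_ ((hmem' η).2 rfl) hη⟩
  · rw [hφ.card_eq, hcard, Finset.card_erase_of_mem (Finset.mem_univ i), Finset.card_univ,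
      Fintype.card_fin, ← pow_succ']
    have := i.2
    congr 1
    omega
  · rw [mem_mid_iff_crosses]
    rintro ⟨a, ha, b, hb, hc⟩
    obtain ⟨η₁, rfl⟩ := hφ.exists_eq (hF ha)
    obtain ⟨η₂, rfl⟩ := hφ.exists_eq (hF hb)
    rw [hmem'] at ha hb
    exact (sameSide_iff_not_crosses hX hc.adj).1 ((hφ.sameSide_iff_eq hX hi).2 (by rw [ha, hb])) hc

theorem Step.down_unique (hX : X.IsCAT0) {P : V} {C C' D : X.Cube} {H : X.Hyperplane}
    (h : Step P C H D) (h' : Step P C' H D) : C = C' := by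
  refine Subtype.ext (Finset.ext fun v => ?_)
  rw [h.mem_iff hX, h'.mem_iff hX]

theorem eq_of_adj_subset {F D : X.Cube} (hF : F.1 ⊆ D.1) {v : V} (hv : v ∈ F.1)
    (h : ∀ u ∈ D.1, X.skeleton.Adj v u → u ∈ F.1) : F = D := by
  obtain ⟨q, φ, hφ⟩ := exists_isChart D.2
  obtain ⟨J, hJ, hmem⟩ := hφ.exists_directions F hF
  obtain ⟨η, rfl⟩ := hφ.exists_eq (hF hv)
  refine Subtype.ext (Finset.Subset.antisymm hF fun u hu => ?_)
  obtain ⟨η', rfl⟩ := hφ.exists_eq hu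
  rw [hmem η hv]
  intro i hi
  have h1 := h _ (hφ.mem _) (hφ.adj_flipAt η i)
  rw [hmem η hv] at h1
  have h2 := h1 i hi
  rw [flipAt_self] at h2
  simp at h2

/-- A cube is determined by its edges at one of its vertices. If two cubes share these edges, their
intersection is a face containing all directions at `v`, so it equals both. -/
theorem finite_cubes_at (hb : X.BoundedGeometry) (v : V) : {C : X.Cube | v ∈ C.1}.Finite := by
  obtain ⟨N, hN⟩ := hb
  have hfin : {e : X.Edge | v ∈ e.1}.Finite := by
    refine Set.finite_of_encard_le_coe (hN v)
  refine Set.Finite.of_finite_image (f := fun C : X.Cube => {e : X.Edge | v ∈ e.1 ∧ e.1 ⊆ C.1})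
    (hfin.finite_subsets.subset ?_) ?_
  · rintro _ ⟨C, hC, rfl⟩
    exact fun e he => he.1
  · intro C hC D hD he
    have hCv : v ∈ C.1 := hC
    have hDv : v ∈ D.1 := hD
    obtain ⟨F, hF, hFe⟩ := X.inter_mem C.1 C.2 D.1 D.2 ⟨v, hCv, hDv⟩
    have hmem : ∀ x, x ∈ F ↔ x ∈ C.1 ∧ x ∈ D.1 := fun x => by
      rw [← Finset.mem_coe, hFe]; simp
    have key : ∀ {C D : X.Cube}, v ∈ C.1 → {e : X.Edge | v ∈ e.1 ∧ e.1 ⊆ C.1} =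
        {e : X.Edge | v ∈ e.1 ∧ e.1 ⊆ D.1} → ∀ u ∈ C.1, X.skeleton.Adj v u → u ∈ D.1 := by
      intro C D hC he u hu hvu
      obtain ⟨-, e, hee⟩ := hvu
      have h1 : e ∈ {e : X.Edge | v ∈ e.1 ∧ e.1 ⊆ C.1} := by
        refine ⟨by rw [← Finset.mem_coe, hee]; simp, ?_⟩
        rw [← Finset.coe_subset, hee]
        rintro x (rfl | rfl)
        · exact hC
        · exact hu
      rw [he] at h1
      exact h1.2 (by rw [← Finset.mem_coe, hee]; simp)
    have h1 : (⟨F, hF⟩ : X.Cube) = C := eq_of_adj_subset (fun x hx => ((hmem x).1 hx).1)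
      ((hmem v).2 ⟨hC, hD⟩) fun u hu hvu => (hmem u).2 ⟨hu, key hC he u hu hvu⟩
    have h2 : (⟨F, hF⟩ : X.Cube) = D := eq_of_adj_subset (fun x hx => ((hmem x).1 hx).2)
      ((hmem v).2 ⟨hC, hD⟩) fun u hu hvu => (hmem u).2 ⟨key hD he.symm u hu hvu, hu⟩
    exact h1.symm.trans h2

theorem finite_step_up (hb : X.BoundedGeometry) (P : V) (C : X.Cube) :
    {p : X.Cube × X.Hyperplane | Step P C p.2 p.1}.Finite := by
  obtain ⟨v, hv⟩ := C.nonempty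
  refine ((finite_cubes_at hb v).biUnion (t := fun D => ({D} : Set X.Cube) ×ˢ (Mid D : Set X.Hyperplane))
    fun D _ => (Set.finite_singleton D).prod (Mid D).finite_toSet).subset ?_
  rintro ⟨D, H⟩ h
  exact Set.mem_biUnion (h.2.1.1 hv) ⟨rfl, h.2.2⟩

theorem finite_step_down (P : V) (D : X.Cube) :
    {p : X.Cube × X.Hyperplane | Step P p.1 p.2 D}.Finite := by
  have h1 : {C : X.Cube | C.1 ⊆ D.1}.Finite :=
    Set.Finite.of_finite_image (f := fun C : X.Cube => C.1)
      ((D.1.powerset.finite_toSet).subset (by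
        rintro _ ⟨C, hC, rfl⟩
        exact Finset.mem_coe.2 (Finset.mem_powerset.2 hC))) Subtype.val_injective.injOn
  refine (h1.prod (Mid D).finite_toSet).subset ?_
  rintro ⟨C, H⟩ h
  exact ⟨h.2.1.1, h.2.2⟩

/-- In `E` the cube `C` is the part on the far side of both hyperplanes, a description that does not
depend on their order. -/
theorem step_swap (hX : X.IsCAT0) {P : V} {C D₁ E : X.Cube} {H₁ H₂ : X.Hyperplane}
    (h₁ : Step P C H₁ D₁) (h₂ : Step P D₁ H₂ E) :
    ∃ D₂, Step P C H₂ D₂ ∧ Step P D₂ H₁ E := by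
  obtain ⟨D₂, h₃⟩ := exists_step_down hX P (mid_mono h₂.2.1.1 h₁.2.2)
  have hne : H₂ ≠ H₁ := by
    rintro rfl
    exact h₂.notMem h₁.2.2
  obtain ⟨C', h₄⟩ := exists_step_down hX P (((h₃.mid_iff).1 h₂.2.2).resolve_left hne)
  obtain rfl : C' = C := by
    refine Subtype.ext (Finset.ext fun v => ?_)
    rw [h₄.mem_iff hX, h₃.mem_iff hX, h₁.mem_iff hX, h₂.mem_iff hX]
    tauto
  exact ⟨D₂, h₄, h₃⟩

end Hyperplanes

end CubicalComplex

/-! ### Integration over cubes and integration by parts. -/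

namespace CubicalComplex

section CubeIntegrals

variable {V : Type*} {X : CubicalComplex V}

/-- The hyperplanes cutting `D` are those cutting `C`, together with `H`. -/
structure MidInsert (C : X.Cube) (H : X.Hyperplane) (D : X.Cube) : Prop where
  notMem : H ∉ Mid C
  mid_iff : ∀ {K : X.Hyperplane}, K ∈ Mid D ↔ K = H ∨ K ∈ Mid C

theorem Step.midInsert {P : V} {C D : X.Cube} {H : X.Hyperplane} (h : Step P C H D) :
    MidInsert C H D := ⟨h.notMem, h.mid_iff⟩

theorem mem_unitCube {C : X.Cube} {x : Coord C} : x ∈ unitCube C ↔ ∀ i, 0 ≤ x i ∧ x i ≤ 1 :=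
  ⟨fun h i => ⟨h.1 i, h.2 i⟩, fun h => ⟨fun i => (h i).1, fun i => (h i).2⟩⟩

theorem isCompact_unitCube (C : X.Cube) : IsCompact (unitCube C) := isCompact_Icc

theorem measurableSet_unitCube (C : X.Cube) : MeasurableSet (unitCube C) := measurableSet_Icc

theorem uniqueDiffOn_unitCube (C : X.Cube) : UniqueDiffOn ℝ (unitCube C) := by
  rw [unitCube, ← Set.pi_univ_Icc]
  exact UniqueDiffOn.univ_pi fun i => uniqueDiffOn_Icc_zero_one

theorem cubeMeasure_eq_pi (C : X.Cube) :
    cubeMeasure C = Measure.pi fun _ => (volume : Measure ℝ).restrict (Set.Icc 0 1) := by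
  rw [cubeMeasure, unitCube, ← Set.pi_univ_Icc]
  exact Measure.restrict_pi_pi _ _

instance : IsProbabilityMeasure ((volume : Measure ℝ).restrict (Set.Icc 0 1)) :=
  ⟨by rw [Measure.restrict_apply_univ]; simp⟩

instance (C : X.Cube) : IsProbabilityMeasure (cubeMeasure C) := by
  rw [cubeMeasure_eq_pi]; infer_instance

theorem ae_mem_unitCube (C : X.Cube) : ∀ᵐ x ∂cubeMeasure C, x ∈ unitCube C :=
  ae_restrict_mem (measurableSet_unitCube C)

theorem aestronglyMeasurable_of_continuousOn {C : X.Cube} {f : Coord C → ℂ}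
    (hf : ContinuousOn f (unitCube C)) : AEStronglyMeasurable f (cubeMeasure C) :=
  hf.aestronglyMeasurable (measurableSet_unitCube C)

theorem integrable_of_continuousOn {C : X.Cube} {f : Coord C → ℂ}
    (hf : ContinuousOn f (unitCube C)) : Integrable f (cubeMeasure C) :=
  hf.integrableOn_compact (isCompact_unitCube C)

theorem setIntegral_Icc_eq_interval (f : ℝ → ℂ) :
    ∫ t in Set.Icc (0 : ℝ) 1, f t = ∫ t in (0 : ℝ)..1, f t := by
  rw [intervalIntegral.integral_of_le zero_le_one, integral_Icc_eq_integral_Ioc]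

theorem continuousOn_fderivWithin_unitCube {C : X.Cube} {f : Coord C → ℂ}
    (hf : ContDiffOn ℝ 1 f (unitCube C)) : ContinuousOn (fderivWithin ℝ f (unitCube C)) (unitCube C) :=
  hf.continuousOn_fderivWithin (uniqueDiffOn_unitCube C) le_rfl

variable [LinearOrder X.Hyperplane]

theorem transfer_self {C D : X.Cube} {H : X.Hyperplane} (h : MidInsert C H D) (hH : H ∈ Mid D)
    (t : ℝ) (x : Coord C) : transfer C D t x ⟨H, hH⟩ = t := by
  simp [transfer, h.notMem]

theorem transfer_of_mem {C D : X.Cube} {K : X.Hyperplane} (hC : K ∈ Mid C) (hD : K ∈ Mid D)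
    (t : ℝ) (x : Coord C) : transfer C D t x ⟨K, hD⟩ = x ⟨K, hC⟩ := by
  simp [transfer, hC]

theorem coord_transfer {C D : X.Cube} {H : X.Hyperplane} (h : MidInsert C H D) (t : ℝ) (x : Coord C) :
    coord D H (transfer C D t x) = t := by
  have hH : H ∈ Mid D := h.mid_iff.2 (Or.inl rfl)
  rw [coord, dif_pos hH, transfer_self h]

theorem transfer_transfer {C D : X.Cube} {H : X.Hyperplane} (h : MidInsert C H D) (t u : ℝ)
    (x : Coord C) : transfer D C u (transfer C D t x) = x := by
  ext ⟨K, hK⟩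
  have hKD : K ∈ Mid D := h.mid_iff.2 (Or.inr hK)
  rw [transfer_of_mem hKD, transfer_of_mem hK]

theorem transfer_mem_unitCube {C D : X.Cube} {t : ℝ} {x : Coord C} (hx : x ∈ unitCube C)
    (ht : t ∈ Set.Icc (0 : ℝ) 1) : transfer C D t x ∈ unitCube D := by
  rw [mem_unitCube] at *
  rintro ⟨K, hK⟩
  unfold transfer
  split_ifs with h
  · exact hx _
  · exact ht

theorem continuous_transfer (C D : X.Cube) :
    Continuous fun p : Coord C × ℝ => transfer C D p.2 p.1 := by
  refine continuous_pi fun K => ?_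
  unfold transfer
  split_ifs with h <;> fun_prop

/-- This is the product decomposition of a cube into a facet and an interval. A product measure is
determined by its values on boxes, so only the regrouping of the factors needs checking. -/
theorem measurePreserving_transfer {C D : X.Cube} {H : X.Hyperplane} (h : MidInsert C H D) :
    MeasurePreserving (fun p : Coord C × ℝ => transfer C D p.2 p.1)
      ((cubeMeasure C).prod ((volume : Measure ℝ).restrict (Set.Icc 0 1))) (cubeMeasure D) := by
  refine ⟨(continuous_transfer C D).measurable, ?_⟩
  rw [cubeMeasure_eq_pi D]
  refine (Measure.pi_eq fun s hs => ?_).symm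
  have hH : H ∈ Mid D := h.mid_iff.2 (Or.inl rfl)
  have hCD : ∀ K : ↥(Mid C), K.1 ∈ Mid D := fun K => h.mid_iff.2 (Or.inr K.2)
  have hpre : (fun p : Coord C × ℝ => transfer C D p.2 p.1) ⁻¹' Set.univ.pi s =
      (Set.univ.pi fun K : ↥(Mid C) => s ⟨K.1, hCD K⟩) ×ˢ s ⟨H, hH⟩ := by
    ext ⟨x, t⟩
    simp only [Set.mem_preimage, Set.mem_pi, Set.mem_univ, true_imp_iff, Set.mem_prod]
    constructor
    · intro hx
      refine ⟨fun K => ?_, ?_⟩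
      · have := hx ⟨K.1, hCD K⟩
        rwa [transfer_of_mem K.2] at this
      · have := hx ⟨H, hH⟩
        rwa [transfer_self h] at this
    · rintro ⟨h1, h2⟩ ⟨K, hK⟩
      rcases h.mid_iff.1 hK with rfl | hKC
      · rwa [transfer_self h]
      · rw [transfer_of_mem hKC]; exact h1 ⟨K, hKC⟩
  rw [Measure.map_apply (continuous_transfer C D).measurable (MeasurableSet.univ_pi hs), hpre,
    Measure.prod_prod, cubeMeasure_eq_pi C, Measure.pi_pi]
  have e1 := Finset.prod_coe_sort (Mid D)
    (fun K => if hK : K ∈ Mid D then (volume.restrict (Set.Icc (0 : ℝ) 1)) (s ⟨K, hK⟩) else 1)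
  have e2 := Finset.prod_coe_sort (Mid C)
    (fun K => if hK : K ∈ Mid D then (volume.restrict (Set.Icc (0 : ℝ) 1)) (s ⟨K, hK⟩) else 1)
  have hM : Mid D = insert H (Mid C) := by
    ext K; rw [h.mid_iff, Finset.mem_insert]
  have e3 := Finset.prod_insert h.notMem
    (f := fun K => if hK : K ∈ Mid D then (volume.restrict (Set.Icc (0 : ℝ) 1)) (s ⟨K, hK⟩) else 1)
  rw [← hM] at e3
  rw [e3, ← e2, dif_pos hH] at e1
  rw [mul_comm]
  convert e1.symm using 2
  · refine Finset.prod_congr rfl fun K _ => ?_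
    rw [dif_pos (hCD K)]
  · rename_i K _
    rw [dif_pos K.2]

/-- Integration over the fibres of the projection of a cube to a codimension-one face. -/
theorem integral_cube_eq {C D : X.Cube} {H : X.Hyperplane} (h : MidInsert C H D) {F : Coord D → ℂ}
    (hF : ContinuousOn F (unitCube D)) :
    ∫ y, F y ∂cubeMeasure D = ∫ x, (∫ t in (0 : ℝ)..1, F (transfer C D t x)) ∂cubeMeasure C := by
  have hmp := measurePreserving_transfer h
  rw [← hmp.map_eq, integral_map hmp.measurable.aemeasurable
    (by rw [hmp.map_eq]; exact aestronglyMeasurable_of_continuousOn hF), integral_prod]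
  · simp only [setIntegral_Icc_eq_interval]
  · exact (hmp.integrable_comp (aestronglyMeasurable_of_continuousOn hF)).2
      (integrable_of_continuousOn hF)

theorem continuousOn_partialDeriv {C : X.Cube} {H : X.Hyperplane} {f : Coord C → ℂ}
    (hf : ContDiffOn ℝ 1 f (unitCube C)) : ContinuousOn (partialDeriv C H f) (unitCube C) :=
  (continuousOn_fderivWithin_unitCube hf).clm_apply continuousOn_const

theorem hasDerivWithinAt_transfer {C D : X.Cube} {H : X.Hyperplane} (h : MidInsert C H D)
    {f : Coord D → ℂ} (hf : ContDiffOn ℝ 1 f (unitCube D)) {x : Coord C} (hx : x ∈ unitCube C) {t : ℝ}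
    (ht : t ∈ Set.Icc (0 : ℝ) 1) :
    HasDerivWithinAt (fun t => f (transfer C D t x)) (partialDeriv D H f (transfer C D t x))
      (Set.Icc 0 1) t := by
  have h1 : HasFDerivWithinAt f (fderivWithin ℝ f (unitCube D) (transfer C D t x)) (unitCube D)
      (transfer C D t x) :=
    ((hf.differentiableOn one_ne_zero) _ (transfer_mem_unitCube hx ht)).hasFDerivWithinAt
  have h2 : HasDerivWithinAt (fun t => transfer C D t x) (fun K => if K.1 = H then (1 : ℝ) else 0)
      (Set.Icc 0 1) t := by
    rw [hasDerivWithinAt_pi]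
    rintro ⟨K, hK⟩
    by_cases hKH : K = H
    · subst hKH
      simp only [transfer, h.notMem, dif_neg, not_false_eq_true, if_true]
      exact hasDerivWithinAt_id _ _
    · have hKC := (h.mid_iff.1 hK).resolve_left hKH
      simp only [transfer, hKC, dif_pos, hKH, if_false]
      exact hasDerivWithinAt_const _ _ _
  exact h1.comp_hasDerivWithinAt t h2 fun u hu => transfer_mem_unitCube hx hu

/-- Integration by parts on a cube. -/
theorem integral_partialDeriv_mul {C D : X.Cube} {H : X.Hyperplane} (h : MidInsert C H D)
    {f g : Coord D → ℂ} (hf : ContDiffOn ℝ 1 f (unitCube D)) (hg : ContDiffOn ℝ 1 g (unitCube D))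
    (h0 : ∀ x ∈ unitCube C, f (transfer C D 0 x) = 0) (h1 : ∀ x ∈ unitCube C, f (transfer C D 1 x) = 0) :
    ∫ y, star (partialDeriv D H f y) * g y ∂cubeMeasure D =
      ∫ y, star (f y) * -partialDeriv D H g y ∂cubeMeasure D := by
  have c1 : ContinuousOn (fun y => star (partialDeriv D H f y) * g y) (unitCube D) :=
    (continuousOn_partialDeriv hf).star.mul hg.continuousOn
  have c2 : ContinuousOn (fun y => star (f y) * partialDeriv D H g y) (unitCube D) :=
    hf.continuousOn.star.mul (continuousOn_partialDeriv hg)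
  -- On each fibre in direction `H` the integrand is the derivative of `star f * g`. Vanishing of
  -- `f` at both ends is enough; nothing is needed from `g` there.
  have key : ∫ y, (star (partialDeriv D H f y) * g y + star (f y) * partialDeriv D H g y)
      ∂cubeMeasure D = 0 := by
    rw [integral_cube_eq h (F := fun y => star (partialDeriv D H f y) * g y +
      star (f y) * partialDeriv D H g y) (c1.add c2)]
    refine integral_eq_zero_of_ae ?_
    filter_upwards [ae_mem_unitCube C] with x hx
    have hu : Set.uIcc (0 : ℝ) 1 = Set.Icc 0 1 := Set.uIcc_of_le zero_le_one
    have hmaps : Set.MapsTo (fun t => transfer C D t x) (Set.Icc 0 1) (unitCube D) :=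
      fun t ht => transfer_mem_unitCube hx ht
    have hcont : Continuous fun t => transfer C D t x :=
      (continuous_transfer C D).comp (Continuous.prodMk_right x)
    have := intervalIntegral.integral_deriv_mul_eq_sub_of_hasDerivWithinAt (a := 0) (b := 1)
      (u := fun t => star (f (transfer C D t x))) (v := fun t => g (transfer C D t x))
      (u' := fun t => star (partialDeriv D H f (transfer C D t x)))
      (v' := fun t => partialDeriv D H g (transfer C D t x))
      (fun t ht => by
        rw [hu] at ht ⊢
        exact (hasDerivWithinAt_transfer h hf hx ht).star)
      (fun t ht => by
        rw [hu] at ht ⊢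
        exact hasDerivWithinAt_transfer h hg hx ht)
      (ContinuousOn.intervalIntegrable (by
        rw [hu]
        exact ((continuousOn_partialDeriv hf).star).comp hcont.continuousOn hmaps))
      (ContinuousOn.intervalIntegrable (by
        rw [hu]
        exact (continuousOn_partialDeriv hg).comp hcont.continuousOn hmaps))
    rw [Pi.zero_apply, this, h0 x hx, h1 x hx]
    simp
  rw [integral_add (integrable_of_continuousOn c1) (integrable_of_continuousOn c2)] at key
  simp only [mul_neg]
  rw [integral_neg]
  exact eq_neg_of_add_eq_zero_left key

end CubeIntegrals

end CubicalComplex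

/-! ### Formal adjoints and symmetry of the de Rham operator. -/

namespace CubicalComplex

section Operators

variable {V : Type*} {X : CubicalComplex V}

/-- Joint continuity of a family of functions on a cube, parametrized by `[0,1]`. -/
def JointCont (C : X.Cube) (f : I → Coord C → ℂ) : Prop :=
  ContinuousOn (fun p : I × Coord C => f p.1 p.2) (Set.univ ×ˢ unitCube C)

theorem JointCont.apply {C : X.Cube} {f : I → Coord C → ℂ} (hf : JointCont C f) (s : I) :
    ContinuousOn (f s) (unitCube C) :=
  ContinuousOn.comp (f := fun x => (s, x)) hf (by fun_prop) fun _ hx => ⟨trivial, hx⟩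

theorem ContinuousOn.jointCont {C : X.Cube} {f : Coord C → ℂ} (hf : ContinuousOn f (unitCube C)) :
    JointCont C fun _ => f :=
  ContinuousOn.comp hf continuousOn_snd fun _ hx => hx.2

theorem JointCont.congr {C : X.Cube} {f g : I → Coord C → ℂ} (hf : JointCont C f)
    (h : ∀ s, ∀ x ∈ unitCube C, g s x = f s x) : JointCont C g :=
  ContinuousOn.congr hf fun p hp => h p.1 p.2 hp.2

theorem JointCont.sum {C : X.Cube} {ι : Type*} {S : Finset ι} {f : ι → I → Coord C → ℂ}
    (hf : ∀ i ∈ S, JointCont C (f i)) : JointCont C fun s x => ∑ i ∈ S, f i s x :=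
  continuousOn_finsetSum S hf

theorem JointCont.add {C : X.Cube} {f g : I → Coord C → ℂ} (hf : JointCont C f) (hg : JointCont C g) :
    JointCont C fun s x => f s x + g s x :=
  ContinuousOn.add hf hg

theorem JointCont.mul {C : X.Cube} {f g : I → Coord C → ℂ} (hf : JointCont C f) (hg : JointCont C g) :
    JointCont C fun s x => f s x * g s x :=
  ContinuousOn.mul hf hg

theorem JointCont.neg {C : X.Cube} {f : I → Coord C → ℂ} (hf : JointCont C f) :
    JointCont C fun s x => -f s x :=
  ContinuousOn.neg hf

theorem JointCont.of_param {C : X.Cube} {c : I → ℂ} (hc : Continuous c) :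
    JointCont C fun s _ => c s :=
  (hc.comp continuous_fst).continuousOn

theorem JointCont.ite {C : X.Cube} {p : Prop} [Decidable p] {f : I → Coord C → ℂ}
    (hf : p → JointCont C f) : JointCont C fun s x => if p then f s x else 0 := by
  by_cases h : p
  · simpa only [h, if_true] using hf h
  · simp only [h, if_false]
    exact JointCont.of_param continuous_const

/-- The form `b` vanishes outside the cubes in `𝒞`. -/
def SupportedOn (𝒞 : Finset X.Cube) (b : X.FormField) : Prop :=
  ∀ C ∉ 𝒞, ∀ J ⊆ Mid C, ∀ x ∈ unitCube C, b C J x = 0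

/-- The inner product of two forms. -/
noncomputable def pairing (𝒞 : Finset X.Cube) (b b' : X.FormField) : ℂ :=
  ∑ C ∈ 𝒞, ∑ J ∈ (Mid C).powerset, ∫ x, star (b C J x) * b' C J x ∂cubeMeasure C

/-- All the coefficients of the form `b` are continuous. -/
def ContField (b : X.FormField) : Prop := ∀ C, ∀ J ⊆ Mid C, ContinuousOn (b C J) (unitCube C)

theorem pairing_star (𝒞 : Finset X.Cube) (b b' : X.FormField) :
    star (pairing 𝒞 b b') = pairing 𝒞 b' b := by
  simp only [pairing, star_sum]
  refine Finset.sum_congr rfl fun C _ => Finset.sum_congr rfl fun J _ => ?_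
  rw [Complex.star_def, ← integral_conj]
  congr 1
  ext x
  simp [mul_comm]

theorem pairing_add_right (𝒞 : Finset X.Cube) {b b₁ b₂ : X.FormField} (hb : ContField b)
    (h₁ : ContField b₁) (h₂ : ContField b₂) :
    pairing 𝒞 b (b₁ + b₂) = pairing 𝒞 b b₁ + pairing 𝒞 b b₂ := by
  simp only [pairing, ← Finset.sum_add_distrib]
  refine Finset.sum_congr rfl fun C _ => Finset.sum_congr rfl fun J hJ => ?_
  rw [Finset.mem_powerset] at hJ
  have c₁ : ContinuousOn (fun x => star (b C J x) * b₁ C J x) (unitCube C) :=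
    (hb C J hJ).star.mul (h₁ C J hJ)
  have c₂ : ContinuousOn (fun x => star (b C J x) * b₂ C J x) (unitCube C) :=
    (hb C J hJ).star.mul (h₂ C J hJ)
  rw [← integral_add (integrable_of_continuousOn c₁) (integrable_of_continuousOn c₂)]
  simp only [Pi.add_apply, mul_add]

theorem MemOmegaZero.contDiffOn_one {C : X.Cube} {b : X.FormField} (hb : MemOmegaZero C b)
    {J : Finset X.Hyperplane} (hJ : J ⊆ Mid C) : ContDiffOn ℝ 1 (b C J) (unitCube C) :=
  (hb.smooth J hJ).of_le (by exact_mod_cast le_top)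

theorem contField_of_memOmegaZero {b : X.FormField} (hb : ∀ C, MemOmegaZero C b) : ContField b :=
  fun C J hJ => ((hb C).smooth J hJ).continuousOn

variable [LinearOrder X.Hyperplane]

/-- Pull back a function from the face `C` to `D` and multiply by `c e^{v (x_H - 1)}`. -/
noncomputable def pull (c v : ℝ) (C : X.Cube) (H : X.Hyperplane) (D : X.Cube) (f : Coord C → ℂ)
    (y : Coord D) : ℂ :=
  (c : ℂ) * Real.exp (v * (coord D H y - 1)) * f (transfer D C 0 y)

/-- Multiply a function on `D` by `c e^{v (x_H - 1)}` and integrate over the fibres of the projection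
to the face `C`. -/
noncomputable def push (c v : ℝ) (C D : X.Cube) (g : Coord D → ℂ) (x : Coord C) : ℂ :=
  ∫ t in (0 : ℝ)..1, (c : ℂ) * Real.exp (v * (t - 1)) * g (transfer C D t x)

theorem continuous_coord (D : X.Cube) (H : X.Hyperplane) : Continuous (coord D H) := by
  unfold coord
  split_ifs <;> fun_prop

theorem JointCont.pull {C D : X.Cube} {H : X.Hyperplane} {f : I → Coord C → ℂ}
    {c v : I → ℝ} (hc : Continuous c) (hv : Continuous v) (hf : JointCont C f) :
    JointCont D fun s => pull (c s) (v s) C H D (f s) := by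
  have h1 : ContinuousOn (fun p : I × Coord D => f p.1 (transfer D C 0 p.2)) (Set.univ ×ˢ unitCube D) := by
    refine ContinuousOn.comp (f := fun p : I × Coord D => (p.1, transfer D C 0 p.2)) hf
      (Continuous.continuousOn ?_) fun p hp =>
      ⟨trivial, transfer_mem_unitCube hp.2 ⟨le_rfl, zero_le_one⟩⟩
    exact continuous_fst.prodMk ((continuous_transfer D C).comp (continuous_snd.prodMk continuous_const))
  have h2 := continuous_coord D H
  refine ContinuousOn.mul (Continuous.continuousOn ?_) h1
  fun_prop

theorem JointCont.push {C D : X.Cube} {g : I → Coord D → ℂ}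
    {c v : I → ℝ} (hc : Continuous c) (hv : Continuous v) (hg : JointCont D g) :
    JointCont C fun s => push (c s) (v s) C D (g s) := by
  -- Continuity is known only on the cube. Clamping all coordinates to `[0,1]` gives a globally
  -- continuous integrand with the same values there.
  let cl : Coord C → Coord C := fun x i => (Set.projIcc (0 : ℝ) 1 zero_le_one (x i) : ℝ)
  let clt : ℝ → ℝ := fun t => (Set.projIcc (0 : ℝ) 1 zero_le_one t : ℝ)
  have hcl : Continuous cl := continuous_pi fun i =>
    continuous_subtype_val.comp (continuous_projIcc.comp (continuous_apply i))
  have hclt : Continuous clt := continuous_subtype_val.comp continuous_projIcc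
  have hclm : ∀ x, cl x ∈ unitCube C := fun x => mem_unitCube.2 fun i =>
    (Set.projIcc (0 : ℝ) 1 zero_le_one (x i)).2
  have hcle : ∀ x ∈ unitCube C, cl x = x := fun x hx => funext fun i => by
    simp only [cl]
    rw [Set.projIcc_of_mem _ (mem_unitCube.1 hx i)]
  have hclte : ∀ t ∈ Set.Icc (0 : ℝ) 1, clt t = t := fun t ht => by
    simp only [clt]
    rw [Set.projIcc_of_mem _ ht]
  have h1 : Continuous fun q : (I × Coord C) × ℝ => g q.1.1 (transfer C D (clt q.2) (cl q.1.2)) := by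
    refine ContinuousOn.comp_continuous (f := fun q : (I × Coord C) × ℝ =>
      (q.1.1, transfer C D (clt q.2) (cl q.1.2))) hg ?_ fun q =>
      ⟨trivial, transfer_mem_unitCube (hclm _) (Set.projIcc (0 : ℝ) 1 zero_le_one q.2).2⟩
    exact (continuous_fst.comp continuous_fst).prodMk ((continuous_transfer C D).comp
      ((hcl.comp (continuous_snd.comp continuous_fst)).prodMk (hclt.comp continuous_snd)))
  have h2 : Continuous fun p : I × Coord C => ∫ t in (0 : ℝ)..1,
      (c p.1 : ℂ) * Real.exp (v p.1 * (t - 1)) * g p.1 (transfer C D (clt t) (cl p.2)) := by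
    refine intervalIntegral.continuous_parametric_intervalIntegral_of_continuous'
      (f := fun (p : I × Coord C) (t : ℝ) =>
        (c p.1 : ℂ) * Real.exp (v p.1 * (t - 1)) * g p.1 (transfer C D (clt t) (cl p.2))) ?_ 0 1
    refine Continuous.mul ?_ h1
    fun_prop
  refine h2.continuousOn.congr fun p hp => ?_
  refine intervalIntegral.integral_congr fun t ht => ?_
  rw [Set.uIcc_of_le zero_le_one] at ht
  rw [hclte t ht, hcle p.2 hp.2]

/-- `pull` and `push` are adjoint to each other. -/
theorem integral_star_pull_mul {C D : X.Cube} {H : X.Hyperplane} (h : MidInsert C H D) (c v : ℝ)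
    {f : Coord C → ℂ} {g : Coord D → ℂ} (hf : ContinuousOn f (unitCube C))
    (hg : ContinuousOn g (unitCube D)) :
    ∫ y, star (pull c v C H D f y) * g y ∂cubeMeasure D =
      ∫ x, star (f x) * push c v C D g x ∂cubeMeasure C := by
  have h1 : ContinuousOn (pull c v C H D f) (unitCube D) :=
    (JointCont.pull (c := fun _ => c) (v := fun _ => v) continuous_const continuous_const
      (ContinuousOn.jointCont hf)).apply 0
  rw [integral_cube_eq h (F := fun y => star (pull c v C H D f y) * g y) (h1.star.mul hg)]
  congr 1
  ext x
  rw [push, ← intervalIntegral.integral_const_mul]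
  congr 1
  ext t
  rw [pull, coord_transfer h, transfer_transfer h]
  simp only [star_mul', Complex.star_def, Complex.conj_ofReal]
  ring

theorem Step.erase_subset {P : V} {C D : X.Cube} {H : X.Hyperplane} (h : Step P C H D)
    {J : Finset X.Hyperplane} (hJ : J ⊆ Mid D) : J.erase H ⊆ Mid C := fun K hK => by
  obtain ⟨h1, h2⟩ := Finset.mem_erase.1 hK
  exact (h.mid_iff.1 (hJ h2)).resolve_left h1

theorem Step.insert_subset {P : V} {C D : X.Cube} {H : X.Hyperplane} (h : Step P C H D)
    {J : Finset X.Hyperplane} (hJ : J ⊆ Mid C) : insert H J ⊆ Mid D := by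
  rw [Finset.insert_subset_iff]
  exact ⟨h.2.2, fun K hK => h.mid_iff.2 (Or.inr (hJ hK))⟩

theorem Step.mid_eq {P : V} {C D : X.Cube} {H : X.Hyperplane} (h : Step P C H D) :
    Mid D = insert H (Mid C) := by
  ext K; rw [h.mid_iff, Finset.mem_insert]

-- On a form supported on finitely many cubes only finitely many summands are nonzero, so the
-- `finsum`, which would be `0` for infinite support, is an honest finite sum.
open Classical in
theorem eW_eq_sum {𝒞 : Finset X.Cube} {b : X.FormField} (hb : SupportedOn 𝒞 b) (P : V)
    (v : X.Hyperplane → ℝ) {D : X.Cube} {J : Finset X.Hyperplane} (hJ : J ⊆ Mid D) {x : Coord D}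
    (hx : x ∈ unitCube D) :
    eW P v b D J x = ∑ C ∈ 𝒞, ∑ H ∈ Mid D, if Step P C H D ∧ H ∈ J then
      sgn H (J.erase H) * pull (v H) (v H) C H D (b C (J.erase H)) x else 0 := by
  rw [eW, finsum_eq_sum_of_support_subset (s := 𝒞 ×ˢ Mid D), Finset.sum_product]
  · refine Finset.sum_congr rfl fun C _ => Finset.sum_congr rfl fun H _ => ?_
    rw [finsum_eq_if]
    by_cases h1 : Step P C H D <;> by_cases h2 : H ∈ J <;> simp [h1, h2, pull]
    ring
  · rintro ⟨C, H⟩ hp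
    rw [Function.mem_support] at hp
    rw [Finset.mem_coe, Finset.mem_product]
    have h1 : Step P C H D := by
      by_contra h
      exact hp (by simp [h])
    refine ⟨?_, h1.2.2⟩
    by_contra h
    refine hp ?_
    have := hb C h (J.erase H) (h1.erase_subset hJ) (transfer D C 0 x)
      (transfer_mem_unitCube hx ⟨le_rfl, zero_le_one⟩)
    simp [this]

open Classical in
theorem eWAdj_eq_sum {𝒞 : Finset X.Cube} {b : X.FormField} (hb : SupportedOn 𝒞 b) (P : V)
    (v : X.Hyperplane → ℝ) {C : X.Cube} {J : Finset X.Hyperplane} (hJ : J ⊆ Mid C) {x : Coord C}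
    (hx : x ∈ unitCube C) :
    eWAdj P v b C J x = ∑ D ∈ 𝒞, ∑ H ∈ Mid D, if Step P C H D then
      sgn H J * push (v H) (v H) C D (b D (insert H J)) x else 0 := by
  rw [eWAdj, finsum_eq_sum_of_support_subset (s := 𝒞 ×ˢ 𝒞.biUnion Mid), Finset.sum_product]
  · refine Finset.sum_congr rfl fun D hD => ?_
    rw [Finset.sum_subset (Finset.subset_biUnion_of_mem Mid hD)]
    · refine Finset.sum_congr rfl fun H _ => ?_
      rw [finsum_eq_if]
      by_cases h1 : Step P C H D <;> simp [h1, push]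
    · intro H _ hH
      rw [if_neg fun h => hH h.2.2]
  · rintro ⟨D, H⟩ hp
    rw [Function.mem_support] at hp
    rw [Finset.mem_coe, Finset.mem_product]
    have h1 : Step P C H D := by
      by_contra h
      exact hp (by simp [h])
    have h2 : D ∈ 𝒞 := by
      by_contra h
      refine hp ?_
      have : ∀ t ∈ Set.uIcc (0 : ℝ) 1, ((v H : ℂ) * Real.exp (v H * (t - 1)) *
          b D (insert H J) (transfer C D t x)) = 0 := by
        intro t ht
        rw [Set.uIcc_of_le zero_le_one] at ht
        rw [hb D h _ (h1.insert_subset hJ) _ (transfer_mem_unitCube hx ht), mul_zero]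
      simp only [h1, finsum_true]
      rw [intervalIntegral.integral_congr this]
      simp
    exact ⟨h2, Finset.mem_biUnion.2 ⟨D, h2, h1.2.2⟩⟩

theorem sgn_star (H : X.Hyperplane) (J : Finset X.Hyperplane) : star (sgn H J) = sgn H J := by
  simp [sgn]

/-- Pairs of a set and an element of it correspond to pairs of a set and an element outside it, by
removing that element. This matches exterior multiplication with contraction. -/
theorem sum_powerset_erase {M : Type*} [AddCommMonoid M] (S : Finset X.Hyperplane)
    (g : Finset X.Hyperplane → X.Hyperplane → M) :
    ∑ J ∈ S.powerset, ∑ H ∈ J, g (J.erase H) H = ∑ J ∈ S.powerset, ∑ H ∈ S \ J, g J H := by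
  rw [Finset.sum_sigma', Finset.sum_sigma']
  refine Finset.sum_bij' (fun p _ => ⟨p.1.erase p.2, p.2⟩) (fun p _ => ⟨insert p.2 p.1, p.2⟩) ?_ ?_ ?_ ?_ ?_
  · rintro ⟨J, H⟩ hp
    simp only [Finset.mem_sigma, Finset.mem_powerset, Finset.mem_sdiff] at hp ⊢
    exact ⟨(Finset.erase_subset _ _).trans hp.1, hp.1 hp.2, Finset.notMem_erase _ _⟩
  · rintro ⟨J, H⟩ hp
    simp only [Finset.mem_sigma, Finset.mem_powerset, Finset.mem_sdiff] at hp ⊢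
    exact ⟨Finset.insert_subset hp.2.1 hp.1, Finset.mem_insert_self _ _⟩
  · rintro ⟨J, H⟩ hp
    simp only [Finset.mem_sigma] at hp
    simp [Finset.insert_erase hp.2]
  · rintro ⟨J, H⟩ hp
    simp only [Finset.mem_sigma, Finset.mem_sdiff] at hp
    simp [Finset.erase_insert hp.2.2]
  · rintro ⟨J, H⟩ _
    rfl

theorem contField_dW {b : X.FormField} (hb : ∀ C, MemOmegaZero C b) (v : X.Hyperplane → ℝ) :
    ContField (dW v b) := by
  intro C J hJ
  refine continuousOn_finsetSum _ fun H hH => continuousOn_const.mul ?_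
  have hs := (Finset.erase_subset H J).trans hJ
  exact (continuousOn_partialDeriv ((hb C).contDiffOn_one hs)).add
    (continuousOn_const.mul ((hb C).smooth _ hs).continuousOn)

theorem contField_dWAdj {b : X.FormField} (hb : ∀ C, MemOmegaZero C b) (v : X.Hyperplane → ℝ) :
    ContField (dWAdj v b) := by
  intro C J hJ
  refine continuousOn_finsetSum _ fun H hH => continuousOn_const.mul ?_
  have hs : insert H J ⊆ Mid C := Finset.insert_subset (Finset.mem_sdiff.1 hH).1 hJ
  exact (continuousOn_partialDeriv ((hb C).contDiffOn_one hs)).neg.add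
    (continuousOn_const.mul ((hb C).smooth _ hs).continuousOn)

theorem contField_eW {𝒞 : Finset X.Cube} {b : X.FormField} (hs : SupportedOn 𝒞 b) (hb : ContField b)
    (P : V) (v : X.Hyperplane → ℝ) : ContField (eW P v b) := by
  classical
  intro D J hJ
  refine ContinuousOn.congr ?_ fun x hx => eW_eq_sum hs P v hJ hx
  refine continuousOn_finsetSum _ fun C _ => continuousOn_finsetSum _ fun H _ => ?_
  by_cases h : Step P C H D ∧ H ∈ J
  · simp only [h, and_self, if_true]
    exact continuousOn_const.mul ((JointCont.pull (c := fun _ => v H) (v := fun _ => v H)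
      continuous_const continuous_const (ContinuousOn.jointCont (hb C _ (h.1.erase_subset hJ)))).apply 0)
  · simp only [h, if_false]
    exact continuousOn_const

theorem contField_eWAdj {𝒞 : Finset X.Cube} {b : X.FormField} (hs : SupportedOn 𝒞 b)
    (hb : ContField b) (P : V) (v : X.Hyperplane → ℝ) : ContField (eWAdj P v b) := by
  classical
  intro C J hJ
  refine ContinuousOn.congr ?_ fun x hx => eWAdj_eq_sum hs P v hJ hx
  refine continuousOn_finsetSum _ fun D _ => continuousOn_finsetSum _ fun H _ => ?_
  by_cases h : Step P C H D
  · simp only [h, if_true]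
    exact continuousOn_const.mul ((JointCont.push (c := fun _ => v H) (v := fun _ => v H)
      continuous_const continuous_const (ContinuousOn.jointCont (hb D _ (h.insert_subset hJ)))).apply 0)
  · simp only [h, if_false]
    exact continuousOn_const

/-- Integrate by parts in one direction `H` at a time. The derivative acts on coefficients of `dx_J`
with `H ∉ J`, and these vanish at `x_H = 0` and `x_H = 1` because the form pulls back to zero on the
faces. -/
theorem pairing_dW (hX : X.IsCAT0) (P : V) (𝒞 : Finset X.Cube) {b b' : X.FormField}
    (hb : ∀ C, MemOmegaZero C b) (hb' : ∀ C, MemOmegaZero C b') (v : X.Hyperplane → ℝ) :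
    pairing 𝒞 (dW v b) b' = pairing 𝒞 b (dWAdj v b') := by
  unfold pairing
  refine Finset.sum_congr rfl fun C _ => ?_
  have key : ∀ J ⊆ Mid C, ∀ H ∈ Mid C \ J,
      ∫ x, star (sgn H J * (partialDeriv C H (b C J) x + v H * b C J x)) * b' C (insert H J) x ∂cubeMeasure C =
      ∫ x, star (b C J x) * (sgn H J * (-partialDeriv C H (b' C (insert H J)) x +
        v H * b' C (insert H J) x)) ∂cubeMeasure C := by
    intro J hJ H hH
    obtain ⟨hHC, hHJ⟩ := Finset.mem_sdiff.1 hH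
    have hs : insert H J ⊆ Mid C := Finset.insert_subset hHC hJ
    obtain ⟨C', hstep⟩ := exists_step_down hX P hHC
    have hm := hstep.midInsert
    have hf := (hb C).contDiffOn_one hJ
    have hg := (hb' C).contDiffOn_one hs
    have hibp := integral_partialDeriv_mul hm hf hg
      (fun x hx => (hb C).pullback_eq_zero J hJ ⟨H, hHC⟩ hHJ _
        (transfer_mem_unitCube hx ⟨le_rfl, zero_le_one⟩) (Or.inl (transfer_self hm hHC _ _)))
      (fun x hx => (hb C).pullback_eq_zero J hJ ⟨H, hHC⟩ hHJ _
        (transfer_mem_unitCube hx ⟨zero_le_one, le_rfl⟩) (Or.inr (transfer_self hm hHC _ _)))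
    have c1 : ContinuousOn (fun x => star (partialDeriv C H (b C J) x) * b' C (insert H J) x)
        (unitCube C) := (continuousOn_partialDeriv hf).star.mul hg.continuousOn
    have c2 : ContinuousOn (fun x => star (b C J x) * -partialDeriv C H (b' C (insert H J)) x)
        (unitCube C) := hf.continuousOn.star.mul (continuousOn_partialDeriv hg).neg
    have c3 : ContinuousOn (fun x => star (b C J x) * b' C (insert H J) x) (unitCube C) :=
      hf.continuousOn.star.mul hg.continuousOn
    calc _ = ∫ x, sgn H J * (star (partialDeriv C H (b C J) x) * b' C (insert H J) x +
          v H * (star (b C J x) * b' C (insert H J) x)) ∂cubeMeasure C := by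
          congr 1; ext x
          rw [star_mul', sgn_star, star_add, star_mul', Complex.star_def, Complex.conj_ofReal]
          ring
      _ = ∫ x, sgn H J * (star (b C J x) * -partialDeriv C H (b' C (insert H J)) x +
          v H * (star (b C J x) * b' C (insert H J) x)) ∂cubeMeasure C := by
          rw [integral_const_mul, integral_const_mul,
            integral_add (integrable_of_continuousOn c1) ((integrable_of_continuousOn c3).const_mul _),
            integral_add (integrable_of_continuousOn c2) ((integrable_of_continuousOn c3).const_mul _),
            hibp]
      _ = _ := by
          congr 1; ext x; ring
  calc _ = ∑ J ∈ (Mid C).powerset, ∑ H ∈ J, ∫ x, star (sgn H (J.erase H) *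
          (partialDeriv C H (b C (J.erase H)) x + v H * b C (J.erase H) x)) *
          b' C (insert H (J.erase H)) x ∂cubeMeasure C := by
        refine Finset.sum_congr rfl fun J hJ => ?_
        rw [Finset.mem_powerset] at hJ
        rw [← integral_finsetSum]
        · congr 1; ext x
          rw [dW, star_sum, Finset.sum_mul]
          refine Finset.sum_congr rfl fun H hH => ?_
          rw [Finset.insert_erase hH]
        · intro H hH
          have hs := (Finset.erase_subset H J).trans hJ
          rw [Finset.insert_erase hH]
          refine integrable_of_continuousOn (ContinuousOn.mul (ContinuousOn.star
            (continuousOn_const.mul ?_)) ((hb' C).smooth J hJ).continuousOn)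
          exact (continuousOn_partialDeriv ((hb C).contDiffOn_one hs)).add
            (continuousOn_const.mul ((hb C).smooth _ hs).continuousOn)
    _ = ∑ J ∈ (Mid C).powerset, ∑ H ∈ Mid C \ J, ∫ x, star (sgn H J *
          (partialDeriv C H (b C J) x + v H * b C J x)) * b' C (insert H J) x ∂cubeMeasure C :=
        sum_powerset_erase (Mid C) fun J H => ∫ x, star (sgn H J *
          (partialDeriv C H (b C J) x + v H * b C J x)) * b' C (insert H J) x ∂cubeMeasure C
    _ = _ := by
        refine Finset.sum_congr rfl fun J hJ => ?_
        rw [Finset.mem_powerset] at hJ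
        rw [Finset.sum_congr rfl (key J hJ), ← integral_finsetSum]
        · congr 1; ext x
          rw [dWAdj, Finset.mul_sum]
        · intro H hH
          have hs : insert H J ⊆ Mid C := Finset.insert_subset (Finset.mem_sdiff.1 hH).1 hJ
          refine integrable_of_continuousOn (ContinuousOn.mul ((hb C).smooth J hJ).continuousOn.star
            (continuousOn_const.mul ?_))
          exact (continuousOn_partialDeriv ((hb' C).contDiffOn_one hs)).neg.add
            (continuousOn_const.mul ((hb' C).smooth _ hs).continuousOn)

/-- By Fubini, pulling back along the projection `D_H → C` is adjoint to integrating over its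
fibres, with the same exponential factor. The rest is rearrangement of finite sums over steps. -/
theorem pairing_eW (P : V) {𝒞 : Finset X.Cube} {b b' : X.FormField}
    (hb : ContField b) (hb' : ContField b') (hs : SupportedOn 𝒞 b) (hs' : SupportedOn 𝒞 b')
    (v : X.Hyperplane → ℝ) :
    pairing 𝒞 (eW P v b) b' = pairing 𝒞 b (eWAdj P v b') := by
  classical
  have cpull : ∀ {C D : X.Cube} {H : X.Hyperplane} {J : Finset X.Hyperplane}, Step P C H D → J ⊆ Mid C →
      ContinuousOn (pull (v H) (v H) C H D (b C J)) (unitCube D) := fun {C D H J} h hJ =>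
    (JointCont.pull (c := fun _ => v H) (v := fun _ => v H) continuous_const continuous_const
      (ContinuousOn.jointCont (hb C J hJ))).apply 0
  have cpush : ∀ {C D : X.Cube} {H : X.Hyperplane} {J : Finset X.Hyperplane}, J ⊆ Mid D →
      ContinuousOn (push (v H) (v H) C D (b' D J)) (unitCube C) := fun {C D H J} hJ =>
    (JointCont.push (c := fun _ => v H) (v := fun _ => v H) continuous_const continuous_const
      (ContinuousOn.jointCont (hb' D J hJ))).apply 0
  have e1 : pairing 𝒞 (eW P v b) b' = ∑ D ∈ 𝒞, ∑ J ∈ (Mid D).powerset, ∑ C ∈ 𝒞, ∑ H ∈ Mid D,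
      if Step P C H D ∧ H ∈ J then ∫ x, star (sgn H (J.erase H) *
        pull (v H) (v H) C H D (b C (J.erase H)) x) * b' D J x ∂cubeMeasure D else 0 := by
    refine Finset.sum_congr rfl fun D _ => Finset.sum_congr rfl fun J hJ => ?_
    rw [Finset.mem_powerset] at hJ
    have hint : ∀ C ∈ 𝒞, ∀ H ∈ Mid D, Integrable (fun x => (if Step P C H D ∧ H ∈ J then
        star (sgn H (J.erase H) * pull (v H) (v H) C H D (b C (J.erase H)) x) * b' D J x else 0))
        (cubeMeasure D) := by
      intro C _ H _
      by_cases h : Step P C H D ∧ H ∈ J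
      · simp only [h, and_self, if_true]
        exact integrable_of_continuousOn (ContinuousOn.mul (ContinuousOn.star (continuousOn_const.mul
          (cpull h.1 (h.1.erase_subset hJ)))) (hb' D J hJ))
      · simp only [h, if_false]
        exact integrable_zero _ _ _
    calc _ = ∫ x, ∑ C ∈ 𝒞, ∑ H ∈ Mid D, (if Step P C H D ∧ H ∈ J then
        star (sgn H (J.erase H) * pull (v H) (v H) C H D (b C (J.erase H)) x) * b' D J x else 0)
          ∂cubeMeasure D := by
          refine integral_congr_ae ?_
          filter_upwards [ae_mem_unitCube D] with x hx
          rw [eW_eq_sum hs P v hJ hx, star_sum, Finset.sum_mul]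
          refine Finset.sum_congr rfl fun C _ => ?_
          rw [star_sum, Finset.sum_mul]
          refine Finset.sum_congr rfl fun H _ => ?_
          by_cases h : Step P C H D ∧ H ∈ J <;> simp [h]
      _ = _ := by
          rw [integral_finsetSum _ fun C hC => integrable_finsetSum _ fun H hH => hint C hC H hH]
          refine Finset.sum_congr rfl fun C hC => ?_
          rw [integral_finsetSum _ fun H hH => hint C hC H hH]
          refine Finset.sum_congr rfl fun H _ => ?_
          by_cases h : Step P C H D ∧ H ∈ J <;> simp [h]
  have e2 : pairing 𝒞 b (eWAdj P v b') = ∑ C ∈ 𝒞, ∑ J ∈ (Mid C).powerset, ∑ D ∈ 𝒞, ∑ H ∈ Mid D,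
      if Step P C H D then ∫ x, star (b C J x) * (sgn H J *
        push (v H) (v H) C D (b' D (insert H J)) x) ∂cubeMeasure C else 0 := by
    refine Finset.sum_congr rfl fun C _ => Finset.sum_congr rfl fun J hJ => ?_
    rw [Finset.mem_powerset] at hJ
    have hint : ∀ D ∈ 𝒞, ∀ H ∈ Mid D, Integrable (fun x => (if Step P C H D then
        star (b C J x) * (sgn H J * push (v H) (v H) C D (b' D (insert H J)) x) else 0))
        (cubeMeasure C) := by
      intro D _ H _
      by_cases h : Step P C H D
      · simp only [h, if_true]
        exact integrable_of_continuousOn (ContinuousOn.mul (hb C J hJ).star (continuousOn_const.mul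
          (cpush (h.insert_subset hJ))))
      · simp only [h, if_false]
        exact integrable_zero _ _ _
    calc _ = ∫ x, ∑ D ∈ 𝒞, ∑ H ∈ Mid D, (if Step P C H D then
        star (b C J x) * (sgn H J * push (v H) (v H) C D (b' D (insert H J)) x) else 0)
          ∂cubeMeasure C := by
          refine integral_congr_ae ?_
          filter_upwards [ae_mem_unitCube C] with x hx
          rw [eWAdj_eq_sum hs' P v hJ hx, Finset.mul_sum]
          refine Finset.sum_congr rfl fun D _ => ?_
          rw [Finset.mul_sum]
          refine Finset.sum_congr rfl fun H _ => ?_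
          by_cases h : Step P C H D <;> simp [h]
      _ = _ := by
          rw [integral_finsetSum _ fun D hD => integrable_finsetSum _ fun H hH => hint D hD H hH]
          refine Finset.sum_congr rfl fun D hD => ?_
          rw [integral_finsetSum _ fun H hH => hint D hD H hH]
          refine Finset.sum_congr rfl fun H _ => ?_
          by_cases h : Step P C H D <;> simp [h]
  rw [e1, e2]
  calc _ = ∑ D ∈ 𝒞, ∑ C ∈ 𝒞, ∑ H ∈ Mid D, ∑ J ∈ (Mid D).powerset,
      (if Step P C H D ∧ H ∈ J then ∫ x, star (sgn H (J.erase H) *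
        pull (v H) (v H) C H D (b C (J.erase H)) x) * b' D J x ∂cubeMeasure D else 0) := by
        refine Finset.sum_congr rfl fun D _ => ?_
        rw [Finset.sum_comm]
        refine Finset.sum_congr rfl fun C _ => ?_
        rw [Finset.sum_comm]
    _ = ∑ D ∈ 𝒞, ∑ C ∈ 𝒞, ∑ H ∈ Mid D, ∑ J ∈ (Mid C).powerset,
      (if Step P C H D then ∫ x, star (b C J x) * (sgn H J *
        push (v H) (v H) C D (b' D (insert H J)) x) ∂cubeMeasure C else 0) := by
        refine Finset.sum_congr rfl fun D _ => Finset.sum_congr rfl fun C _ =>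
          Finset.sum_congr rfl fun H _ => ?_
        by_cases h : Step P C H D
        · simp only [h, true_and, if_true]
          have hp : (Mid D).powerset = (insert H (Mid C)).powerset := by rw [h.mid_eq]
          -- Subsets of `Mid D` without `H` contribute nothing to the wedge with `dx_H`. Those with
          -- `H` correspond to the subsets of `Mid C`.
          rw [hp, Finset.sum_powerset_insert h.notMem, Finset.sum_eq_zero, zero_add]
          · refine Finset.sum_congr rfl fun J hJ => ?_
            rw [Finset.mem_powerset] at hJ
            have hHJ : H ∉ J := fun hH => h.notMem (hJ hH)
            rw [if_pos (Finset.mem_insert_self _ _), Finset.erase_insert hHJ]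
            simp only [star_mul', sgn_star, mul_assoc, mul_left_comm (star (b C J _)) (sgn H J)]
            rw [integral_const_mul, integral_const_mul, integral_star_pull_mul h.midInsert _ _
              (hb C J hJ) (hb' D _ (h.insert_subset hJ))]
          · intro J hJ
            rw [Finset.mem_powerset] at hJ
            rw [if_neg fun hH => h.notMem (hJ hH)]
        · simp [h]
    _ = _ := by
        rw [Finset.sum_comm]
        refine Finset.sum_congr rfl fun C _ => ?_
        rw [Finset.sum_comm]
        refine Finset.sum_congr rfl fun D _ => ?_
        rw [Finset.sum_comm]

/-- The de Rham operator is symmetric. -/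
theorem pairing_deRhamOp (hX : X.IsCAT0) (P : V) {𝒞 : Finset X.Cube} {b b' : X.FormField}
    (hb : ∀ C, MemOmegaZero C b) (hb' : ∀ C, MemOmegaZero C b') (hs : SupportedOn 𝒞 b)
    (hs' : SupportedOn 𝒞 b') (v : X.Hyperplane → ℝ) :
    pairing 𝒞 (deRhamOp P v b) b' = pairing 𝒞 b (deRhamOp P v b') := by
  have expand : ∀ {b b' : X.FormField}, (∀ C, MemOmegaZero C b) → (∀ C, MemOmegaZero C b') →
      SupportedOn 𝒞 b' → pairing 𝒞 b (deRhamOp P v b') =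
        pairing 𝒞 b (dW v b') + pairing 𝒞 b (eW P v b') + pairing 𝒞 b (dWAdj v b') +
          pairing 𝒞 b (eWAdj P v b') := by
    intro b b' hb hb' hs'
    have c0 := contField_of_memOmegaZero hb
    have c0' := contField_of_memOmegaZero hb'
    have c1 := contField_dW hb' v
    have c2 := contField_eW hs' c0' P v
    have c3 := contField_dWAdj hb' v
    have c4 := contField_eWAdj hs' c0' P v
    have c12 : ContField (dW v b' + eW P v b') := fun C J hJ => (c1 C J hJ).add (c2 C J hJ)
    have c123 : ContField (dW v b' + eW P v b' + dWAdj v b') := fun C J hJ =>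
      (c12 C J hJ).add (c3 C J hJ)
    rw [deRhamOp, pairing_add_right 𝒞 c0 c123 c4, pairing_add_right 𝒞 c0 c12 c3,
      pairing_add_right 𝒞 c0 c1 c2]
  rw [← pairing_star, expand hb' hb hs, expand hb hb' hs']
  simp only [star_add, pairing_star]
  rw [pairing_dW hX P 𝒞 hb hb' v, pairing_eW P (contField_of_memOmegaZero hb)
    (contField_of_memOmegaZero hb') hs hs' v]
  -- The adjoint terms are moved across by the same two identities, read with the roles of `b` and
  -- `b'` exchanged and conjugated.
  rw [← pairing_star 𝒞 b' (dWAdj v b), ← pairing_dW hX P 𝒞 hb' hb v, pairing_star,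
    ← pairing_star 𝒞 b' (eWAdj P v b), ← pairing_eW P (contField_of_memOmegaZero hb')
    (contField_of_memOmegaZero hb) hs' hs v, pairing_star]
  ring

end Operators

end CubicalComplex

/-! ### Families of forms and the elements of `ℋ(X)` that they define. -/

namespace CubicalComplex

section Families

/-- With `tendstoUniformlyOn_of_continuousOn`, this exchanges continuity in the `C^∞`-topology for
joint continuity of all derivatives, which is easier to propagate through the operators. -/
theorem continuousOn_univ_prod_iff {Y Z : Type*} [TopologicalSpace Y] [PseudoMetricSpace Z]
    {T : Type*} [TopologicalSpace T] {F : T → Y → Z} {K : Set Y} (hF : ∀ s, ContinuousOn (F s) K)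
    (hU : ∀ s₀, TendstoUniformlyOn F (F s₀) (𝓝 s₀) K) :
    ContinuousOn (fun p : T × Y => F p.1 p.2) (Set.univ ×ˢ K) := by
  rintro ⟨s, x⟩ hp
  have hx : x ∈ K := hp.2
  rw [ContinuousWithinAt, Metric.tendsto_nhds]
  intro ε hε
  have h1 := Metric.tendstoUniformlyOn_iff.1 (hU s) (ε / 2) (half_pos hε)
  have h2 := Metric.tendsto_nhds.1 (hF s x hx) (ε / 2) (half_pos hε)
  rw [nhdsWithin_prod_eq, nhdsWithin_univ]
  filter_upwards [h1.prod_mk (h2.and self_mem_nhdsWithin)] with q hq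
  calc dist (F q.1 q.2) (F s x) ≤ dist (F q.1 q.2) (F s q.2) + dist (F s q.2) (F s x) :=
        dist_triangle _ _ _
    _ < ε / 2 + ε / 2 := add_lt_add (by rw [dist_comm]; exact hq.1 _ hq.2.2) hq.2.1
    _ = ε := add_halves ε

theorem tendstoUniformlyOn_of_continuousOn {Y Z : Type*} [PseudoMetricSpace Y]
    [PseudoMetricSpace Z] {F : I → Y → Z} {K : Set Y} (hK : IsCompact K)
    (hF : ContinuousOn (fun p : I × Y => F p.1 p.2) (Set.univ ×ˢ K)) (s₀ : I) :
    TendstoUniformlyOn F (F s₀) (𝓝 s₀) K := by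
  have h := (isCompact_univ.prod hK).uniformContinuousOn_of_continuous hF
  rw [← nhdsWithin_univ]
  exact UniformContinuousOn.tendstoUniformlyOn h (Set.mem_univ s₀)

variable {V : Type*} {X : CubicalComplex V}

/-- The product of a family of forms and a function on the parameter space. -/
def smulFamily (f : I → ℂ) (b : I → X.FormField) : I → X.FormField := fun s C J x => f s * b s C J x

theorem Represents.add {b b' : I → X.FormField} {β β' : X.HilbertModule} (h : Represents b β)
    (h' : Represents b' β') : Represents (b + b') (β + β') := fun s p => by
  filter_upwards [h s p, h' s p, Lp.coeFn_add (β.1 s p) (β'.1 s p)] with x h1 h2 h3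
  change (β.1 s p + β'.1 s p : Lp ℂ 2 (cubeMeasure p.1.1)) x = b s p.1.1 p.1.2 x + b' s p.1.1 p.1.2 x
  rw [h3, Pi.add_apply, h1, h2]

theorem Represents.zero : Represents (0 : I → X.FormField) 0 := fun _ p =>
  Lp.coeFn_zero ℂ 2 (cubeMeasure p.1.1)

theorem Represents.smul {b : I → X.FormField} {β : X.HilbertModule} (h : Represents b β) (f : C(I, ℂ)) :
    Represents (smulFamily f b) (f • β) := fun s p => by
  filter_upwards [h s p, Lp.coeFn_smul (f s) (β.1 s p)] with x h1 h2
  change (f s • β.1 s p : Lp ℂ 2 (cubeMeasure p.1.1)) x = f s * b s p.1.1 p.1.2 x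
  rw [h2, Pi.smul_apply, h1, smul_eq_mul]

/-- The class in `L²` of a continuous function on a cube. -/
noncomputable def toL2 {C : X.Cube} (f : Coord C → ℂ) (hf : ContinuousOn f (unitCube C)) :
    Lp ℂ 2 (cubeMeasure C) :=
  MemLp.toLp f <| by
    obtain ⟨M, hM⟩ := (isCompact_unitCube C).exists_bound_of_continuousOn hf
    exact MemLp.of_bound (aestronglyMeasurable_of_continuousOn hf) M
      ((ae_mem_unitCube C).mono fun x hx => hM x hx)

theorem coeFn_toL2 {C : X.Cube} {f : Coord C → ℂ} (hf : ContinuousOn f (unitCube C)) :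
    toL2 f hf =ᵐ[cubeMeasure C] f := MemLp.coeFn_toLp _

/-- The cube has total mass one, so the `L²` norm is bounded by the supremum norm. -/
theorem norm_toL2_sub_le {C : X.Cube} {f g : Coord C → ℂ} (hf : ContinuousOn f (unitCube C))
    (hg : ContinuousOn g (unitCube C)) {ε : ℝ} (hε : 0 ≤ ε)
    (h : ∀ x ∈ unitCube C, ‖f x - g x‖ ≤ ε) : ‖toL2 f hf - toL2 g hg‖ ≤ ε := by
  have := Lp.norm_le_of_ae_bound (f := toL2 f hf - toL2 g hg) hε (by
    filter_upwards [ae_mem_unitCube C, Lp.coeFn_sub (toL2 f hf) (toL2 g hg), coeFn_toL2 hf,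
      coeFn_toL2 hg] with x hx h1 h2 h3
    rw [h1, Pi.sub_apply, h2, h3]
    exact h x hx)
  simpa [measureUnivNNReal] using this

theorem JointCont.continuous_toL2 {C : X.Cube} {f : I → Coord C → ℂ} (hf : JointCont C f) :
    Continuous fun s => toL2 (f s) (hf.apply s) := by
  rw [continuous_iff_continuousAt]
  intro s₀
  rw [ContinuousAt, Metric.tendsto_nhds]
  intro ε hε
  have h := Metric.tendstoUniformlyOn_iff.1
    (tendstoUniformlyOn_of_continuousOn (isCompact_unitCube C) hf s₀) (ε / 2) (half_pos hε)
  filter_upwards [h] with s hs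
  rw [dist_eq_norm]
  refine lt_of_le_of_lt (norm_toL2_sub_le _ _ (half_pos hε).le fun x hx => ?_) (half_lt_self hε)
  rw [← dist_eq_norm, dist_comm]
  exact (hs x hx).le

theorem finite_formIndex (𝒞 : Finset X.Cube) : {p : X.FormIndex | p.1.1 ∈ 𝒞}.Finite := by
  classical
  have : ((𝒞 ×ˢ 𝒞.biUnion fun C => (Mid C).powerset : Finset (X.Cube × Finset X.Hyperplane)) :
      Set (X.Cube × Finset X.Hyperplane)).Finite := Finset.finite_toSet _
  refine (this.preimage (f := fun p : X.FormIndex => p.1) Subtype.val_injective.injOn).subset ?_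
  intro p hp
  simp only [Set.mem_preimage, Finset.mem_coe, Finset.mem_product, Finset.mem_biUnion,
    Finset.mem_powerset]
  exact ⟨hp, p.1.1, hp, p.2⟩

theorem inner_eq_pairing {𝒞 : Finset X.Cube} {b b' : I → X.FormField} {β β' : X.HilbertModule}
    (h : Represents b β) (h' : Represents b' β') {s : I} (hs : SupportedOn 𝒞 (b s)) :
    inner ℂ (β.1 s) (β'.1 s) = pairing 𝒞 (b s) (b' s) := by
  classical
  let g : X.FormIndex → ℂ := fun p =>
    ∫ x, star (b s p.1.1 p.1.2 x) * b' s p.1.1 p.1.2 x ∂cubeMeasure p.1.1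
  have e1 : ∀ p : X.FormIndex, inner ℂ (β.1 s p) (β'.1 s p) = g p := by
    intro p
    rw [L2.inner_def]
    refine integral_congr_ae ?_
    filter_upwards [h s p, h' s p] with x h1 h2
    rw [h1, h2]
    simp [mul_comm]
  have e2 : inner ℂ (β.1 s) (β'.1 s) = ∑' p, g p :=
    (lp.inner_eq_tsum _ _).trans (tsum_congr e1)
  have e3 : ∀ p ∉ (finite_formIndex 𝒞).toFinset, g p = 0 := by
    intro p hp
    refine integral_eq_zero_of_ae ?_
    filter_upwards [ae_mem_unitCube p.1.1] with x hx
    rw [hs p.1.1 (fun hq => hp ((finite_formIndex 𝒞).mem_toFinset.2 hq)) p.1.2 p.2 x hx]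
    simp
  rw [e2, tsum_eq_sum e3, pairing, Finset.sum_sigma']
  symm
  refine Finset.sum_bij' (fun q hq => ⟨(q.1, q.2), Finset.mem_powerset.1 (Finset.mem_sigma.1 hq).2⟩)
    (fun p _ => ⟨p.1.1, p.1.2⟩) ?_ ?_ ?_ ?_ ?_
  · rintro ⟨C, J⟩ hq
    exact (finite_formIndex 𝒞).mem_toFinset.2 (Finset.mem_sigma.1 hq).1
  · rintro p hp
    exact Finset.mem_sigma.2 ⟨(finite_formIndex 𝒞).mem_toFinset.1 hp, Finset.mem_powerset.2 p.2⟩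
  · rintro ⟨C, J⟩ hq; rfl
  · rintro p hp; rfl
  · rintro ⟨C, J⟩ hq; rfl

theorem lp_sum_single_apply {ι : Type*} {E : ι → Type*} [∀ i, NormedAddCommGroup (E i)]
    [DecidableEq ι] (S : Finset ι) (f : ∀ i, E i) (q : ι) :
    (∑ p ∈ S, lp.single 2 p (f p)) q = if q ∈ S then f q else 0 := by
  rw [lp.coeFn_sum, Finset.sum_apply]
  split_ifs with h
  · rw [Finset.sum_eq_single_of_mem q h fun p _ hp => lp.single_apply_ne 2 p _ hp.symm,
      lp.single_apply_self]
  · exact Finset.sum_eq_zero fun p hp => lp.single_apply_ne 2 p _ fun e => h (e ▸ hp)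

theorem exists_hilbertModule (ξ : I → X.OmegaL2) (hξ : Continuous ξ) (h0 : ξ 0 ∈ X.AL2) :
    ∃ β : X.HilbertModule, ∀ s, β.1 s = ξ s :=
  ⟨⟨⟨ξ, hξ⟩, h0⟩, fun _ => rfl⟩

theorem exists_continuous_lp {ι : Type*} {E : ι → Type*} [∀ i, NormedAddCommGroup (E i)]
    [DecidableEq ι] (S : Finset ι) {f : I → ∀ i, E i} (hf : ∀ i, Continuous fun s => f s i) :
    ∃ ξ : I → lp E 2, Continuous ξ ∧ ∀ s q, ξ s q = if q ∈ S then f s q else 0 :=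
  ⟨fun s => ∑ p ∈ S, lp.single 2 p (f s p),
    continuous_finsetSum _ fun p _ => (lp.isometry_single p).continuous.comp (hf p),
    fun s q => lp_sum_single_apply S (f s) q⟩

theorem exists_continuous_toL2 {b : I → X.FormField}
    (hc : ∀ C, ∀ J ⊆ Mid C, JointCont C fun s => b s C J) :
    ∃ f : I → ∀ p : X.FormIndex, Lp ℂ 2 (cubeMeasure p.1.1), (∀ p, Continuous fun s => f s p) ∧
      ∀ (s : I) (p : X.FormIndex), f s p =ᵐ[cubeMeasure p.1.1] b s p.1.1 p.1.2 :=
  ⟨fun s p => toL2 (b s p.1.1 p.1.2) ((hc p.1.1 p.1.2 p.2).apply s),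
    fun p => JointCont.continuous_toL2 (f := fun s => b s p.1.1 p.1.2) (hc p.1.1 p.1.2 p.2),
    fun s p => coeFn_toL2 ((hc p.1.1 p.1.2 p.2).apply s)⟩

theorem exists_continuous_omegaL2 {𝒞 : Finset X.Cube} {b : I → X.FormField}
    (hc : ∀ C, ∀ J ⊆ Mid C, JointCont C fun s => b s C J) (hs : ∀ s, SupportedOn 𝒞 (b s)) :
    ∃ ξ : I → X.OmegaL2, Continuous ξ ∧
      ∀ s (q : X.FormIndex), ξ s q =ᵐ[cubeMeasure q.1.1] b s q.1.1 q.1.2 := by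
  classical
  obtain ⟨f, hf, hfe⟩ := exists_continuous_toL2 hc
  obtain ⟨ξ, hξ, hξe⟩ := exists_continuous_lp (finite_formIndex 𝒞).toFinset hf
  refine ⟨ξ, hξ, fun s q => ?_⟩
  rw [hξe]
  split_ifs with h
  · exact hfe s q
  · filter_upwards [ae_mem_unitCube q.1.1, Lp.coeFn_zero ℂ 2 (cubeMeasure q.1.1)] with x hx hz
    rw [hz, hs s q.1.1 (fun hq => h ((finite_formIndex 𝒞).mem_toFinset.2 hq)) q.1.2 q.2 x hx]
    rfl

variable [LinearOrder X.Hyperplane]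

theorem IsSmoothFamily.continuousOn_iteratedFDerivWithin {w : X.Hyperplane → ℝ} {b : I → X.FormField}
    (hb : IsSmoothFamily w b) {C : X.Cube} {J : Finset X.Hyperplane} (hJ : J ⊆ Mid C) (k : ℕ) :
    ContinuousOn (fun p : I × Coord C => iteratedFDerivWithin ℝ k (b p.1 C J) (unitCube C) p.2)
      (Set.univ ×ˢ unitCube C) :=
  continuousOn_univ_prod_iff
    (fun s => ((hb.memOmegaZero s C).smooth J hJ).continuousOn_iteratedFDerivWithin
      (by exact_mod_cast le_top) (uniqueDiffOn_unitCube C)) (hb.continuous C J hJ k)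

theorem IsSmoothFamily.jointCont {w : X.Hyperplane → ℝ} {b : I → X.FormField}
    (hb : IsSmoothFamily w b) {C : X.Cube} {J : Finset X.Hyperplane} (hJ : J ⊆ Mid C) :
    JointCont C fun s => b s C J := by
  have h : ContinuousOn (fun p : I × Coord C =>
      iteratedFDerivWithin ℝ 0 (b p.1 C J) (unitCube C) p.2 0) (Set.univ ×ˢ unitCube C) :=
    (continuous_eval_const (0 : Fin 0 → Coord C)).comp_continuousOn
      (hb.continuousOn_iteratedFDerivWithin hJ 0)
  simp only [iteratedFDerivWithin_zero_apply] at h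
  exact h

theorem IsSmoothFamily.add {w : X.Hyperplane → ℝ} {b b' : I → X.FormField}
    (hb : IsSmoothFamily w b) (hb' : IsSmoothFamily w b') : IsSmoothFamily w (b + b') where
  memOmegaZero s C :=
    ⟨fun J hJ => ((hb.memOmegaZero s C).smooth J hJ).add ((hb'.memOmegaZero s C).smooth J hJ),
      fun J hJ H hH x hx h => by
        have h1 := (hb.memOmegaZero s C).pullback_eq_zero J hJ H hH x hx h
        have h2 := (hb'.memOmegaZero s C).pullback_eq_zero J hJ H hH x hx h
        simp only [Pi.add_apply, h1, h2, add_zero]⟩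
  continuous C J hJ k s₀ := by
    refine tendstoUniformlyOn_of_continuousOn
      (F := fun s => iteratedFDerivWithin ℝ k ((b + b') s C J) (unitCube C)) (isCompact_unitCube C) ?_ s₀
    refine ((hb.continuousOn_iteratedFDerivWithin hJ k).add
      (hb'.continuousOn_iteratedFDerivWithin hJ k)).congr fun p hp => ?_
    exact iteratedFDerivWithin_add_apply
      ((((hb.memOmegaZero p.1 C).smooth J hJ).of_le (by exact_mod_cast le_top)) p.2 hp.2)
      ((((hb'.memOmegaZero p.1 C).smooth J hJ).of_le (by exact_mod_cast le_top)) p.2 hp.2)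
      (uniqueDiffOn_unitCube C) hp.2
  memA C := by
    obtain ⟨δ, hδ, h⟩ := hb.memA C
    obtain ⟨δ', hδ', h'⟩ := hb'.memA C
    refine ⟨min δ δ', lt_min hδ hδ', fun s hs => ?_⟩
    obtain ⟨c, hc⟩ := h s (hs.trans_le (min_le_left _ _))
    obtain ⟨c', hc'⟩ := h' s (hs.trans_le (min_le_right _ _))
    refine ⟨c + c', fun J hJ x hx => ?_⟩
    rw [Pi.add_apply, Pi.add_apply, Pi.add_apply, Pi.add_apply, hc J hJ x hx, hc' J hJ x hx]
    split_ifs <;> ring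
  finite_support := by
    refine (hb.finite_support.union hb'.finite_support).subset ?_
    rintro C ⟨s, J, hJ, x, hx, h⟩
    by_contra hC
    simp only [Set.mem_union, Set.mem_ofPred_eq, not_or, not_exists, not_and, not_not] at hC
    exact h (by simp only [Pi.add_apply, hC.1 s J hJ x hx, hC.2 s J hJ x hx, add_zero])

theorem IsSmoothFamily.zero (w : X.Hyperplane → ℝ) : IsSmoothFamily w (0 : I → X.FormField) where
  memOmegaZero s C := ⟨fun J _ => contDiffOn_const, fun _ _ _ _ _ _ _ => rfl⟩
  continuous C J hJ k s₀ := by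
    refine tendstoUniformlyOn_of_continuousOn
      (F := fun s => iteratedFDerivWithin ℝ k ((0 : I → X.FormField) s C J) (unitCube C))
      (isCompact_unitCube C) ?_ s₀
    refine ContinuousOn.congr (f := fun _ => 0) continuousOn_const fun p hp => ?_
    exact congrFun (iteratedFDerivWithin_fun_zero (𝕜 := ℝ) (i := k)) p.2
  memA C := ⟨1, one_pos, fun s _ => ⟨0, fun J _ x _ => by simp⟩⟩
  finite_support := by simp

theorem IsSmoothFamily.smul {w : X.Hyperplane → ℝ} {b : I → X.FormField}
    (hb : IsSmoothFamily w b) (f : C(I, ℂ)) : IsSmoothFamily w (smulFamily f b) where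
  memOmegaZero s C :=
    ⟨fun J hJ => contDiffOn_const.mul ((hb.memOmegaZero s C).smooth J hJ),
      fun J hJ H hH x hx h => by
        rw [smulFamily, (hb.memOmegaZero s C).pullback_eq_zero J hJ H hH x hx h, mul_zero]⟩
  continuous C J hJ k s₀ := by
    refine tendstoUniformlyOn_of_continuousOn
      (F := fun s => iteratedFDerivWithin ℝ k (smulFamily f b s C J) (unitCube C))
      (isCompact_unitCube C) ?_ s₀
    refine (((f.continuous.comp continuous_fst).continuousOn).smul
      (hb.continuousOn_iteratedFDerivWithin hJ k)).congr fun p hp => ?_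
    exact iteratedFDerivWithin_const_smul_apply (a := f p.1)
      ((((hb.memOmegaZero p.1 C).smooth J hJ).of_le (by exact_mod_cast le_top)) p.2 hp.2)
      (uniqueDiffOn_unitCube C) hp.2
  memA C := by
    obtain ⟨δ, hδ, h⟩ := hb.memA C
    refine ⟨δ, hδ, fun s hs => ?_⟩
    obtain ⟨c, hc⟩ := h s hs
    refine ⟨f s * c, fun J hJ x hx => ?_⟩
    rw [smulFamily, hc J hJ x hx]
    split_ifs <;> ring
  finite_support := by
    refine hb.finite_support.subset ?_
    rintro C ⟨s, J, hJ, x, hx, h⟩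
    exact ⟨s, J, hJ, x, hx, right_ne_zero_of_mul h⟩

theorem IsSmoothFamily.exists_supportedOn {w : X.Hyperplane → ℝ} {b : I → X.FormField}
    (hb : IsSmoothFamily w b) : ∃ 𝒞 : Finset X.Cube, ∀ s, SupportedOn 𝒞 (b s) :=
  ⟨hb.finite_support.toFinset, fun s C hC J hJ x hx => by
    by_contra h
    exact hC (hb.finite_support.mem_toFinset.2 ⟨s, J, hJ, x, hx, h⟩)⟩

/-- At parameter `0` the exponential in the definition of `A_s(C)` is `1`, so only constant
top-degree forms remain. -/
theorem mem_AL2_of_memA {ξ : X.OmegaL2} {b : X.FormField}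
    (hξ : ∀ q : X.FormIndex, ξ q =ᵐ[cubeMeasure q.1.1] b q.1.1 q.1.2)
    {w : X.Hyperplane → ℝ} (h0 : ∀ C, MemA w 0 C b) : ξ ∈ X.AL2 := by
  intro q
  obtain ⟨c, hcc⟩ := h0 q.1.1
  refine ⟨fun hq => Lp.ext ?_, if q.1.2 = Mid q.1.1 then c else 0, ?_⟩
  · refine (hξ q).trans ?_
    filter_upwards [ae_mem_unitCube q.1.1, Lp.coeFn_zero ℂ 2 (cubeMeasure q.1.1)] with x hx hz
    rw [hz, hcc q.1.2 q.2 x hx, if_neg hq]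
    rfl
  · refine (hξ q).trans ?_
    filter_upwards [ae_mem_unitCube q.1.1] with x hx
    rw [hcc q.1.2 q.2 x hx]
    simp

/-- A finitely supported, jointly continuous family of forms, whose value at `0` lies in `A^*`,
defines an element of `ℋ(X)`. -/
theorem exists_represents {𝒞 : Finset X.Cube} {b : I → X.FormField}
    (hc : ∀ C, ∀ J ⊆ Mid C, JointCont C fun s => b s C J) (hs : ∀ s, SupportedOn 𝒞 (b s))
    {w : X.Hyperplane → ℝ} (h0 : ∀ C, MemA w 0 C (b 0)) : ∃ β : X.HilbertModule, Represents b β := by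
  obtain ⟨ξ, hcont, hξ⟩ := exists_continuous_omegaL2 hc hs
  obtain ⟨β, hβ⟩ := exists_hilbertModule ξ hcont (mem_AL2_of_memA (hξ 0) h0)
  exact ⟨β, fun s q => by rw [hβ]; exact hξ s q⟩

end Families

end CubicalComplex

/-! ### Operators defined by symmetric relations. -/

namespace FibredModule

variable {E H : Type*} [NormedAddCommGroup E] [Module C(I, ℂ) E] [Inner C(I, ℂ) E]
    [NormedAddCommGroup H] [InnerProductSpace ℂ H] (𝓔 : FibredModule E H)

/-- Symmetry expresses the inner products of a value with the domain by the argument alone, and the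
domain is dense. -/
theorem IsSymmetricRelation.snd_eq {G : Set (E × E)} (hG : 𝓔.IsSymmetricRelation G)
    (hd : Dense {x | ∃ y, (x, y) ∈ G}) {x y y' : E} (h : (x, y) ∈ G) (h' : (x, y') ∈ G) : y = y' := by
  rw [← sub_eq_zero]
  refine 𝓔.eq_zero_of_inner_eq_zero hd fun z hz s => ?_
  obtain ⟨u, hu⟩ := hz
  rw [map_sub, inner_sub_left, hG _ h _ hu s, hG _ h' _ hu s, sub_self]

/-- A symmetric relation whose domain is a dense submodule is the graph of an operator. -/
theorem IsSymmetricRelation.exists_graph_eq {G : Set (E × E)} (hG : 𝓔.IsSymmetricRelation G)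
    (D : Submodule C(I, ℂ) E) (hD : ∀ x, x ∈ D ↔ ∃ y, (x, y) ∈ G) (hd : Dense (D : Set E)) :
    ∃ T : E →ₗ.[C(I, ℂ)] E, T.domain = D ∧ (T.graph : Set (E × E)) = G := by
  have hd' : Dense {x | ∃ y, (x, y) ∈ G} := by
    have : {x | ∃ y, (x, y) ∈ G} = (D : Set E) := by ext x; exact (hD x).symm
    rwa [this]
  choose F hF using fun x : D => (hD x.1).1 x.2
  let T : E →ₗ.[C(I, ℂ)] E :=
    { domain := D
      toFun :=
        { toFun := F
          -- Linearity is not read off from a formula. Both sides have the same inner products with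
          -- the dense domain, again by symmetry.
          map_add' := fun x y => by
            rw [← sub_eq_zero]
            refine 𝓔.eq_zero_of_inner_eq_zero hd' fun z hz s => ?_
            obtain ⟨u, hu⟩ := hz
            rw [map_sub, map_add, inner_sub_left, inner_add_left, hG _ (hF _) _ hu s,
              hG _ (hF x) _ hu s, hG _ (hF y) _ hu s]
            simp only [Submodule.coe_add, map_add, inner_add_left, sub_self]
          map_smul' := fun c x => by
            rw [← sub_eq_zero]
            refine 𝓔.eq_zero_of_inner_eq_zero hd' fun z hz s => ?_
            obtain ⟨u, hu⟩ := hz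
            rw [map_sub, RingHom.id_apply, 𝓔.ev_smul, inner_sub_left, inner_smul_left,
              hG _ (hF _) _ hu s, hG _ (hF x) _ hu s]
            simp only [Submodule.coe_smul, 𝓔.ev_smul, inner_smul_left, sub_self] } }
  refine ⟨T, rfl, Set.Subset.antisymm ?_ ?_⟩
  · intro p hp
    obtain ⟨x, hx1, hx2⟩ := T.mem_graph_iff.1 hp
    have := hF x
    rw [show F x = T x from rfl, hx1, hx2] at this
    exact this
  · intro p hp
    have hx : p.1 ∈ D := (hD _).2 ⟨p.2, hp⟩
    refine T.mem_graph_iff.2 ⟨⟨p.1, hx⟩, rfl, ?_⟩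
    exact hG.snd_eq 𝓔 hd' (hF ⟨p.1, hx⟩) hp

end FibredModule

/-! ### A formula for `𝒟` that is regular at `s = 0`. -/

namespace CubicalComplex

variable {V : Type*} {X : CubicalComplex V} [LinearOrder X.Hyperplane]

/-- The finite sum that computes `e_w`, `d_JV` and the corresponding part of `𝒟`. -/
noncomputable def raiseSum (P : V) (𝒞 : Finset X.Cube) (c v : X.Hyperplane → ℝ) (b : X.FormField) :
    X.FormField := by
  classical
  exact fun D J x => ∑ C ∈ 𝒞, ∑ H ∈ Mid D, if Step P C H D ∧ H ∈ J then
      sgn H (J.erase H) * pull (c H) (v H) C H D (b C (J.erase H)) x else 0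

/-- The finite sum that computes `e_w^⋄`, `δ_JV` and the corresponding part of `𝒟`. -/
noncomputable def lowerSum (P : V) (𝒞 : Finset X.Cube) (c v : X.Hyperplane → ℝ) (b : X.FormField) :
    X.FormField := by
  classical
  exact fun C J x => ∑ D ∈ 𝒞, ∑ H ∈ Mid D, if Step P C H D then
      sgn H J * push (c H) (v H) C D (b D (insert H J)) x else 0

theorem dJV_eq_sum {𝒞 : Finset X.Cube} {b : X.FormField} (hb : SupportedOn 𝒞 b) (P : V)
    (w : X.Hyperplane → ℝ) {D : X.Cube} {J : Finset X.Hyperplane} (hJ : J ⊆ Mid D) {x : Coord D}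
    (hx : x ∈ unitCube D) : dJV P w b D J x = raiseSum P 𝒞 w 0 b D J x := by
  classical
  rw [dJV, raiseSum, finsum_eq_sum_of_support_subset (s := 𝒞 ×ˢ Mid D), Finset.sum_product]
  · refine Finset.sum_congr rfl fun C _ => Finset.sum_congr rfl fun H _ => ?_
    rw [finsum_eq_if]
    by_cases h1 : Step P C H D <;> by_cases h2 : H ∈ J <;> simp [h1, h2, pull]
    ring
  · rintro ⟨C, H⟩ hp
    rw [Function.mem_support] at hp
    rw [Finset.mem_coe, Finset.mem_product]
    have h1 : Step P C H D := by
      by_contra h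
      exact hp (by simp [h])
    refine ⟨?_, h1.2.2⟩
    by_contra h
    refine hp ?_
    have := hb C h (J.erase H) (h1.erase_subset hJ) (transfer D C 0 x)
      (transfer_mem_unitCube hx ⟨le_rfl, zero_le_one⟩)
    simp [this]

/-- The operator `δ_JV` restricts to the face `x_H = 1`, whereas `lowerSum` integrates over `x_H`.
On forms with constant coefficients these agree, which is where `MemA` at parameter `0` enters. -/
theorem deltaJV_eq_sum {𝒞 : Finset X.Cube} {b : X.FormField} (hb : SupportedOn 𝒞 b)
    {v : X.Hyperplane → ℝ} (hc : ∀ C, MemA v 0 C b) (P : V) (w : X.Hyperplane → ℝ) {C : X.Cube}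
    {J : Finset X.Hyperplane} (hJ : J ⊆ Mid C) {x : Coord C} (hx : x ∈ unitCube C) :
    deltaJV P w b C J x = lowerSum P 𝒞 w 0 b C J x := by
  classical
  rw [deltaJV, lowerSum, finsum_eq_sum_of_support_subset (s := 𝒞 ×ˢ 𝒞.biUnion Mid),
    Finset.sum_product]
  · refine Finset.sum_congr rfl fun D hD => ?_
    rw [Finset.sum_subset (Finset.subset_biUnion_of_mem Mid hD)]
    · refine Finset.sum_congr rfl fun H _ => ?_
      rw [finsum_eq_if]
      by_cases h1 : Step P C H D
      · obtain ⟨c, hcD⟩ := hc D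
        have hs := h1.insert_subset hJ
        have e : ∀ t ∈ Set.uIcc (0 : ℝ) 1, (w H : ℂ) * Real.exp ((0 : X.Hyperplane → ℝ) H * (t - 1)) *
            b D (insert H J) (transfer C D t x) = w H * (if insert H J = Mid D then c else 0) := by
          intro t ht
          rw [Set.uIcc_of_le zero_le_one] at ht
          rw [hcD _ hs _ (transfer_mem_unitCube hx ht)]
          simp
        rw [if_pos h1, if_pos h1, push, intervalIntegral.integral_congr e,
          hcD _ hs _ (transfer_mem_unitCube hx ⟨zero_le_one, le_rfl⟩)]
        rw [intervalIntegral.integral_const, sub_zero, one_smul, zero_mul, Real.exp_zero,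
          Complex.ofReal_one, mul_one]
        ring
      · simp [h1]
    · intro H _ hH
      rw [if_neg fun h => hH h.2.2]
  · rintro ⟨D, H⟩ hp
    rw [Function.mem_support] at hp
    rw [Finset.mem_coe, Finset.mem_product]
    have h1 : Step P C H D := by
      by_contra h
      exact hp (by simp [h])
    have h2 : D ∈ 𝒞 := by
      by_contra h
      refine hp ?_
      simp [h1, hb D h _ (h1.insert_subset hJ) _ (transfer_mem_unitCube hx ⟨zero_le_one, le_rfl⟩)]
    exact ⟨h2, Finset.mem_biUnion.2 ⟨D, h2, h1.2.2⟩⟩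

theorem JointCont.raiseSum {𝒞 : Finset X.Cube} {b : I → X.FormField} {c v : I → X.Hyperplane → ℝ}
    (hb : ∀ C, ∀ J ⊆ Mid C, JointCont C fun s => b s C J) (P : V) (hc : ∀ H, Continuous fun s => c s H)
    (hv : ∀ H, Continuous fun s => v s H) {D : X.Cube} {J : Finset X.Hyperplane} (hJ : J ⊆ Mid D) :
    JointCont D fun s => raiseSum P 𝒞 (c s) (v s) (b s) D J := by
  classical
  exact JointCont.sum fun C _ => JointCont.sum fun H _ => JointCont.ite fun h =>
    (JointCont.of_param continuous_const).mul
      (JointCont.pull (hc H) (hv H) (hb C _ (h.1.erase_subset hJ)))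

theorem JointCont.lowerSum {𝒞 : Finset X.Cube} {b : I → X.FormField} {c v : I → X.Hyperplane → ℝ}
    (hb : ∀ C, ∀ J ⊆ Mid C, JointCont C fun s => b s C J) (P : V) (hc : ∀ H, Continuous fun s => c s H)
    (hv : ∀ H, Continuous fun s => v s H) {C : X.Cube} {J : Finset X.Hyperplane} (hJ : J ⊆ Mid C) :
    JointCont C fun s => lowerSum P 𝒞 (c s) (v s) (b s) C J := by
  classical
  exact JointCont.sum fun D _ => JointCont.sum fun H _ => JointCont.ite fun h =>
    (JointCont.of_param continuous_const).mul
      (JointCont.push (hc H) (hv H) (hb D _ (h.insert_subset hJ)))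

theorem IsSmoothFamily.jointCont_partialDeriv {w : X.Hyperplane → ℝ} {b : I → X.FormField}
    (hb : IsSmoothFamily w b) {C : X.Cube} {J : Finset X.Hyperplane} (hJ : J ⊆ Mid C)
    (H : X.Hyperplane) : JointCont C fun s => partialDeriv C H (b s C J) := by
  have h : ContinuousOn (fun p : I × Coord C =>
      iteratedFDerivWithin ℝ 1 (b p.1 C J) (unitCube C) p.2 fun _ K => if K.1 = H then 1 else 0)
      (Set.univ ×ˢ unitCube C) :=
    (continuous_eval_const (fun _ K => if K.1 = H then 1 else 0 : Fin 1 → Coord C)).comp_continuousOn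
      (hb.continuousOn_iteratedFDerivWithin hJ 1)
  refine ContinuousOn.congr h fun p hp => ?_
  rw [iteratedFDerivWithin_one_apply (uniqueDiffOn_unitCube C p.2 hp.2)]
  rfl

theorem partialDeriv_congr {C : X.Cube} {H : X.Hyperplane} {f g : Coord C → ℂ}
    (h : ∀ x ∈ unitCube C, f x = g x) {x : Coord C} (hx : x ∈ unitCube C) :
    partialDeriv C H f x = partialDeriv C H g x := by
  rw [partialDeriv, partialDeriv, fderivWithin_congr h (h x hx)]

theorem partialDeriv_exp (C : X.Cube) (v : X.Hyperplane → ℝ) (c : ℂ) {H : X.Hyperplane}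
    (hH : H ∈ Mid C) {x : Coord C} (hx : x ∈ unitCube C) :
    partialDeriv C H (fun x => c * Real.exp (∑ K : ↥(Mid C), v K.1 * x K)) x =
      v H * (c * Real.exp (∑ K : ↥(Mid C), v K.1 * x K)) := by
  have h1 : HasFDerivAt (fun x : Coord C => ∑ K : ↥(Mid C), v K.1 * x K)
      (∑ K : ↥(Mid C), v K.1 • ContinuousLinearMap.proj (R := ℝ) (φ := fun _ : ↥(Mid C) => ℝ) K) x :=
    HasFDerivAt.fun_sum fun K _ => (hasFDerivAt_apply K x).const_mul _
  have h2 : HasFDerivAt (fun x : Coord C => c * Real.exp (∑ K : ↥(Mid C), v K.1 * x K)) _ x :=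
    ((Complex.ofRealCLM.hasFDerivAt.comp x h1.exp).const_mul c)
  rw [partialDeriv, h2.hasFDerivWithinAt.fderivWithin (uniqueDiffOn_unitCube C x hx)]
  have h3 : ∑ K : ↥(Mid C), v K.1 * (if K.1 = H then (1 : ℝ) else 0) = v H := by
    rw [Finset.sum_eq_single ⟨H, hH⟩]
    · simp
    · intro K _ hK
      rw [if_neg fun h => hK (Subtype.ext h), mul_zero]
    · simp
  simp only [smul_apply, ContinuousLinearMap.comp_apply,
    sum_apply, ContinuousLinearMap.proj_apply, smul_eq_mul,
    Complex.ofRealCLM_apply, h3]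
  push_cast
  ring

/-- `d_v` and its adjoint vanish on the forms in `A_s(C)`, where `v = s w`. -/
theorem dW_add_dWAdj_eq_zero {w : X.Hyperplane → ℝ} {s : ℝ} {C : X.Cube} {b : X.FormField}
    (h : MemA w s C b) {J : Finset X.Hyperplane} (hJ : J ⊆ Mid C) {x : Coord C}
    (hx : x ∈ unitCube C) : dW (s • w) b C J x + dWAdj (s • w) b C J x = 0 := by
  obtain ⟨c, hc⟩ := h
  have e1 : dW (s • w) b C J x = 0 := by
    refine Finset.sum_eq_zero fun H hH => ?_
    have hs := (Finset.erase_subset H J).trans hJ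
    -- The differential raises the degree of a form that is already of top degree, so it only sees
    -- zero coefficients. The adjoint vanishes because `-∂/∂x_H + s w(H)` kills the exponential.
    have hne : J.erase H ≠ Mid C := fun e => Finset.notMem_erase H J (by rw [e]; exact hJ hH)
    have h0 : ∀ y ∈ unitCube C, b C (J.erase H) y = (fun _ => 0) y := fun y hy => by
      rw [hc _ hs y hy, if_neg hne]
    rw [partialDeriv_congr h0 hx, h0 x hx, partialDeriv]
    simp
  have e2 : dWAdj (s • w) b C J x = 0 := by
    refine Finset.sum_eq_zero fun H hH => ?_
    obtain ⟨hHC, hHJ⟩ := Finset.mem_sdiff.1 hH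
    have hs : insert H J ⊆ Mid C := Finset.insert_subset hHC hJ
    by_cases hM : insert H J = Mid C
    · have h0 : ∀ y ∈ unitCube C, b C (insert H J) y =
          (fun y => c * Real.exp (∑ K : ↥(Mid C), (s • w) K.1 * y K)) y := fun y hy => by
        rw [hc _ hs y hy, if_pos hM]
        simp only [Pi.smul_apply, smul_eq_mul, mul_assoc, Finset.mul_sum]
      rw [partialDeriv_congr h0 hx, h0 x hx, partialDeriv_exp C _ c hHC hx]
      ring
    · have h0 : ∀ y ∈ unitCube C, b C (insert H J) y = (fun _ => 0) y := fun y hy => by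
        rw [hc _ hs y hy, if_neg hM]
      rw [partialDeriv_congr h0 hx, h0 x hx, partialDeriv]
      simp
  rw [e1, e2, add_zero]

theorem raiseSum_smul (P : V) (𝒞 : Finset X.Cube) (a : ℝ) (c v : X.Hyperplane → ℝ) (b : X.FormField)
    (D : X.Cube) (J : Finset X.Hyperplane) (x : Coord D) :
    raiseSum P 𝒞 (a • c) v b D J x = a * raiseSum P 𝒞 c v b D J x := by
  simp only [raiseSum, Finset.mul_sum]
  refine Finset.sum_congr rfl fun C _ => Finset.sum_congr rfl fun H _ => ?_
  split_ifs
  · simp only [pull, Pi.smul_apply, smul_eq_mul, Complex.ofReal_mul]; ring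
  · simp

theorem lowerSum_smul (P : V) (𝒞 : Finset X.Cube) (a : ℝ) (c v : X.Hyperplane → ℝ) (b : X.FormField)
    (C : X.Cube) (J : Finset X.Hyperplane) (x : Coord C) :
    lowerSum P 𝒞 (a • c) v b C J x = a * lowerSum P 𝒞 c v b C J x := by
  simp only [lowerSum, Finset.mul_sum]
  refine Finset.sum_congr rfl fun D _ => Finset.sum_congr rfl fun H _ => ?_
  split_ifs
  · simp only [push, Pi.smul_apply, smul_eq_mul, Complex.ofReal_mul, mul_assoc,
      intervalIntegral.integral_const_mul]
    ring
  · simp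

/-- A formula for `𝒟` that is valid for all values of the parameter. -/
theorem curlyD_eq {𝒞 : Finset X.Cube} {w : X.Hyperplane → ℝ} {b : I → X.FormField}
    (hb : IsSmoothFamily w b) (hs : ∀ s, SupportedOn 𝒞 (b s)) (P : V) (s : I) {C : X.Cube}
    {J : Finset X.Hyperplane} (hJ : J ⊆ Mid C) {x : Coord C} (hx : x ∈ unitCube C) :
    curlyD P w b s C J x = ((s : ℝ)⁻¹ : ℂ) * (dW ((s : ℝ) • w) (b s) C J x +
      dWAdj ((s : ℝ) • w) (b s) C J x) + raiseSum P 𝒞 w ((s : ℝ) • w) (b s) C J x +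
      lowerSum P 𝒞 w ((s : ℝ) • w) (b s) C J x := by
  rw [curlyD]
  split_ifs with h0
  · subst h0
    have hA : ∀ D, MemA w 0 D (b 0) := fun D => by
      obtain ⟨δ, hδ, h⟩ := hb.memA D
      simpa using h 0 (by simpa using hδ)
    rw [julgValetteOp, Pi.add_apply, Pi.add_apply, Pi.add_apply, dJV_eq_sum (hs 0) P w hJ hx,
      deltaJV_eq_sum (hs 0) hA P w hJ hx]
    -- The convention `0⁻¹ = 0` removes the de Rham part at `s = 0`.
    simp
  · have hsne : ((s : ℝ) : ℂ) ≠ 0 := by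
      rw [Complex.ofReal_ne_zero]
      exact fun h => h0 (Subtype.ext h)
    -- The prefactor `s w(H)` cancels against `s⁻¹`, while the exponent keeps `s w(H)`. This is why
    -- `raiseSum` and `lowerSum` carry two separate weights.
    have e1 : eW P ((s : ℝ) • w) (b s) C J x = raiseSum P 𝒞 ((s : ℝ) • w) ((s : ℝ) • w) (b s) C J x :=
      eW_eq_sum (hs s) P _ hJ hx
    have e2 : eWAdj P ((s : ℝ) • w) (b s) C J x =
        lowerSum P 𝒞 ((s : ℝ) • w) ((s : ℝ) • w) (b s) C J x := eWAdj_eq_sum (hs s) P _ hJ hx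
    simp only [deRhamOp, Pi.add_apply]
    rw [e1, e2, raiseSum_smul, lowerSum_smul]
    field_simp
    ring

end CubicalComplex

/-! ### `𝒟` as a symmetric operator on `ℋ(X)`. -/

namespace CubicalComplex

variable {V : Type*} {X : CubicalComplex V}

theorem pairing_smul_right (𝒞 : Finset X.Cube) (b b' : X.FormField) (a : ℂ) :
    pairing 𝒞 b (fun C J x => a * b' C J x) = a * pairing 𝒞 b b' := by
  simp only [pairing, Finset.mul_sum, ← integral_const_mul, mul_left_comm a]

variable [LinearOrder X.Hyperplane]

/-- Values can appear only one step up or down from the support, and bounded geometry leaves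
finitely many steps up from each cube. -/
theorem exists_supportedOn_curlyD (hbg : X.BoundedGeometry) {𝒞 : Finset X.Cube} {w : X.Hyperplane → ℝ}
    {b : I → X.FormField} (hb : IsSmoothFamily w b) (hs : ∀ s, SupportedOn 𝒞 (b s)) (P : V) :
    ∃ 𝒟 : Finset X.Cube, ∀ s, SupportedOn 𝒟 (curlyD P w b s) := by
  classical
  refine ⟨𝒞 ∪ 𝒞.biUnion (fun C => (finite_step_up hbg P C).toFinset.image Prod.fst) ∪
    𝒞.biUnion (fun D => (finite_step_down P D).toFinset.image Prod.fst), fun s C hC J hJ x hx => ?_⟩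
  simp only [Finset.mem_union, Finset.mem_biUnion, Finset.mem_image, Set.Finite.mem_toFinset,
    Set.mem_ofPred_eq, Prod.exists, exists_and_right, exists_eq_right, not_or, not_exists,
    not_and] at hC
  obtain ⟨⟨h0, h1⟩, h2⟩ := hC
  have hz : ∀ K ⊆ Mid C, ∀ y ∈ unitCube C, b s C K y = (fun _ => 0) y := fun K hK y hy =>
    hs s C h0 K hK y hy
  have e1 : dW ((s : ℝ) • w) (b s) C J x = 0 := Finset.sum_eq_zero fun H hH => by
    have hK := (Finset.erase_subset H J).trans hJ
    rw [partialDeriv_congr (hz _ hK) hx, hz _ hK x hx, partialDeriv]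
    simp
  have e2 : dWAdj ((s : ℝ) • w) (b s) C J x = 0 := Finset.sum_eq_zero fun H hH => by
    have hK : insert H J ⊆ Mid C := Finset.insert_subset (Finset.mem_sdiff.1 hH).1 hJ
    rw [partialDeriv_congr (hz _ hK) hx, hz _ hK x hx, partialDeriv]
    simp
  have e3 : raiseSum P 𝒞 w ((s : ℝ) • w) (b s) C J x = 0 :=
    Finset.sum_eq_zero fun C' hC' => Finset.sum_eq_zero fun H _ =>
      if_neg fun h => h1 C' hC' H h.1
  have e4 : lowerSum P 𝒞 w ((s : ℝ) • w) (b s) C J x = 0 :=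
    Finset.sum_eq_zero fun D hD => Finset.sum_eq_zero fun H _ => if_neg fun h => h2 D hD H h
  rw [curlyD_eq hb hs P s hJ hx, e1, e2, e3, e4]
  simp

theorem jointCont_curlyD {𝒞 : Finset X.Cube} {w : X.Hyperplane → ℝ}
    {b : I → X.FormField} (hb : IsSmoothFamily w b) (hs : ∀ s, SupportedOn 𝒞 (b s)) (P : V)
    {C : X.Cube} {J : Finset X.Hyperplane} (hJ : J ⊆ Mid C) :
    JointCont C fun s => curlyD P w b s C J := by
  have hc : ∀ C, ∀ J ⊆ Mid C, JointCont C fun s => b s C J := fun C J hJ => hb.jointCont hJ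
  have hw : ∀ H, Continuous fun s : I => ((s : ℝ) • w) H := fun H => by
    simp only [Pi.smul_apply]; fun_prop
  obtain ⟨δ, hδ, hA⟩ := hb.memA C
  -- Below `δ` the form lies in `A_s(C)` and the de Rham part vanishes, so `s⁻¹` may be replaced by
  -- the continuous function `(max s δ)⁻¹` without changing the product.
  have h1 : JointCont C fun s x => (((max (s : ℝ) δ)⁻¹ : ℝ) : ℂ) * (dW ((s : ℝ) • w) (b s) C J x +
      dWAdj ((s : ℝ) • w) (b s) C J x) := by
    refine (JointCont.of_param ?_).mul (JointCont.add ?_ ?_)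
    · refine Complex.continuous_ofReal.comp (Continuous.inv₀ (by fun_prop) fun s => ?_)
      exact (lt_max_of_lt_right hδ).ne'
    · refine JointCont.sum fun H hH => (JointCont.of_param continuous_const).mul ?_
      have hK := (Finset.erase_subset H J).trans hJ
      exact (hb.jointCont_partialDeriv hK H).add
        ((JointCont.of_param (Complex.continuous_ofReal.comp (hw H))).mul (hb.jointCont hK))
    · refine JointCont.sum fun H hH => (JointCont.of_param continuous_const).mul ?_
      have hK : insert H J ⊆ Mid C := Finset.insert_subset (Finset.mem_sdiff.1 hH).1 hJ
      exact (hb.jointCont_partialDeriv hK H).neg.add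
        ((JointCont.of_param (Complex.continuous_ofReal.comp (hw H))).mul (hb.jointCont hK))
  refine ((h1.add (JointCont.raiseSum (𝒞 := 𝒞) (c := fun _ => w) hc P (fun _ => continuous_const) hw hJ)).add
    (JointCont.lowerSum (𝒞 := 𝒞) (c := fun _ => w) hc P (fun _ => continuous_const) hw hJ)).congr
      fun s x hx => ?_
  rw [curlyD_eq hb hs P s hJ hx]
  rcases lt_or_ge (s : ℝ) δ with h | h
  · rw [dW_add_dWAdj_eq_zero (hA s h) hJ hx, mul_zero, mul_zero]
  · rw [max_eq_left h, Complex.ofReal_inv]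

/-- A step adds one hyperplane to the cube and the same one to the multi-index, so at `s = 0`
top-degree constants go to top-degree constants and the value stays in `A^*`. -/
theorem memA_curlyD_zero {w : X.Hyperplane → ℝ} {b : I → X.FormField} (hb : IsSmoothFamily w b)
    (P : V) (C : X.Cube) : MemA w 0 C (curlyD P w b 0) := by
  classical
  obtain ⟨𝒞, hs⟩ := hb.exists_supportedOn
  have hA : ∀ D, ∃ c : ℂ, ∀ J ⊆ Mid D, ∀ x ∈ unitCube D, b 0 D J x = if J = Mid D then c else 0 :=
    fun D => by
      obtain ⟨δ, hδ, h⟩ := hb.memA D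
      obtain ⟨c, hc⟩ := h 0 (by simpa using hδ)
      exact ⟨c, by simpa using hc⟩
  choose c hc using hA
  have hA0 : ∀ D, MemA w 0 D (b 0) := fun D => ⟨c D, by simpa using hc D⟩
  refine ⟨(∑ C' ∈ 𝒞, ∑ H ∈ Mid C, if Step P C' H C then sgn H ((Mid C).erase H) * (w H * c C') else 0) +
    ∑ D ∈ 𝒞, ∑ H ∈ Mid D, if Step P C H D then sgn H (Mid C) * (w H * c D) else 0,
    fun J hJ x hx => ?_⟩
  have e : curlyD P w b 0 C J x = raiseSum P 𝒞 w 0 (b 0) C J x + lowerSum P 𝒞 w 0 (b 0) C J x := by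
    rw [curlyD, if_pos rfl, julgValetteOp, Pi.add_apply, Pi.add_apply, Pi.add_apply,
      dJV_eq_sum (hs 0) P w hJ hx, deltaJV_eq_sum (hs 0) hA0 P w hJ hx]
  have hpush : ∀ {D : X.Cube} {H : X.Hyperplane}, Step P C H D →
      push (w H) ((0 : X.Hyperplane → ℝ) H) C D (b 0 D (insert H J)) x =
        w H * if insert H J = Mid D then c D else 0 := by
    intro D H h
    have e : ∀ t ∈ Set.uIcc (0 : ℝ) 1, (w H : ℂ) * Real.exp ((0 : X.Hyperplane → ℝ) H * (t - 1)) *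
        b 0 D (insert H J) (transfer C D t x) = w H * (if insert H J = Mid D then c D else 0) := by
      intro t ht
      rw [Set.uIcc_of_le zero_le_one] at ht
      rw [hc D _ (h.insert_subset hJ) _ (transfer_mem_unitCube hx ht)]
      simp
    rw [push, intervalIntegral.integral_congr e, intervalIntegral.integral_const, sub_zero, one_smul]
  have hpull : ∀ {C' : X.Cube} {H : X.Hyperplane}, Step P C' H C →
      pull (w H) ((0 : X.Hyperplane → ℝ) H) C' H C (b 0 C' (J.erase H)) x =
        w H * if J.erase H = Mid C' then c C' else 0 := by
    intro C' H h
    rw [pull, hc C' _ (h.erase_subset hJ) _ (transfer_mem_unitCube hx ⟨le_rfl, zero_le_one⟩)]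
    simp
  rw [e]
  by_cases hM : J = Mid C
  · subst hM
    rw [if_pos rfl, zero_mul, Real.exp_zero, Complex.ofReal_one, mul_one, raiseSum, lowerSum]
    congr 1
    · refine Finset.sum_congr rfl fun C' _ => Finset.sum_congr rfl fun H hH => ?_
      by_cases h : Step P C' H C
      · have h3 : (Mid C).erase H = Mid C' := by
          rw [h.mid_eq, Finset.erase_insert h.notMem]
        rw [if_pos ⟨h, hH⟩, if_pos h, hpull h, if_pos h3]
      · rw [if_neg fun h' => h h'.1, if_neg h]
    · refine Finset.sum_congr rfl fun D _ => Finset.sum_congr rfl fun H _ => ?_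
      by_cases h : Step P C H D
      · rw [if_pos h, if_pos h, hpush h, if_pos h.mid_eq.symm]
      · rw [if_neg h, if_neg h]
  · rw [if_neg hM]
    have e1 : raiseSum P 𝒞 w 0 (b 0) C J x = 0 := by
      refine Finset.sum_eq_zero fun C' _ => Finset.sum_eq_zero fun H hH => ?_
      split_ifs with h
      · rw [hpull h.1, if_neg, mul_zero, mul_zero]
        intro h3
        exact hM (by rw [h.1.mid_eq, ← h3, Finset.insert_erase h.2])
      · rfl
    have e2 : lowerSum P 𝒞 w 0 (b 0) C J x = 0 := by
      refine Finset.sum_eq_zero fun D _ => Finset.sum_eq_zero fun H _ => ?_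
      split_ifs with h
      · rw [hpush h, if_neg, mul_zero, mul_zero]
        intro h3
        rw [h.mid_eq] at h3
        refine hM (hJ.antisymm fun K hK => ?_)
        have : K ∈ insert H J := by rw [h3]; exact Finset.mem_insert_of_mem hK
        exact (Finset.mem_insert.1 this).resolve_left fun e => h.notMem (e ▸ hK)
      · rfl
    rw [e1, e2, add_zero]

theorem exists_represents_curlyD (hbg : X.BoundedGeometry) {w : X.Hyperplane → ℝ}
    {b : I → X.FormField} (hb : IsSmoothFamily w b) (P : V) :
    ∃ y : X.HilbertModule, Represents (curlyD P w b) y := by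
  obtain ⟨𝒞, hs⟩ := hb.exists_supportedOn
  obtain ⟨𝒟, hs'⟩ := exists_supportedOn_curlyD hbg hb hs P
  exact exists_represents (fun C J hJ => jointCont_curlyD hb hs P hJ) hs' (memA_curlyD_zero hb P)

theorem IsSmoothFamily.exists_represents {w : X.Hyperplane → ℝ} {b : I → X.FormField}
    (hb : IsSmoothFamily w b) : ∃ β : X.HilbertModule, Represents b β := by
  obtain ⟨𝒞, hs⟩ := hb.exists_supportedOn
  refine CubicalComplex.exists_represents (w := w) (fun C J hJ => hb.jointCont hJ) hs fun C => ?_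
  obtain ⟨δ, hδ, h⟩ := hb.memA C
  simpa using h 0 (by simpa using hδ)

/-- For `s ≠ 0` this is symmetry of the de Rham operator with the real factor `s⁻¹`. Both sides are
continuous in `s` and the complement of `0` is dense, so the Julg-Valette case needs no computation.
-/
theorem curlyD_symmetric (hX : X.IsCAT0) (P : V) {w : X.Hyperplane → ℝ} {b b' : I → X.FormField}
    (hb : IsSmoothFamily w b) (hb' : IsSmoothFamily w b') {β β' y y' : X.HilbertModule}
    (h : Represents b β) (h' : Represents b' β') (hy : Represents (curlyD P w b) y)
    (hy' : Represents (curlyD P w b') y') (s : I) :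
    inner ℂ (y.1 s) (β'.1 s) = inner ℂ (β.1 s) (y'.1 s) := by
  classical
  obtain ⟨𝒞₁, hs₁⟩ := hb.exists_supportedOn
  obtain ⟨𝒞₂, hs₂⟩ := hb'.exists_supportedOn
  have hs : ∀ s, SupportedOn (𝒞₁ ∪ 𝒞₂) (b s) := fun s C hC => hs₁ s C fun h =>
    hC (Finset.mem_union_left _ h)
  have hs' : ∀ s, SupportedOn (𝒞₁ ∪ 𝒞₂) (b' s) := fun s C hC => hs₂ s C fun h =>
    hC (Finset.mem_union_right _ h)
  generalize 𝒞₁ ∪ 𝒞₂ = 𝒞 at hs hs'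
  have key : Set.EqOn (fun s : I => inner ℂ (y.1 s) (β'.1 s)) (fun s => inner ℂ (β.1 s) (y'.1 s)) {0}ᶜ := by
    intro s h0
    have hD : ∀ b : I → X.FormField, curlyD P w b s =
        fun C J x => (((s : ℝ)⁻¹ : ℝ) : ℂ) * deRhamOp P ((s : ℝ) • w) (b s) C J x := fun b => by
      rw [curlyD, if_neg (show s ≠ 0 from h0), Complex.ofReal_inv]
    change inner ℂ (y.1 s) (β'.1 s) = inner ℂ (β.1 s) (y'.1 s)
    rw [← inner_conj_symm, inner_eq_pairing h' hy (hs' s), inner_eq_pairing h hy' (hs s), hD, hD,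
      pairing_smul_right, pairing_smul_right, map_mul, Complex.conj_ofReal, ← Complex.star_def,
      pairing_star, pairing_deRhamOp hX P (hb.memOmegaZero s) (hb'.memOmegaZero s) (hs s) (hs' s)]
  exact congrFun (Continuous.ext_on (dense_compl_singleton (0 : I))
    (y.1.continuous.inner β'.1.continuous) (β.1.continuous.inner y'.1.continuous) key) s

/-- The graph of `𝒟`. -/
def curlyDGraph (P : V) (w : X.Hyperplane → ℝ) : Set (X.HilbertModule × X.HilbertModule) :=
  {p | ∃ b, IsSmoothFamily w b ∧ Represents b p.1 ∧ Represents (curlyD P w b) p.2}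

theorem isSymmetricRelation_curlyDGraph (hX : X.IsCAT0) (P : V) (w : X.Hyperplane → ℝ) :
    X.fibred.IsSymmetricRelation (curlyDGraph P w) := by
  rintro ⟨β, y⟩ ⟨b, hb, h, hy⟩ ⟨β', y'⟩ ⟨b', hb', h', hy'⟩ s
  exact curlyD_symmetric hX P hb hb' h h' hy hy' s

variable (X) in
/-- The domain of `𝒟` as a submodule. -/
def curlyDSubmodule (w : X.Hyperplane → ℝ) : Submodule C(I, ℂ) X.HilbertModule where
  carrier := curlyDDomain w
  zero_mem' := ⟨0, IsSmoothFamily.zero w, Represents.zero⟩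
  add_mem' := fun ⟨b, hb, h⟩ ⟨b', hb', h'⟩ => ⟨b + b', hb.add hb', h.add h'⟩
  smul_mem' := fun c _ ⟨_, hb, h⟩ => ⟨_, hb.smul c, h.smul c⟩

theorem IsCurlyD.graph_subset {P : V} {w : X.Hyperplane → ℝ}
    {T : X.HilbertModule →ₗ.[C(I, ℂ)] X.HilbertModule} (hT : IsCurlyD P w T) :
    (T.graph : Set (X.HilbertModule × X.HilbertModule)) ⊆ curlyDGraph P w := by
  intro p hp
  obtain ⟨x, hx1, hx2⟩ := T.mem_graph_iff.1 hp
  obtain ⟨b, hb, hr⟩ : (x : X.HilbertModule) ∈ curlyDDomain w := by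
    rw [← hT.domain_eq]; exact x.2
  exact ⟨b, hb, hx1 ▸ hr, hx2 ▸ hT.apply_eq x b hb hr⟩

theorem exists_mem_curlyDGraph_iff (hbg : X.BoundedGeometry) (P : V) {w : X.Hyperplane → ℝ}
    (β : X.HilbertModule) : (∃ y, (β, y) ∈ curlyDGraph P w) ↔ β ∈ curlyDDomain w := by
  constructor
  · rintro ⟨y, b, hb, h, _⟩
    exact ⟨b, hb, h⟩
  · rintro ⟨b, hb, h⟩
    obtain ⟨y, hy⟩ := exists_represents_curlyD hbg hb P
    exact ⟨y, b, hb, h, hy⟩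

/-- The family representing an element of `ℋ_0(X)` is not unique, since its values off the cubes are
arbitrary. Symmetry shows that the result does not depend on the choice. -/
theorem curlyDGraph_unique (hX : X.IsCAT0) (hbg : X.BoundedGeometry) {P : V}
    {w : X.Hyperplane → ℝ} (hd : Dense (curlyDDomain w : Set X.HilbertModule)) {β y y' : X.HilbertModule}
    (h : (β, y) ∈ curlyDGraph P w) (h' : (β, y') ∈ curlyDGraph P w) : y = y' := by
  refine FibredModule.IsSymmetricRelation.snd_eq X.fibred (isSymmetricRelation_curlyDGraph hX P w)
    ?_ h h'
  have : {β | ∃ y, (β, y) ∈ curlyDGraph P w} = curlyDDomain w :=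
    Set.ext (exists_mem_curlyDGraph_iff hbg P)
  rw [this]
  exact hd

theorem represents_curlyD_of_mem (hX : X.IsCAT0) (hbg : X.BoundedGeometry) {P : V}
    {w : X.Hyperplane → ℝ} (hd : Dense (curlyDDomain w : Set X.HilbertModule)) {β y : X.HilbertModule}
    (h : (β, y) ∈ curlyDGraph P w) {b : I → X.FormField} (hb : IsSmoothFamily w b)
    (hr : Represents b β) : Represents (curlyD P w b) y := by
  obtain ⟨y', hy'⟩ := exists_represents_curlyD hbg hb P
  obtain rfl := curlyDGraph_unique hX hbg hd h ⟨b, hb, hr, hy'⟩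
  exact hy'

theorem exists_graph_eq_curlyDGraph (hX : X.IsCAT0) (hbg : X.BoundedGeometry) (P : V)
    {w : X.Hyperplane → ℝ} (hd : Dense (curlyDDomain w : Set X.HilbertModule)) :
    ∃ T : X.HilbertModule →ₗ.[C(I, ℂ)] X.HilbertModule, T.domain = X.curlyDSubmodule w ∧
      (T.graph : Set (X.HilbertModule × X.HilbertModule)) = curlyDGraph P w :=
  FibredModule.IsSymmetricRelation.exists_graph_eq X.fibred (isSymmetricRelation_curlyDGraph hX P w)
    (X.curlyDSubmodule w) (fun β => (exists_mem_curlyDGraph_iff hbg P β).symm) hd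

theorem existsUnique_isCurlyD (hX : X.IsCAT0) (hbg : X.BoundedGeometry) (P : V)
    {w : X.Hyperplane → ℝ} (hd : Dense (curlyDDomain w : Set X.HilbertModule)) :
    ∃! T : X.HilbertModule →ₗ.[C(I, ℂ)] X.HilbertModule, IsCurlyD P w T := by
  obtain ⟨T, hTd, hTg⟩ := exists_graph_eq_curlyDGraph hX hbg P hd
  have hT : ∀ β : T.domain, ((β : X.HilbertModule), T β) ∈ curlyDGraph P w := fun β =>
    hTg.subset (T.mem_graph β)
  have hTd' : (T.domain : Set X.HilbertModule) = curlyDDomain w :=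
    congrArg (fun D : Submodule C(I, ℂ) X.HilbertModule => (D : Set X.HilbertModule)) hTd
  refine ⟨T, ⟨hTd', fun β b hb h => represents_curlyD_of_mem hX hbg hd (hT β) hb h⟩, fun S hS => ?_⟩
  refine LinearPMap.ext (SetLike.coe_injective (hS.domain_eq.trans hTd'.symm)) fun x hx hx' => ?_
  exact curlyDGraph_unique hX hbg hd (hS.graph_subset (S.mem_graph ⟨x, hx⟩)) (hT ⟨x, hx'⟩)

end CubicalComplex

/-! ### Shifts of symmetric operators on finite-dimensional invariant spaces. -/

/-- A symmetric operator on a finite-dimensional space does not have `±i` as an eigenvalue. -/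
theorem mem_span_add_smul_of_symmetric {H : Type*} [NormedAddCommGroup H] [InnerProductSpace ℂ H]
    {ι : Type*} [Finite ι] {B DB : ι → H} (hD : ∀ i, DB i ∈ Submodule.span ℂ (Set.range B))
    (hs : ∀ i j, inner ℂ (DB i) (B j) = inner ℂ (B i) (DB j)) {a : ℂ}
    (ha : a = Complex.I ∨ a = -Complex.I) (i : ι) :
    B i ∈ Submodule.span ℂ (Set.range fun i => DB i + a • B i) := by
  cases nonempty_fintype ι
  set R := Submodule.span ℂ (Set.range fun i => DB i + a • B i) with hR
  have hRW : R ≤ Submodule.span ℂ (Set.range B) := by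
    rw [hR, Submodule.span_le]
    rintro _ ⟨j, rfl⟩
    exact Submodule.add_mem _ (hD j)
      (Submodule.smul_mem _ _ (Submodule.subset_span (Set.mem_range_self j)))
  have : FiniteDimensional ℂ R := FiniteDimensional.span_of_finite ℂ (Set.finite_range _)
  obtain ⟨u, hu, y, hy, huy⟩ := R.exists_add_mem_mem_orthogonal (B i)
  have hyW : y ∈ Submodule.span ℂ (Set.range B) := by
    rw [show y = B i - u by rw [huy]; abel]
    exact Submodule.sub_mem _ (Submodule.subset_span (Set.mem_range_self i)) (hRW hu)
  -- The vectors `B i` may be dependent, so the operator is applied to a choice of coefficients of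
  -- `y`. Orthogonality of `y` to its own shifted image reads `⟨Dy, y⟩ + conj(a) ‖y‖² = 0`; the
  -- first term is real and `a` is imaginary, so `y = 0`.
  obtain ⟨c, rfl⟩ := (Submodule.mem_span_range_iff_exists_fun ℂ).1 hyW
  have hz : ∑ j, c j • DB j + a • ∑ j, c j • B j ∈ R := by
    have : ∑ j, c j • DB j + a • ∑ j, c j • B j = ∑ j, c j • (DB j + a • B j) := by
      simp only [smul_add, Finset.sum_add_distrib, Finset.smul_sum, smul_comm a]
    rw [this]
    exact Submodule.sum_mem _ fun j _ =>
      Submodule.smul_mem _ _ (Submodule.subset_span (Set.mem_range_self j))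
  have h1 := (R.mem_orthogonal _).1 hy _ hz
  have h2 : inner ℂ (∑ j, c j • DB j) (∑ j, c j • B j) = inner ℂ (∑ j, c j • B j) (∑ j, c j • DB j) := by
    simp only [sum_inner, inner_sum, inner_smul_left, inner_smul_right, hs]
  have him : (inner ℂ (∑ j, c j • DB j) (∑ j, c j • B j)).im = 0 := by
    have := inner_conj_symm (𝕜 := ℂ) (∑ j, c j • B j) (∑ j, c j • DB j)
    rw [← h2] at this
    exact Complex.conj_eq_iff_im.1 (by rw [h2] at this ⊢; rw [this])
  rw [inner_add_left, inner_smul_left, inner_self_eq_norm_sq_to_K] at h1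
  have h3 := congrArg Complex.im h1
  have h4 : ‖∑ j, c j • B j‖ ^ 2 = 0 := by
    rw [Complex.add_im, him, zero_add] at h3
    rcases ha with rfl | rfl
    · simpa [← Complex.ofReal_pow] using h3
    · simpa [← Complex.ofReal_pow] using h3
  have h5 : ∑ j, c j • B j = 0 := by simpa using h4
  rw [huy, h5, add_zero]
  exact hu

namespace FibredModule

variable {E H : Type*} [NormedAddCommGroup E] [Module C(I, ℂ) E] [Inner C(I, ℂ) E]
    [NormedAddCommGroup H] [InnerProductSpace ℂ H] (𝓔 : FibredModule E H)

/-- The values at `s` of the elements of a submodule. -/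
def fibre (R : Submodule C(I, ℂ) E) (s : I) : Submodule ℂ H where
  carrier := 𝓔.ev s '' R
  zero_mem' := ⟨0, R.zero_mem, map_zero _⟩
  add_mem' := by
    rintro _ _ ⟨x, hx, rfl⟩ ⟨y, hy, rfl⟩
    exact ⟨x + y, R.add_mem hx hy, map_add _ _ _⟩
  smul_mem' := by
    rintro a _ ⟨x, hx, rfl⟩
    exact ⟨_, R.smul_mem (algebraMap ℂ C(I, ℂ) a) hx, 𝓔.ev_const_smul s a x⟩

theorem mem_fibre {R : Submodule C(I, ℂ) E} {x : E} (hx : x ∈ R) (s : I) : 𝓔.ev s x ∈ 𝓔.fibre R s :=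
  ⟨x, hx, rfl⟩

theorem dense_of_fibre (R : Submodule C(I, ℂ) E)
    (h : ∀ (s : I) (γ : E), 𝓔.ev s γ ∈ closure (𝓔.fibre R s : Set H)) : Dense (R : Set E) := by
  refine 𝓔.dense_of_fibrewise R fun s γ ε hε => ?_
  obtain ⟨_, ⟨r, hr, rfl⟩, hd⟩ := Metric.mem_closure_iff.1 (h s γ) ε hε
  exact ⟨r, hr, by rwa [dist_comm, dist_eq_norm] at hd⟩

end FibredModule

/-! ### The finite set of cubes above a given cube. -/

namespace CubicalComplex

variable {V : Type*} {X : CubicalComplex V}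

/-- The cubes obtained from `B` by repeatedly passing from a cube `C` to one of the cubes `D_H`. -/
def Above (P : V) (B : X.Cube) : Set X.Cube :=
  {D | Relation.ReflTransGen (fun C D => ∃ H, Step P C H D) B D}

theorem Above.step {P : V} {B C D : X.Cube} {H : X.Hyperplane} (hC : C ∈ Above P B)
    (h : Step P C H D) : D ∈ Above P B := Relation.ReflTransGen.tail hC ⟨H, h⟩

theorem Above.mid_subset {P : V} {B D : X.Cube} (hD : D ∈ Above P B) : Mid B ⊆ Mid D := by
  induction hD with
  | refl => exact subset_rfl
  | tail _ h ih =>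
    obtain ⟨H, h⟩ := h
    exact fun K hK => h.mid_iff.2 (Or.inr (ih hK))

/-- The hyperplanes available for a further step decrease strictly along a step. By interchanging
steps, each one available at `D` was already available at `C`, and the one just used is lost.
Induction on their number applies, with finitely many choices at each stage. -/
theorem finite_above (hX : X.IsCAT0) (hb : X.BoundedGeometry) (P : V) (B : X.Cube) :
    (Above P B).Finite := by
  let up : X.Cube → Set X.Hyperplane := fun C => {H | ∃ D, Step P C H D}
  have hfin : ∀ C, (up C).Finite := fun C => ((finite_step_up hb P C).image Prod.snd).subset
    fun H ⟨D, hD⟩ => ⟨(D, H), hD, rfl⟩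
  have key : ∀ (k : ℕ) (C : X.Cube), (up C).ncard ≤ k → (Above P C).Finite := by
    intro k
    induction k with
    | zero =>
      intro C hC
      have h0 : up C = ∅ := (Set.ncard_eq_zero (hfin C)).1 (Nat.le_zero.1 hC)
      refine (Set.finite_singleton C).subset fun D hD => ?_
      rcases Relation.ReflTransGen.cases_head hD with rfl | ⟨E, ⟨H, h⟩, _⟩
      · rfl
      · exact absurd (show H ∈ up C from ⟨E, h⟩) (by rw [h0]; exact Set.notMem_empty _)
    | succ k ih =>
      intro C hC
      have h1 : ∀ p ∈ {p : X.Cube × X.Hyperplane | Step P C p.2 p.1}, (Above P p.1).Finite := by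
        rintro ⟨D, H⟩ h
        refine ih D (Nat.le_of_lt_succ (lt_of_lt_of_le (Set.ncard_lt_ncard ?_ (hfin C)) hC))
        refine ⟨fun K ⟨E, hE⟩ => ?_, fun hsub => ?_⟩
        · obtain ⟨D₂, h2, _⟩ := step_swap hX h hE
          exact ⟨D₂, h2⟩
        · obtain ⟨E, hE⟩ := hsub ⟨D, h⟩
          exact hE.notMem h.2.2
      refine ((Set.finite_singleton C).union ((finite_step_up hb P C).biUnion h1)).subset fun D hD => ?_
      rcases Relation.ReflTransGen.cases_head hD with rfl | ⟨E, ⟨H, h⟩, hE⟩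
      · exact Or.inl rfl
      · exact Or.inr (Set.mem_biUnion (show (E, H) ∈ {p : X.Cube × X.Hyperplane | Step P C p.2 p.1} from h) hE)
  exact key _ B le_rfl

/-- The hyperplanes added to `B` can be removed in any order. If `K` is not the last one added,
interchange it with the last step and use the induction hypothesis. -/
theorem Above.step_down (hX : X.IsCAT0) {P : V} {B C D : X.Cube} {K : X.Hyperplane}
    (hD : D ∈ Above P B) (hK : K ∉ Mid B) (h : Step P C K D) : C ∈ Above P B := by
  induction hD generalizing C with
  | refl => exact absurd h.2.2 hK
  | @tail E D hE hED ih =>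
    obtain ⟨H, hED⟩ := hED
    by_cases hKH : K = H
    · subst hKH
      rw [Step.down_unique hX h hED]
      exact hE
    · obtain ⟨E', hE'⟩ := exists_step_down hX P ((hED.mid_iff.1 h.2.2).resolve_left hKH)
      obtain ⟨D₂, h1, h2⟩ := step_swap hX hE' hED
      rw [Step.down_unique hX h h2]
      exact Above.step (ih hE') h1

/-- Pass repeatedly to the face `x_H = 1` for the hyperplanes `H` outside `S`. -/
theorem exists_above (hX : X.IsCAT0) (P : V) {S : Finset X.Hyperplane} :
    ∀ {C : X.Cube}, S ⊆ Mid C → ∃ B, C ∈ Above P B ∧ Mid B = S := by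
  classical
  have key : ∀ (k : ℕ) (C : X.Cube), S ⊆ Mid C → (Mid C \ S).card = k → ∃ B, C ∈ Above P B ∧ Mid B = S := by
    intro k
    induction k with
    | zero =>
      intro C hS hC
      refine ⟨C, Relation.ReflTransGen.refl, Finset.Subset.antisymm ?_ hS⟩
      exact Finset.sdiff_eq_empty_iff_subset.1 (Finset.card_eq_zero.1 hC)
    | succ k ih =>
      intro C hS hC
      obtain ⟨H, hH⟩ := Finset.card_pos.1 (by rw [hC]; exact k.succ_pos)
      obtain ⟨hHC, hHS⟩ := Finset.mem_sdiff.1 hH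
      obtain ⟨C', h⟩ := exists_step_down hX P hHC
      have e : Mid C' \ S = (Mid C \ S).erase H := by
        ext K
        simp only [Finset.mem_sdiff, Finset.mem_erase, h.mid_iff]
        constructor
        · rintro ⟨h1, h2⟩
          exact ⟨fun e => h.notMem (e ▸ h1), Or.inr h1, h2⟩
        · rintro ⟨h1, h2, h3⟩
          exact ⟨h2.resolve_left h1, h3⟩
      obtain ⟨B, hB, hBS⟩ := ih C' (fun K hK => (h.mid_iff.1 (hS hK)).resolve_left fun e => hHS (e ▸ hK))
        (by rw [e, Finset.card_erase_of_mem hH, hC]; rfl)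
      exact ⟨B, Above.step hB h, hBS⟩
  exact fun {C} hS => key _ C hS rfl

end CubicalComplex

/-! ### Finite-dimensional invariant spaces and the range of a shift. -/

namespace FibredModule

variable {E H : Type*} [NormedAddCommGroup E] [Module C(I, ℂ) E] [Inner C(I, ℂ) E]
    [NormedAddCommGroup H] [InnerProductSpace ℂ H] (𝓔 : FibredModule E H)

/-- The range of `T + a`. -/
noncomputable def shiftedRange (T : E →ₗ.[C(I, ℂ)] E) (a : ℂ) : Submodule C(I, ℂ) E :=
  LinearMap.range (T.toFun + algebraMap ℂ C(I, ℂ) a • T.domain.subtype)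

theorem IsSymmetricRelation.mono {G G' : Set (E × E)} (hG : 𝓔.IsSymmetricRelation G) (h : G' ⊆ G) :
    𝓔.IsSymmetricRelation G' := fun p hp q hq s => hG p (h hp) q (h hq) s

/-- Invariance is needed only at the one parameter `s`. The family may leave the span at other
parameters, which leaves freedom in extending eigenforms to elements of the domain. -/
theorem mem_fibre_shiftedRange {T : E →ₗ.[C(I, ℂ)] E}
    (hT : 𝓔.IsSymmetricRelation (T.graph : Set (E × E))) {ι : Type*} [Finite ι] (β : ι → T.domain)
    (s : I) (hinv : ∀ i, 𝓔.ev s (T (β i)) ∈ Submodule.span ℂ (Set.range fun j => 𝓔.ev s (β j : E)))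
    {a : ℂ} (ha : a = Complex.I ∨ a = -Complex.I) (i : ι) :
    𝓔.ev s (β i : E) ∈ 𝓔.fibre (shiftedRange T a) s := by
  have h := mem_span_add_smul_of_symmetric hinv
    (fun i j => hT _ (T.mem_graph (β i)) _ (T.mem_graph (β j)) s) ha i
  refine (Submodule.span_le.2 ?_) h
  rintro _ ⟨j, rfl⟩
  refine ⟨T (β j) + algebraMap ℂ C(I, ℂ) a • (β j : E), ⟨β j, rfl⟩, ?_⟩
  rw [map_add, 𝓔.ev_const_smul]

end FibredModule

namespace CubicalComplex

variable {V : Type*} {X : CubicalComplex V}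

/-- `ξ` is the element of `Ω*_{L²}(X)` given by the form `b`. -/
def RepresentsAt (b : X.FormField) (ξ : X.OmegaL2) : Prop :=
  ∀ p : X.FormIndex, ξ p =ᵐ[cubeMeasure p.1.1] b p.1.1 p.1.2

theorem Represents.at {b : I → X.FormField} {β : X.HilbertModule} (h : Represents b β) (s : I) :
    RepresentsAt (b s) (X.fibred.ev s β) := h s

theorem RepresentsAt.unique {b : X.FormField} {ξ η : X.OmegaL2} (h : RepresentsAt b ξ)
    (h' : RepresentsAt b η) : ξ = η :=
  lp.ext (funext fun p => Lp.ext ((h p).trans (h' p).symm))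

theorem RepresentsAt.congr {b b' : X.FormField} {ξ : X.OmegaL2} (h : RepresentsAt b ξ)
    (hb : ∀ C, ∀ J ⊆ Mid C, ∀ x ∈ unitCube C, b C J x = b' C J x) : RepresentsAt b' ξ := fun p => by
  filter_upwards [h p, ae_mem_unitCube p.1.1] with x h1 hx
  rw [h1, hb _ _ p.2 x hx]

theorem RepresentsAt.zero : RepresentsAt (0 : X.FormField) 0 := fun p =>
  Lp.coeFn_zero ℂ 2 (cubeMeasure p.1.1)

theorem RepresentsAt.add {b b' : X.FormField} {ξ ξ' : X.OmegaL2} (h : RepresentsAt b ξ)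
    (h' : RepresentsAt b' ξ') : RepresentsAt (b + b') (ξ + ξ') := fun p => by
  filter_upwards [h p, h' p, Lp.coeFn_add (ξ p) (ξ' p)] with x h1 h2 h3
  change (ξ p + ξ' p : Lp ℂ 2 (cubeMeasure p.1.1)) x = b p.1.1 p.1.2 x + b' p.1.1 p.1.2 x
  rw [h3, Pi.add_apply, h1, h2]

theorem RepresentsAt.smul {b : X.FormField} {ξ : X.OmegaL2} (h : RepresentsAt b ξ) (a : ℂ) :
    RepresentsAt (a • b) (a • ξ) := fun p => by
  filter_upwards [h p, Lp.coeFn_smul a (ξ p)] with x h1 h2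
  change (a • ξ p : Lp ℂ 2 (cubeMeasure p.1.1)) x = a • b p.1.1 p.1.2 x
  rw [h2, Pi.smul_apply, h1]

theorem RepresentsAt.exists_mem_span {ι : Type*} {b : ι → X.FormField} {ξ : ι → X.OmegaL2}
    (h : ∀ i, RepresentsAt (b i) (ξ i)) {g : X.FormField} (hg : g ∈ Submodule.span ℂ (Set.range b)) :
    ∃ ζ ∈ Submodule.span ℂ (Set.range ξ), RepresentsAt g ζ := by
  induction hg using Submodule.span_induction with
  | mem x hx =>
    obtain ⟨i, rfl⟩ := hx
    exact ⟨ξ i, Submodule.subset_span (Set.mem_range_self i), h i⟩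
  | zero => exact ⟨0, Submodule.zero_mem _, RepresentsAt.zero⟩
  | add x y _ _ hx hy =>
    obtain ⟨u, hu, hu'⟩ := hx
    obtain ⟨v, hv, hv'⟩ := hy
    exact ⟨u + v, Submodule.add_mem _ hu hv, hu'.add hv'⟩
  | smul a x _ hx =>
    obtain ⟨u, hu, hu'⟩ := hx
    exact ⟨a • u, Submodule.smul_mem _ a hu, hu'.smul a⟩

theorem RepresentsAt.mem_span {ι : Type*} {b : ι → X.FormField} {ξ : ι → X.OmegaL2}
    (h : ∀ i, RepresentsAt (b i) (ξ i)) {g : X.FormField} (hg : g ∈ Submodule.span ℂ (Set.range b))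
    {η : X.OmegaL2} (hη : RepresentsAt g η) : η ∈ Submodule.span ℂ (Set.range ξ) := by
  obtain ⟨ζ, hζ, hζ'⟩ := exists_mem_span h hg
  rwa [hη.unique hζ']

variable [LinearOrder X.Hyperplane]

theorem IsCurlyD.isSymmetricRelation (hX : X.IsCAT0) {P : V} {w : X.Hyperplane → ℝ}
    {T : X.HilbertModule →ₗ.[C(I, ℂ)] X.HilbertModule} (hT : IsCurlyD P w T) :
    X.fibred.IsSymmetricRelation (T.graph : Set (X.HilbertModule × X.HilbertModule)) :=
  FibredModule.IsSymmetricRelation.mono X.fibred (isSymmetricRelation_curlyDGraph hX P w)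
    hT.graph_subset

theorem IsCurlyD.exists_represents {P : V} {w : X.Hyperplane → ℝ}
    {T : X.HilbertModule →ₗ.[C(I, ℂ)] X.HilbertModule} (hT : IsCurlyD P w T)
    {b : I → X.FormField} (hb : IsSmoothFamily w b) :
    ∃ β : T.domain, Represents b (β : X.HilbertModule) := by
  obtain ⟨β, hβ⟩ := hb.exists_represents
  have h1 : β ∈ curlyDDomain w := ⟨b, hb, hβ⟩
  have h2 : β ∈ (T.domain : Set X.HilbertModule) := hT.domain_eq.superset h1
  exact ⟨⟨β, h2⟩, hβ⟩

theorem IsCurlyD.ev_apply_mem_span {P : V} {w : X.Hyperplane → ℝ}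
    {T : X.HilbertModule →ₗ.[C(I, ℂ)] X.HilbertModule} (hT : IsCurlyD P w T) {ι : Type*}
    {b : ι → I → X.FormField} (hb : ∀ i, IsSmoothFamily w (b i)) (s : I) {β : ι → T.domain}
    (hβ : ∀ i, Represents (b i) (β i : X.HilbertModule)) (i : ι)
    (hinv : ∃ g ∈ Submodule.span ℂ (Set.range fun j => b j s),
      ∀ C, ∀ J ⊆ Mid C, ∀ x ∈ unitCube C, curlyD P w (b i) s C J x = g C J x) :
    X.fibred.ev s (T (β i)) ∈
      Submodule.span ℂ (Set.range fun j => X.fibred.ev s (β j : X.HilbertModule)) := by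
  obtain ⟨g, hg, hge⟩ := hinv
  exact RepresentsAt.mem_span (b := fun j => b j s)
    (ξ := fun j => X.fibred.ev s (β j : X.HilbertModule)) (fun j => (hβ j).at s) hg
    (((hT.apply_eq (β i) (b i) (hb i) (hβ i)).at s).congr hge)

theorem IsCurlyD.mem_fibre_shiftedRange (hX : X.IsCAT0) {P : V} {w : X.Hyperplane → ℝ}
    {T : X.HilbertModule →ₗ.[C(I, ℂ)] X.HilbertModule} (hT : IsCurlyD P w T) {ι : Type*} [Finite ι]
    {b : ι → I → X.FormField} (hb : ∀ i, IsSmoothFamily w (b i)) (s : I)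
    (hinv : ∀ i, ∃ g ∈ Submodule.span ℂ (Set.range fun j => b j s),
      ∀ C, ∀ J ⊆ Mid C, ∀ x ∈ unitCube C, curlyD P w (b i) s C J x = g C J x)
    {a : ℂ} (ha : a = Complex.I ∨ a = -Complex.I) (i : ι) {ξ : X.OmegaL2}
    (hξ : RepresentsAt (b i s) ξ) : ξ ∈ X.fibred.fibre (FibredModule.shiftedRange T a) s := by
  choose β hβ using fun i => hT.exists_represents (hb i)
  rw [hξ.unique ((hβ i).at s)]
  exact X.fibred.mem_fibre_shiftedRange (hT.isSymmetricRelation hX) β s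
    (fun i => hT.ev_apply_mem_span hb s hβ i (hinv i)) ha i

theorem mem_fibre_curlyDSubmodule {w : X.Hyperplane → ℝ} {b : I → X.FormField}
    (hb : IsSmoothFamily w b) (s : I) {ξ : X.OmegaL2} (hξ : RepresentsAt (b s) ξ) :
    ξ ∈ X.fibred.fibre (X.curlyDSubmodule w) s := by
  obtain ⟨β, hβ⟩ := hb.exists_represents
  have hmem : β ∈ X.curlyDSubmodule w := ⟨b, hb, hβ⟩
  rw [hξ.unique (hβ.at s)]
  exact X.fibred.mem_fibre hmem s

end CubicalComplex

/-! ### Eigenforms on a single cube. -/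

namespace CubicalComplex

section Profiles

/-- The factor of an eigenform in a direction along which it is a function. -/
noncomputable def bot (n : ℕ) (t : ℝ) : ℝ := Real.sin (n * Real.pi * t)

/-- The factor of an eigenform in a direction along which it is a one-form. -/
noncomputable def top (v : ℝ) (n : ℕ) (t : ℝ) : ℝ :=
  if n = 0 then Real.exp (v * t)
  else n * Real.pi * Real.cos (n * Real.pi * t) + v * Real.sin (n * Real.pi * t)

/-- The derivative of `top`. -/
noncomputable def topDeriv (v : ℝ) (n : ℕ) (t : ℝ) : ℝ :=
  if n = 0 then v * Real.exp (v * t)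
  else -(n * Real.pi) ^ 2 * Real.sin (n * Real.pi * t) + v * (n * Real.pi * Real.cos (n * Real.pi * t))

theorem hasDerivAt_bot (n : ℕ) (t : ℝ) :
    HasDerivAt (bot n) (n * Real.pi * Real.cos (n * Real.pi * t)) t := by
  exact ((hasDerivAt_id' t).const_mul (n * Real.pi)).sin.congr_deriv (by ring)

theorem hasDerivAt_top (v : ℝ) (n : ℕ) (t : ℝ) : HasDerivAt (top v n) (topDeriv v n t) t := by
  unfold top topDeriv
  split_ifs with h
  · exact ((hasDerivAt_id' t).const_mul v).exp.congr_deriv (by ring)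
  · have h1 := ((hasDerivAt_id' t).const_mul (n * Real.pi)).sin.const_mul v
    have h2 := ((hasDerivAt_id' t).const_mul (n * Real.pi)).cos.const_mul (n * Real.pi)
    exact (h2.add h1).congr_deriv (by ring)

theorem contDiff_bot (n : ℕ) : ContDiff ℝ ∞ (bot n) := by
  unfold bot; fun_prop

theorem contDiff_top (v : ℝ) (n : ℕ) : ContDiff ℝ ∞ (top v n) := by
  unfold top
  split_ifs <;> fun_prop

theorem deriv_bot_add {n : ℕ} (hn : n ≠ 0) (v t : ℝ) :
    n * Real.pi * Real.cos (n * Real.pi * t) + v * bot n t = top v n t := by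
  rw [top, if_neg hn, bot]

/-- For `n ≠ 0` the adjoint of `d/dt + v` leads back to `bot`, with the eigenvalue `(nπ)² + v²`. The
exponential `top v 0` is annihilated. -/
theorem neg_topDeriv_add (v : ℝ) (n : ℕ) (t : ℝ) :
    -topDeriv v n t + v * top v n t = (if n = 0 then 0 else (n * Real.pi) ^ 2 + v ^ 2) * bot n t := by
  unfold topDeriv top bot
  split_ifs <;> ring

theorem bot_zero_right (n : ℕ) : bot n 0 = 0 := by simp [bot]

theorem bot_one_right (n : ℕ) : bot n 1 = 0 := by simp [bot, Real.sin_nat_mul_pi]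

/-- The integrand is the derivative of `c e^{v(t-1)} sin(nπt)`, which vanishes at both ends. Hence
`e_v^⋄` annihilates directions of nonzero frequency. -/
theorem integral_exp_mul_top_eq_zero (c v : ℝ) {n : ℕ} (hn : n ≠ 0) :
    ∫ t in (0 : ℝ)..1, c * Real.exp (v * (t - 1)) * top v n t = 0 := by
  have h : ∀ t ∈ Set.uIcc (0 : ℝ) 1, HasDerivAt (fun t => c * Real.exp (v * (t - 1)) * bot n t)
      (c * Real.exp (v * (t - 1)) * top v n t) t := by
    intro t _
    have h1 := ((((hasDerivAt_id' t).sub_const 1).const_mul v).exp.const_mul c).mul (hasDerivAt_bot n t)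
    exact h1.congr_deriv (by rw [← deriv_bot_add hn]; ring)
  rw [intervalIntegral.integral_eq_sub_of_hasDerivAt h, bot_one_right, bot_zero_right, mul_zero,
    mul_zero, sub_zero]
  refine Continuous.intervalIntegrable ?_ _ _
  have := (contDiff_top v n).continuous
  fun_prop

end Profiles

variable {V : Type*} {X : CubicalComplex V}

/-- Two forms agree on all the cubes. -/
def EqOnCubes (b b' : X.FormField) : Prop :=
  ∀ C, ∀ J ⊆ Mid C, ∀ x ∈ unitCube C, b C J x = b' C J x

/-- The indices of a finite-dimensional space of eigenforms that is invariant under the de Rham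
operator. -/
def eigenStates (P : V) (B : X.Cube) : Set (X.Cube × Finset X.Hyperplane) :=
  {τ | τ.1 ∈ Above P B ∧ τ.2 ⊆ Mid τ.1 ∧ ∀ K ∈ Mid τ.1, K ∉ Mid B → K ∈ τ.2}

theorem finite_eigenStates (hX : X.IsCAT0) (hb : X.BoundedGeometry) (P : V) (B : X.Cube) :
    (eigenStates P B).Finite := by
  classical
  refine ((finite_above hX hb P B).biUnion fun C _ =>
    (((Mid C).powerset.finite_toSet).image fun J => (C, J))).subset ?_
  rintro ⟨C, J⟩ ⟨h1, h2, _⟩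
  exact Set.mem_biUnion (x := C) h1 ⟨J, Finset.mem_coe.2 (Finset.mem_powerset.2 h2), rfl⟩

variable [LinearOrder X.Hyperplane]

theorem partialDeriv_prod_add {C : X.Cube} {H : X.Hyperplane} (hH : H ∈ Mid C)
    {g g' : X.Hyperplane → ℝ → ℝ} (hg : ∀ K t, HasDerivAt (g K) (g' K t) t) (a c : ℝ) {x : Coord C}
    (hx : x ∈ unitCube C) :
    a * partialDeriv C H (fun x => ((∏ K : ↥(Mid C), g K.1 (x K) : ℝ) : ℂ)) x +
      c * ((∏ K : ↥(Mid C), g K.1 (x K) : ℝ) : ℂ) =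
      ((∏ K : ↥(Mid C), if K.1 = H then a * g' H (x K) + c * g H (x K) else g K.1 (x K) : ℝ) : ℂ) := by
  have h1 : HasFDerivAt (fun x : Coord C => ∏ K : ↥(Mid C), g K.1 (x K))
      (∑ K : ↥(Mid C), (∏ L ∈ Finset.univ.erase K, g L.1 (x L)) •
        (g' K.1 (x K) • ContinuousLinearMap.proj (R := ℝ) (φ := fun _ : ↥(Mid C) => ℝ) K)) x :=
    HasFDerivAt.finsetProd fun K _ => (hg K.1 (x K)).comp_hasFDerivAt x (hasFDerivAt_apply K x)
  have h2 : HasFDerivAt (fun x : Coord C => ((∏ K : ↥(Mid C), g K.1 (x K) : ℝ) : ℂ)) _ x :=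
    Complex.ofRealCLM.hasFDerivAt.comp x h1
  let H' : ↥(Mid C) := ⟨H, hH⟩
  have h3 : partialDeriv C H (fun x => ((∏ K : ↥(Mid C), g K.1 (x K) : ℝ) : ℂ)) x =
      (((∏ K ∈ Finset.univ.erase H', g K.1 (x K)) * g' H (x H') : ℝ) : ℂ) := by
    rw [partialDeriv, h2.hasFDerivWithinAt.fderivWithin (uniqueDiffOn_unitCube C x hx),
      ContinuousLinearMap.comp_apply, Complex.ofRealCLM_apply, sum_apply,
      Finset.sum_eq_single H']
    · simp [H']
    · intro K _ hK
      have : ¬ K.1 = H := fun e => hK (Subtype.ext e)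
      simp [this]
    · simp
  have h4 : ∏ K : ↥(Mid C), g K.1 (x K) = g H (x H') * ∏ K ∈ Finset.univ.erase H', g K.1 (x K) :=
    (Finset.mul_prod_erase _ _ (Finset.mem_univ H')).symm
  have h5 : (∏ K : ↥(Mid C), if K.1 = H then a * g' H (x K) + c * g H (x K) else g K.1 (x K)) =
      (a * g' H (x H') + c * g H (x H')) * ∏ K ∈ Finset.univ.erase H', g K.1 (x K) := by
    rw [← Finset.mul_prod_erase _ _ (Finset.mem_univ H'), if_pos rfl]
    congr 1
    refine Finset.prod_congr rfl fun K hK => if_neg fun e => ?_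
    exact (Finset.mem_erase.1 hK).1 (Subtype.ext e)
  rw [h3, h4, h5]
  push_cast
  ring

theorem prod_mid_eq {C D : X.Cube} {H : X.Hyperplane} (h : MidInsert C H D) (f : X.Hyperplane → ℝ → ℝ)
    (y : Coord D) : ∏ K : ↥(Mid D), f K.1 (y K) =
      f H (coord D H y) * ∏ K : ↥(Mid C), f K.1 (transfer D C 0 y K) := by
  have e1 : ∏ K : ↥(Mid D), f K.1 (y K) = ∏ K ∈ Mid D, f K (coord D K y) := by
    refine Eq.trans (Finset.prod_congr rfl fun K _ => ?_)
      (Finset.prod_coe_sort (Mid D) fun K => f K (coord D K y))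
    rw [coord, dif_pos K.2]
  have e2 : ∏ K : ↥(Mid C), f K.1 (transfer D C 0 y K) = ∏ K ∈ Mid C, f K (coord D K y) := by
    refine Eq.trans (Finset.prod_congr rfl fun K _ => ?_)
      (Finset.prod_coe_sort (Mid C) fun K => f K (coord D K y))
    have hK : K.1 ∈ Mid D := h.mid_iff.2 (Or.inr K.2)
    rw [coord, dif_pos hK, transfer_of_mem hK]
  have hM : Mid D = insert H (Mid C) := by
    ext K; rw [h.mid_iff, Finset.mem_insert]
  rw [e1, e2, hM, Finset.prod_insert h.notMem]

/-- The factor of an eigenform in the direction of the hyperplane `K`. -/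
noncomputable def profile (v : X.Hyperplane → ℝ) (n : X.Hyperplane → ℕ) (J : Finset X.Hyperplane)
    (K : X.Hyperplane) (t : ℝ) : ℝ := if K ∈ J then top (v K) (n K) t else bot (n K) t

/-- The form `f dx_{J₀}` on the cube `C₀`, where `f` is a product of functions of the coordinates;
it is an eigenform of the square of the de Rham operator. -/
noncomputable def eigenForm (v : X.Hyperplane → ℝ) (n : X.Hyperplane → ℕ) (C₀ : X.Cube)
    (J₀ : Finset X.Hyperplane) : X.FormField := by
  classical
  exact fun C J x => if C = C₀ ∧ J = J₀ then ((∏ K : ↥(Mid C), profile v n J K.1 (x K) : ℝ) : ℂ) else 0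

/-- The derivative of `profile`. -/
noncomputable def profileDeriv (v : X.Hyperplane → ℝ) (n : X.Hyperplane → ℕ) (J : Finset X.Hyperplane)
    (K : X.Hyperplane) (t : ℝ) : ℝ :=
  if K ∈ J then topDeriv (v K) (n K) t else n K * Real.pi * Real.cos (n K * Real.pi * t)

theorem hasDerivAt_profile (v : X.Hyperplane → ℝ) (n : X.Hyperplane → ℕ) (J : Finset X.Hyperplane)
    (K : X.Hyperplane) (t : ℝ) : HasDerivAt (profile v n J K) (profileDeriv v n J K t) t := by
  unfold profile profileDeriv
  split_ifs
  · exact hasDerivAt_top _ _ _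
  · exact hasDerivAt_bot _ _

theorem contDiff_profile (v : X.Hyperplane → ℝ) (n : X.Hyperplane → ℕ) (J : Finset X.Hyperplane)
    (K : X.Hyperplane) : ContDiff ℝ ∞ (profile v n J K) := by
  unfold profile
  split_ifs
  · exact contDiff_top _ _
  · exact contDiff_bot _

theorem eigenForm_self (v : X.Hyperplane → ℝ) (n : X.Hyperplane → ℕ) (C : X.Cube)
    (J : Finset X.Hyperplane) :
    eigenForm v n C J C J = fun x => ((∏ K : ↥(Mid C), profile v n J K.1 (x K) : ℝ) : ℂ) := by
  ext x
  rw [eigenForm, if_pos ⟨rfl, rfl⟩]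

theorem eigenForm_of_ne_left (v : X.Hyperplane → ℝ) (n : X.Hyperplane → ℕ) {C C₀ : X.Cube}
    (J J₀ : Finset X.Hyperplane) (h : C ≠ C₀) : eigenForm v n C₀ J₀ C J = fun _ => 0 := by
  ext x
  rw [eigenForm, if_neg fun e => h e.1]

theorem eigenForm_of_ne_right (v : X.Hyperplane → ℝ) (n : X.Hyperplane → ℕ) (C C₀ : X.Cube)
    {J J₀ : Finset X.Hyperplane} (h : J ≠ J₀) : eigenForm v n C₀ J₀ C J = fun _ => 0 := by
  ext x
  rw [eigenForm, if_neg fun e => h e.2]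

theorem supportedOn_eigenForm (v : X.Hyperplane → ℝ) (n : X.Hyperplane → ℕ) (C₀ : X.Cube)
    (J₀ : Finset X.Hyperplane) : SupportedOn {C₀} (eigenForm v n C₀ J₀) := fun C hC J _ x _ => by
  rw [eigenForm_of_ne_left v n J J₀ fun e => hC (by rw [e]; exact Finset.mem_singleton_self _)]

theorem memOmegaZero_eigenForm (v : X.Hyperplane → ℝ) (n : X.Hyperplane → ℕ) (C₀ : X.Cube)
    (J₀ : Finset X.Hyperplane) (C : X.Cube) : MemOmegaZero C (eigenForm v n C₀ J₀) := by
  constructor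
  · intro J _
    by_cases h : C = C₀
    · subst h
      by_cases hJ : J = J₀
      · subst hJ
        rw [eigenForm_self]
        refine ContDiff.contDiffOn (Complex.ofRealCLM.contDiff.comp (contDiff_prod fun K _ => ?_))
        exact (contDiff_profile v n J K.1).comp (contDiff_apply ℝ ℝ K)
      · rw [eigenForm_of_ne_right v n _ _ hJ]
        exact contDiffOn_const
    · rw [eigenForm_of_ne_left v n _ _ h]
      exact contDiffOn_const
  · intro J _ H hHJ x _ hx
    rw [eigenForm]
    split_ifs
    · rw [Finset.prod_eq_zero (Finset.mem_univ H), Complex.ofReal_zero]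
      rw [profile, if_neg hHJ]
      rcases hx with hx | hx
      · rw [hx, bot_zero_right]
      · rw [hx, bot_one_right]
    · rfl

theorem partialDeriv_zero (C : X.Cube) (H : X.Hyperplane) (x : Coord C) :
    partialDeriv C H (fun _ => 0) x = 0 := by
  simp [partialDeriv]

/-- The span of the eigenforms. -/
noncomputable def eigenSpan (P : V) (B : X.Cube) (v : X.Hyperplane → ℝ) (n : X.Hyperplane → ℕ) :
    Submodule ℂ X.FormField :=
  Submodule.span ℂ (Set.range fun τ : eigenStates P B => eigenForm v n τ.1.1 τ.1.2)

theorem mem_eigenSpan {P : V} {B : X.Cube} (v : X.Hyperplane → ℝ) (n : X.Hyperplane → ℕ)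
    {τ : X.Cube × Finset X.Hyperplane} (hτ : τ ∈ eigenStates P B) :
    eigenForm v n τ.1 τ.2 ∈ eigenSpan P B v n := Submodule.subset_span ⟨⟨τ, hτ⟩, rfl⟩

/-- The frequency is nonzero exactly on the hyperplanes of `B`. A state lies on a cube above `B` and
is a one-form in all the added directions, so the differential only meets directions of nonzero
frequency and turns their `bot` into `top`. -/
theorem dW_eigenForm {P : V} {B : X.Cube} (v : X.Hyperplane → ℝ) {n : X.Hyperplane → ℕ}
    (hn : ∀ K, n K ≠ 0 ↔ K ∈ Mid B) {τ : X.Cube × Finset X.Hyperplane} (hτ : τ ∈ eigenStates P B) :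
    ∃ g ∈ eigenSpan P B v n, EqOnCubes (dW v (eigenForm v n τ.1 τ.2)) g := by
  obtain ⟨C₀, J₀⟩ := τ
  obtain ⟨hC₀, hJ₀, hst⟩ := hτ
  simp only at hC₀ hJ₀ hst
  refine ⟨∑ H ∈ Mid C₀ \ J₀, sgn H J₀ • eigenForm v n C₀ (insert H J₀),
    Submodule.sum_mem _ fun H hH => Submodule.smul_mem _ _ ?_, fun C J hJ x hx => ?_⟩
  · obtain ⟨h1, h2⟩ := Finset.mem_sdiff.1 hH
    exact mem_eigenSpan (τ := (C₀, insert H J₀)) v n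
      ⟨hC₀, Finset.insert_subset h1 hJ₀, fun K hK hKB => Finset.mem_insert_of_mem (hst K hK hKB)⟩
  · rw [dW, Finset.sum_apply, Finset.sum_apply, Finset.sum_apply]
    simp only [Pi.smul_apply, smul_eq_mul]
    by_cases hC : C = C₀
    · subst hC
      refine Finset.sum_congr_of_eq_on_inter ?_ ?_ ?_
      · intro H hH hH2
        have hHJ₀ : H ∈ J₀ := by
          by_contra h
          exact hH2 (Finset.mem_sdiff.2 ⟨hJ hH, h⟩)
        have : J.erase H ≠ J₀ := fun e => Finset.notMem_erase H J (by rw [e]; exact hHJ₀)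
        rw [eigenForm_of_ne_right v n _ _ this, partialDeriv_zero, mul_zero, add_zero, mul_zero]
      · intro H _ hHJ
        have : J ≠ insert H J₀ := fun e => hHJ (by rw [e]; exact Finset.mem_insert_self _ _)
        rw [eigenForm_of_ne_right v n _ _ this, mul_zero]
      · intro H hHJ hH
        obtain ⟨hHC, hHJ₀⟩ := Finset.mem_sdiff.1 hH
        by_cases e : J.erase H = J₀
        · have e' : J = insert H J₀ := by rw [← e, Finset.insert_erase hHJ]
          rw [← e', e, eigenForm_self, eigenForm_self]
          have h := partialDeriv_prod_add hHC (hasDerivAt_profile v n J₀) 1 (v H) hx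
          rw [Complex.ofReal_one, one_mul] at h
          rw [h]
          congr 2
          refine Finset.prod_congr rfl fun K _ => ?_
          -- A direction missing from the multi-index belongs to `B`; only there does `d/dt + v` map
          -- `bot` to `top`.
          have hnH : n H ≠ 0 := by
            rw [hn]
            by_contra h
            exact hHJ₀ (hst H hHC h)
          split_ifs with hK
          · have hKJ : K.1 ∈ J := by rw [hK]; exact hHJ
            rw [profileDeriv, if_neg hHJ₀, profile, if_neg hHJ₀, profile, if_pos hKJ, one_mul,
              deriv_bot_add hnH, hK]
          · rw [profile, profile, ← e]
            simp only [Finset.mem_erase, hK, ne_eq, not_false_eq_true, true_and]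
        · have e' : J ≠ insert H J₀ := fun h => e (by rw [h, Finset.erase_insert hHJ₀])
          rw [eigenForm_of_ne_right v n _ _ e, eigenForm_of_ne_right v n _ _ e', partialDeriv_zero,
            mul_zero, add_zero, mul_zero, mul_zero]
    · simp only [eigenForm_of_ne_left v n _ _ hC, partialDeriv_zero, mul_zero, add_zero,
        Finset.sum_const_zero]

theorem dWAdj_eigenForm {P : V} {B : X.Cube} (v : X.Hyperplane → ℝ) {n : X.Hyperplane → ℕ}
    (hn : ∀ K, n K ≠ 0 ↔ K ∈ Mid B) {τ : X.Cube × Finset X.Hyperplane} (hτ : τ ∈ eigenStates P B) :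
    ∃ g ∈ eigenSpan P B v n, EqOnCubes (dWAdj v (eigenForm v n τ.1 τ.2)) g := by
  obtain ⟨C₀, J₀⟩ := τ
  obtain ⟨hC₀, hJ₀, hst⟩ := hτ
  simp only at hC₀ hJ₀ hst
  -- The value `0` at frequency `0` records that the exponential is annihilated. It is also what
  -- keeps the added directions in the multi-index.
  let l : X.Hyperplane → ℝ := fun H => if n H = 0 then 0 else (n H * Real.pi) ^ 2 + v H ^ 2
  refine ⟨∑ H ∈ J₀, (sgn H (J₀.erase H) * l H) • eigenForm v n C₀ (J₀.erase H),
    Submodule.sum_mem _ fun H hH => ?_, fun C J hJ x hx => ?_⟩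
  · by_cases hnH : n H = 0
    · simp [l, hnH]
    · refine Submodule.smul_mem _ _ (mem_eigenSpan (τ := (C₀, J₀.erase H)) v n
        ⟨hC₀, (Finset.erase_subset _ _).trans hJ₀, fun K hK hKB =>
          Finset.mem_erase.2 ⟨fun e => hKB (by rw [e]; exact (hn H).1 hnH), hst K hK hKB⟩⟩)
  · rw [dWAdj, Finset.sum_apply, Finset.sum_apply, Finset.sum_apply]
    simp only [Pi.smul_apply, smul_eq_mul]
    by_cases hC : C = C₀
    · subst hC
      refine Finset.sum_congr_of_eq_on_inter ?_ ?_ ?_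
      · intro H _ hHJ₀
        have : insert H J ≠ J₀ := fun e => hHJ₀ (by rw [← e]; exact Finset.mem_insert_self _ _)
        rw [eigenForm_of_ne_right v n _ _ this, partialDeriv_zero, mul_zero, neg_zero, add_zero,
          mul_zero]
      · intro H hHJ₀ hH
        have hHJ : H ∈ J := by
          by_contra h
          exact hH (Finset.mem_sdiff.2 ⟨hJ₀ hHJ₀, h⟩)
        have : J ≠ J₀.erase H := fun e => Finset.notMem_erase H J₀ (by rw [← e]; exact hHJ)
        rw [eigenForm_of_ne_right v n _ _ this, mul_zero]
      · intro H hH hHJ₀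
        obtain ⟨hHC, hHJ⟩ := Finset.mem_sdiff.1 hH
        by_cases e : insert H J = J₀
        · have e' : J = J₀.erase H := by rw [← e, Finset.erase_insert hHJ]
          rw [← e', e, eigenForm_self, eigenForm_self]
          have h := partialDeriv_prod_add hHC (hasDerivAt_profile v n J₀) (-1) (v H) hx
          rw [Complex.ofReal_neg, Complex.ofReal_one, neg_one_mul] at h
          rw [h, mul_assoc, ← Complex.ofReal_mul]
          congr 2
          let H' : ↥(Mid C) := ⟨H, hHC⟩
          rw [← Finset.mul_prod_erase _ _ (Finset.mem_univ H'),
            ← Finset.mul_prod_erase _ (fun K : ↥(Mid C) => profile v n J K.1 (x K))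
              (Finset.mem_univ H'), ← mul_assoc, if_pos rfl]
          congr 1
          · rw [profileDeriv, if_pos hHJ₀, profile, if_pos hHJ₀, profile, if_neg hHJ, neg_one_mul,
              neg_topDeriv_add]
          · refine Finset.prod_congr rfl fun K hK => ?_
            have hKH : K.1 ≠ H := fun e => (Finset.mem_erase.1 hK).1 (Subtype.ext e)
            rw [if_neg hKH, profile, profile, ← e]
            simp only [Finset.mem_insert, hKH, false_or]
        · have e' : J ≠ J₀.erase H := fun h => e (by rw [h, Finset.insert_erase hHJ₀])
          rw [eigenForm_of_ne_right v n _ _ e, eigenForm_of_ne_right v n _ _ e', partialDeriv_zero,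
            mul_zero, neg_zero, add_zero, mul_zero, mul_zero]
    · simp only [eigenForm_of_ne_left v n _ _ hC, partialDeriv_zero, mul_zero, neg_zero, add_zero,
        Finset.sum_const_zero]

end CubicalComplex

/-! ### Eigenforms under passage between cubes. -/

namespace CubicalComplex

variable {V : Type*} {X : CubicalComplex V}

theorem EqOnCubes.add {b₁ b₂ g₁ g₂ : X.FormField} (h₁ : EqOnCubes b₁ g₁) (h₂ : EqOnCubes b₂ g₂) :
    EqOnCubes (b₁ + b₂) (g₁ + g₂) := fun C J hJ x hx => by
  simp only [Pi.add_apply, h₁ C J hJ x hx, h₂ C J hJ x hx]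

theorem EqOnCubes.smul {b g : X.FormField} (h : EqOnCubes b g) (a : ℂ) :
    EqOnCubes (a • b) (a • g) := fun C J hJ x hx => by
  simp only [Pi.smul_apply, h C J hJ x hx]

variable [LinearOrder X.Hyperplane]

/-- A step from a cube above `B` adds a hyperplane outside `B`, where the frequency is `0`. The
factor `e^{v(x-1)}` of `e_v` is `e^{-v}` times the profile `top v 0` required in that direction. -/
theorem raiseSum_eigenForm (hX : X.IsCAT0) (hb : X.BoundedGeometry) {P : V} {B : X.Cube}
    (c v : X.Hyperplane → ℝ) {n : X.Hyperplane → ℕ} (hn : ∀ K, n K ≠ 0 ↔ K ∈ Mid B)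
    {τ : X.Cube × Finset X.Hyperplane} (hτ : τ ∈ eigenStates P B) :
    ∃ g ∈ eigenSpan P B v n, EqOnCubes (raiseSum P {τ.1} c v (eigenForm v n τ.1 τ.2)) g := by
  classical
  obtain ⟨C₀, J₀⟩ := τ
  obtain ⟨hC₀, hJ₀, hst⟩ := hτ
  simp only at hC₀ hJ₀ hst
  refine ⟨∑ D ∈ (finite_above hX hb P B).toFinset, ∑ H ∈ Mid D, if Step P C₀ H D then
      (sgn H J₀ * (c H * Real.exp (-v H) : ℝ)) • eigenForm v n D (insert H J₀) else 0,
    Submodule.sum_mem _ fun D _ => Submodule.sum_mem _ fun H _ => ?_, fun D J hJ x hx => ?_⟩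
  · split_ifs with h
    · refine Submodule.smul_mem _ _ (mem_eigenSpan (τ := (D, insert H J₀)) v n
        ⟨Above.step hC₀ h, h.insert_subset hJ₀, fun K hK hKB => ?_⟩)
      rw [Finset.mem_insert]
      exact (h.mid_iff.1 hK).imp_right fun h' => hst K h' hKB
    · exact Submodule.zero_mem _
  · have e1 : (∑ D ∈ (finite_above hX hb P B).toFinset, ∑ H ∈ Mid D, if Step P C₀ H D then
        (sgn H J₀ * (c H * Real.exp (-v H) : ℝ)) • eigenForm v n D (insert H J₀) else 0) D J x =
        ∑ H ∈ Mid D, if Step P C₀ H D then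
          (sgn H J₀ * (c H * Real.exp (-v H) : ℝ)) * eigenForm v n D (insert H J₀) D J x else 0 := by
      simp only [Finset.sum_apply]
      rw [Finset.sum_eq_single D]
      · refine Finset.sum_congr rfl fun H _ => ?_
        split_ifs <;> rfl
      · intro D' _ hD'
        refine Finset.sum_eq_zero fun H _ => ?_
        split_ifs
        · simp only [Pi.smul_apply, eigenForm_of_ne_left v n _ _ hD'.symm, smul_zero]
        · rfl
      · intro hD
        refine Finset.sum_eq_zero fun H _ => ?_
        rw [if_neg fun h => hD ((finite_above hX hb P B).mem_toFinset.2 (Above.step hC₀ h))]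
        rfl
    rw [e1, raiseSum, Finset.sum_singleton]
    refine Finset.sum_congr rfl fun H hH => ?_
    by_cases h : Step P C₀ H D
    · have hHJ₀ : H ∉ J₀ := fun h' => h.notMem (hJ₀ h')
      rw [if_pos h]
      by_cases e : J = insert H J₀
      · subst e
        have hnH : n H = 0 := by
          by_contra h'
          exact h.notMem (Above.mid_subset hC₀ ((hn H).1 h'))
        rw [if_pos ⟨h, Finset.mem_insert_self _ _⟩, Finset.erase_insert hHJ₀, mul_assoc, pull,
          eigenForm_self, eigenForm_self]
        dsimp only
        rw [prod_mid_eq h.midInsert (profile v n (insert H J₀)) x]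
        have e2 : profile v n (insert H J₀) H (coord D H x) = Real.exp (v H * coord D H x) := by
          rw [profile, if_pos (Finset.mem_insert_self _ _), top, if_pos hnH]
        have e3 : ∏ K : ↥(Mid C₀), profile v n (insert H J₀) K.1 (transfer D C₀ 0 x K) =
            ∏ K : ↥(Mid C₀), profile v n J₀ K.1 (transfer D C₀ 0 x K) := by
          refine Finset.prod_congr rfl fun K _ => ?_
          have hKH : K.1 ≠ H := fun e => h.notMem (e ▸ K.2)
          rw [profile, profile]
          simp only [Finset.mem_insert, hKH, false_or]
        rw [e2, e3, show v H * (coord D H x - 1) = -v H + v H * coord D H x by ring, Real.exp_add]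
        push_cast
        ring
      · have e' : H ∈ J → J.erase H ≠ J₀ := fun h1 h2 => e (by rw [← h2, Finset.insert_erase h1])
        rw [eigenForm_of_ne_right v n _ _ e, mul_zero]
        split_ifs with h'
        · rw [eigenForm_of_ne_right v n _ _ (e' h'.2), pull, mul_zero, mul_zero]
        · rfl
    · rw [if_neg h, if_neg fun h' => h h'.1]

theorem push_eigenForm (c v : X.Hyperplane → ℝ) (n : X.Hyperplane → ℕ) {C D : X.Cube}
    {H : X.Hyperplane} (h : MidInsert C H D) (J : Finset X.Hyperplane) (x : Coord C) :
    push (c H) (v H) C D (eigenForm v n D (insert H J) D (insert H J)) x =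
      ((∫ t in (0 : ℝ)..1, c H * Real.exp (v H * (t - 1)) * top (v H) (n H) t : ℝ) : ℂ) *
        eigenForm v n C J C J x := by
  rw [push, eigenForm_self, eigenForm_self, ← intervalIntegral.integral_ofReal,
    ← intervalIntegral.integral_mul_const]
  refine intervalIntegral.integral_congr fun t _ => ?_
  have e1 : profile v n (insert H J) H (coord D H (transfer C D t x)) = top (v H) (n H) t := by
    rw [profile, if_pos (Finset.mem_insert_self _ _), coord_transfer h]
  have e3 : ∏ K : ↥(Mid C), profile v n (insert H J) K.1 (transfer D C 0 (transfer C D t x) K) =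
      ∏ K : ↥(Mid C), profile v n J K.1 (x K) := by
    rw [transfer_transfer h]
    refine Finset.prod_congr rfl fun K _ => ?_
    have hKH : K.1 ≠ H := fun e => h.notMem (e ▸ K.2)
    rw [profile, profile]
    simp only [Finset.mem_insert, hKH, false_or]
  simp only
  rw [prod_mid_eq h, e1, e3]
  push_cast
  ring

/-- In a direction of `B` the fibre integral vanishes. In any other direction the face of the step
is still above `B`, so the result stays in the span. -/
theorem lowerSum_eigenForm (hX : X.IsCAT0) (hb : X.BoundedGeometry) {P : V} {B : X.Cube}
    (c v : X.Hyperplane → ℝ) {n : X.Hyperplane → ℕ} (hn : ∀ K, n K ≠ 0 ↔ K ∈ Mid B)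
    {τ : X.Cube × Finset X.Hyperplane} (hτ : τ ∈ eigenStates P B) :
    ∃ g ∈ eigenSpan P B v n, EqOnCubes (lowerSum P {τ.1} c v (eigenForm v n τ.1 τ.2)) g := by
  classical
  obtain ⟨D₀, J₀⟩ := τ
  obtain ⟨hD₀, hJ₀, hst⟩ := hτ
  simp only at hD₀ hJ₀ hst
  let l : X.Hyperplane → ℝ := fun H =>
    ∫ t in (0 : ℝ)..1, c H * Real.exp (v H * (t - 1)) * top (v H) (n H) t
  have hl : ∀ H ∈ Mid B, l H = 0 := fun H hH => integral_exp_mul_top_eq_zero _ _ ((hn H).2 hH)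
  refine ⟨∑ C ∈ (finite_above hX hb P B).toFinset, ∑ H ∈ Mid D₀, if Step P C H D₀ ∧ H ∈ J₀ then
      (sgn H (J₀.erase H) * l H) • eigenForm v n C (J₀.erase H) else 0,
    Submodule.sum_mem _ fun C hC => Submodule.sum_mem _ fun H _ => ?_, fun C J hJ x hx => ?_⟩
  · split_ifs with h
    · by_cases hHB : H ∈ Mid B
      · rw [hl H hHB, Complex.ofReal_zero, mul_zero, zero_smul]
        exact Submodule.zero_mem _
      · refine Submodule.smul_mem _ _ (mem_eigenSpan (τ := (C, J₀.erase H)) v n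
          ⟨(finite_above hX hb P B).mem_toFinset.1 hC, h.1.erase_subset hJ₀, fun K hK hKB => ?_⟩)
        exact Finset.mem_erase.2 ⟨fun e => h.1.notMem (e ▸ hK), hst K (h.1.mid_iff.2 (Or.inr hK)) hKB⟩
    · exact Submodule.zero_mem _
  · have key : ∀ H, (if Step P C H D₀ then
        sgn H J * push (c H) (v H) C D₀ (eigenForm v n D₀ J₀ D₀ (insert H J)) x else 0) =
        if Step P C H D₀ ∧ H ∈ J₀ then
          (sgn H (J₀.erase H) * l H) * eigenForm v n C (J₀.erase H) C J x else 0 := by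
      intro H
      by_cases h : Step P C H D₀
      · have hHJ : H ∉ J := fun h' => h.notMem (hJ h')
        rw [if_pos h]
        by_cases e : insert H J = J₀
        · have hHJ₀ : H ∈ J₀ := by rw [← e]; exact Finset.mem_insert_self _ _
          have e' : J₀.erase H = J := by rw [← e, Finset.erase_insert hHJ]
          rw [if_pos ⟨h, hHJ₀⟩, e', ← e, push_eigenForm c v n h.midInsert]
          ring
        · rw [eigenForm_of_ne_right v n _ _ e]
          have e0 : push (c H) (v H) C D₀ (fun _ => 0) x = 0 := by simp [push]
          rw [e0, mul_zero]
          split_ifs with h'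
          · have e' : J ≠ J₀.erase H := fun h2 => e (by rw [h2, Finset.insert_erase h'.2])
            rw [eigenForm_of_ne_right v n _ _ e', mul_zero]
          · rfl
      · rw [if_neg h, if_neg fun h' => h h'.1]
    have e1 : (∑ C ∈ (finite_above hX hb P B).toFinset, ∑ H ∈ Mid D₀, if Step P C H D₀ ∧ H ∈ J₀ then
        (sgn H (J₀.erase H) * l H) • eigenForm v n C (J₀.erase H) else 0) C J x =
        ∑ H ∈ Mid D₀, if Step P C H D₀ ∧ H ∈ J₀ then
          (sgn H (J₀.erase H) * l H) * eigenForm v n C (J₀.erase H) C J x else 0 := by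
      simp only [Finset.sum_apply]
      rw [Finset.sum_eq_single C]
      · refine Finset.sum_congr rfl fun H _ => ?_
        split_ifs <;> rfl
      · intro C' _ hC'
        refine Finset.sum_eq_zero fun H _ => ?_
        split_ifs
        · simp only [Pi.smul_apply, eigenForm_of_ne_left v n _ _ hC'.symm, smul_zero]
        · rfl
      · intro hC
        refine Finset.sum_eq_zero fun H _ => ?_
        split_ifs with h
        · have hHB : H ∈ Mid B := by
            by_contra h'
            exact hC ((finite_above hX hb P B).mem_toFinset.2 (Above.step_down hX hD₀ h' h.1))
          rw [hl H hHB]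
          simp
        · rfl
    rw [e1, lowerSum, Finset.sum_singleton]
    exact Finset.sum_congr rfl fun H _ => key H

/-- The operator `𝒟` preserves the span of the eigenforms. -/
theorem curlyD_eigenForm (hX : X.IsCAT0) (hb : X.BoundedGeometry) {P : V} {B : X.Cube}
    (w : X.Hyperplane → ℝ) {n : X.Hyperplane → ℕ} (hn : ∀ K, n K ≠ 0 ↔ K ∈ Mid B)
    {τ : X.Cube × Finset X.Hyperplane} (hτ : τ ∈ eigenStates P B) {b : I → X.FormField}
    (hsm : IsSmoothFamily w b) (hsupp : ∀ s, SupportedOn {τ.1} (b s)) {s : I}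
    (hs : b s = eigenForm ((s : ℝ) • w) n τ.1 τ.2) :
    ∃ g ∈ eigenSpan P B ((s : ℝ) • w) n,
      ∀ C, ∀ J ⊆ Mid C, ∀ x ∈ unitCube C, curlyD P w b s C J x = g C J x := by
  obtain ⟨g₁, hg₁, h₁⟩ := dW_eigenForm ((s : ℝ) • w) hn hτ
  obtain ⟨g₂, hg₂, h₂⟩ := dWAdj_eigenForm ((s : ℝ) • w) hn hτ
  obtain ⟨g₃, hg₃, h₃⟩ := raiseSum_eigenForm hX hb w ((s : ℝ) • w) hn hτ
  obtain ⟨g₄, hg₄, h₄⟩ := lowerSum_eigenForm hX hb w ((s : ℝ) • w) hn hτ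
  refine ⟨((s : ℝ)⁻¹ : ℂ) • (g₁ + g₂) + g₃ + g₄, Submodule.add_mem _ (Submodule.add_mem _
    (Submodule.smul_mem _ _ (Submodule.add_mem _ hg₁ hg₂)) hg₃) hg₄, fun C J hJ x hx => ?_⟩
  rw [curlyD_eq hsm hsupp P s hJ hx, hs]
  exact ((((h₁.add h₂).smul _).add h₃).add h₄) C J hJ x hx

end CubicalComplex

/-! ### Eigenforms as values of families in the domain. -/

namespace CubicalComplex

variable {V : Type*} {X : CubicalComplex V}

/-- The derivatives in `x` alone are the total derivatives of `F` restricted along the inclusion of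
the second factor, so they depend jointly continuously on both variables. -/
theorem continuousOn_iteratedFDerivWithin_param {C : X.Cube} {F : ℝ × Coord C → ℂ}
    (hF : ContDiff ℝ ∞ F) (k : ℕ) :
    ContinuousOn (fun p : I × Coord C =>
      iteratedFDerivWithin ℝ k (fun x => F ((p.1 : ℝ), x)) (unitCube C) p.2)
      (Set.univ ×ˢ unitCube C) := by
  have hk : (k : WithTop ℕ∞) ≤ ∞ := by exact_mod_cast le_top
  let inr : Coord C →L[ℝ] ℝ × Coord C := ContinuousLinearMap.inr ℝ ℝ (Coord C)
  have h1 : ∀ (s : ℝ) (x : Coord C), iteratedFDeriv ℝ k (fun x => F (s, x)) x =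
      (iteratedFDeriv ℝ k F (s, x)).compContinuousLinearMap fun _ => inr := by
    intro s x
    have hG : ContDiff ℝ ∞ fun q => F ((s, 0) + q) := hF.comp (contDiff_const.add contDiff_id)
    have e1 : (fun x => F (s, x)) = (fun q => F ((s, 0) + q)) ∘ inr := by
      ext y; simp [inr]
    rw [e1, inr.iteratedFDeriv_comp_right hG x hk, iteratedFDeriv_comp_add_left]
    simp [inr]
  have h2 : Continuous fun p : I × Coord C =>
      (iteratedFDeriv ℝ k F ((p.1 : ℝ), p.2)).compContinuousLinearMap fun _ => inr := by
    refine (ContinuousMultilinearMap.compContinuousLinearMapL (F := ℂ)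
      fun _ : Fin k => inr).continuous.comp ?_
    exact (hF.continuous_iteratedFDeriv hk).comp (by fun_prop)
  refine h2.continuousOn.congr fun p hp => ?_
  have hs : ContDiff ℝ ∞ fun x => F ((p.1 : ℝ), x) := hF.comp (contDiff_const.prodMk contDiff_id)
  rw [iteratedFDerivWithin_eq_iteratedFDeriv (uniqueDiffOn_unitCube C)
    ((hs.of_le hk).contDiffAt) hp.2, h1]

variable [LinearOrder X.Hyperplane]

theorem IsSmoothFamily.of_form (w : X.Hyperplane → ℝ) {b : X.FormField} {C₀ : X.Cube}
    (hb : ∀ C, MemOmegaZero C b) (hs : SupportedOn {C₀} b) {χ : C(I, ℂ)} {δ : ℝ} (hδ : 0 < δ)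
    (hχ : ∀ s : I, (s : ℝ) < δ → χ s = 0) : IsSmoothFamily w (smulFamily χ fun _ => b) where
  memOmegaZero s C :=
    ⟨fun J hJ => contDiffOn_const.mul ((hb C).smooth J hJ),
      fun J hJ H hH x hx h => by
        rw [smulFamily, (hb C).pullback_eq_zero J hJ H hH x hx h, mul_zero]⟩
  continuous C J hJ k s₀ := by
    refine tendstoUniformlyOn_of_continuousOn
      (F := fun s => iteratedFDerivWithin ℝ k (smulFamily χ (fun _ => b) s C J) (unitCube C))
      (isCompact_unitCube C) ?_ s₀
    have hc : ContinuousOn (fun p : I × Coord C => iteratedFDerivWithin ℝ k (b C J) (unitCube C) p.2)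
        (Set.univ ×ˢ unitCube C) := by
      refine ContinuousOn.comp (((hb C).smooth J hJ).continuousOn_iteratedFDerivWithin (m := k)
        (by exact_mod_cast le_top) (uniqueDiffOn_unitCube C)) continuousOn_snd fun p hp => hp.2
    refine (((χ.continuous.comp continuous_fst).continuousOn).smul hc).congr fun p hp => ?_
    exact iteratedFDerivWithin_const_smul_apply (a := χ p.1)
      ((((hb C).smooth J hJ).of_le (by exact_mod_cast le_top)) p.2 hp.2)
      (uniqueDiffOn_unitCube C) hp.2
  memA C := ⟨δ, hδ, fun s hs' => ⟨0, fun J hJ x hx => by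
    rw [smulFamily, hχ s hs']; simp⟩⟩
  finite_support := by
    refine (Set.finite_singleton C₀).subset ?_
    rintro C ⟨s, J, hJ, x, hx, h⟩
    by_contra hC
    refine h ?_
    rw [smulFamily, hs C (by simpa using hC) J hJ x hx, mul_zero]

theorem exists_smoothFamily_of_form (w : X.Hyperplane → ℝ) {b : X.FormField} {C₀ : X.Cube}
    (hb : ∀ C, MemOmegaZero C b) (hs : SupportedOn {C₀} b) {s₀ : I} (h0 : s₀ ≠ 0) :
    ∃ f : I → X.FormField, IsSmoothFamily w f ∧ (∀ s, SupportedOn {C₀} (f s)) ∧ f s₀ = b := by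
  have hpos : (0 : ℝ) < s₀ := unitInterval.pos_iff_ne_zero.2 h0
  -- A continuous cutoff that is zero for `s ≤ s₀ / 2` and one at `s₀`. It makes the condition near
  -- `s = 0` trivially true.
  let χ : C(I, ℂ) := ⟨fun s => ((max 0 ((2 * s - s₀) / s₀) : ℝ) : ℂ), by fun_prop⟩
  refine ⟨smulFamily χ fun _ => b, IsSmoothFamily.of_form w hb hs (half_pos hpos) fun s h => ?_,
    fun s C hC J hJ x hx => ?_, ?_⟩
  · change ((max 0 ((2 * s - s₀) / s₀) : ℝ) : ℂ) = 0
    rw [Complex.ofReal_eq_zero]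
    refine max_eq_left (div_nonpos_of_nonpos_of_nonneg ?_ hpos.le)
    linarith
  · rw [smulFamily, hs C hC J hJ x hx, mul_zero]
  · ext C J x
    change ((max 0 ((2 * s₀ - s₀) / s₀) : ℝ) : ℂ) * b C J x = b C J x
    rw [show (2 * (s₀ : ℝ) - s₀) / s₀ = 1 by field_simp; ring]
    simp

/-- At frequency zero and in top degree the eigenform is the generator `e^{s w_C}` of `A_s(C)` for
every `s`, so no cutoff is needed and the value at `s = 0` is also reached. -/
theorem IsSmoothFamily.eigenForm_zero (w : X.Hyperplane → ℝ) (C₀ : X.Cube) :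
    IsSmoothFamily w fun s : I => eigenForm ((s : ℝ) • w) 0 C₀ (Mid C₀) where
  memOmegaZero s C := memOmegaZero_eigenForm _ _ _ _ C
  continuous C J hJ k s₀ := by
    refine tendstoUniformlyOn_of_continuousOn
      (F := fun s : I => iteratedFDerivWithin ℝ k (eigenForm ((s : ℝ) • w) 0 C₀ (Mid C₀) C J)
        (unitCube C)) (isCompact_unitCube C) ?_ s₀
    let F : ℝ × Coord C → ℂ := fun p => eigenForm (p.1 • w) 0 C₀ (Mid C₀) C J p.2
    have hF : ContDiff ℝ ∞ F := by
      by_cases h : C = C₀ ∧ J = Mid C₀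
      · obtain ⟨rfl, rfl⟩ := h
        have e : F = fun p => ((∏ K : ↥(Mid C), Real.exp (p.1 * w K.1 * p.2 K) : ℝ) : ℂ) := by
          ext p
          simp only [F]
          rw [eigenForm_self]
          exact congrArg Complex.ofReal (Finset.prod_congr rfl fun K _ => by simp [profile, top])
        rw [e]
        refine Complex.ofRealCLM.contDiff.comp (contDiff_prod fun K _ => ?_)
        fun_prop
      · have e : F = fun _ => 0 := by
          ext p
          simp only [F]
          rw [eigenForm, if_neg h]
        rw [e]
        exact contDiff_const
    exact continuousOn_iteratedFDerivWithin_param hF k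
  memA C := by
    classical
    refine ⟨1, one_pos, fun s _ => ⟨if C = C₀ then 1 else 0, fun J hJ x hx => ?_⟩⟩
    by_cases hC : C = C₀
    · subst hC
      by_cases hJM : J = Mid C
      · subst hJM
        rw [eigenForm_self, if_pos rfl, if_pos rfl, one_mul, Finset.mul_sum, Real.exp_sum]
        exact congrArg Complex.ofReal
          (Finset.prod_congr rfl fun K _ => by simp [profile, top, mul_assoc])
      · rw [eigenForm_of_ne_right _ _ _ _ hJM, if_neg hJM]
    · rw [eigenForm_of_ne_left _ _ _ _ hC, if_neg hC, zero_mul]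
      simp
  finite_support := by
    refine (Set.finite_singleton C₀).subset ?_
    rintro C ⟨s, J, hJ, x, hx, h⟩
    by_contra hC
    exact h (supportedOn_eigenForm _ _ _ _ C (by simpa using hC) J hJ x hx)

theorem exists_smoothFamily_eigenForm (w : X.Hyperplane → ℝ) (s : I) {n : X.Hyperplane → ℕ}
    {C : X.Cube} {J : Finset X.Hyperplane} (h : s ≠ 0 ∨ (n = 0 ∧ J = Mid C)) :
    ∃ b : I → X.FormField, IsSmoothFamily w b ∧ (∀ t, SupportedOn {C} (b t)) ∧
      b s = eigenForm ((s : ℝ) • w) n C J := by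
  by_cases hs : s = 0
  · obtain ⟨rfl, rfl⟩ := h.resolve_left (not_not.2 hs)
    exact ⟨_, IsSmoothFamily.eigenForm_zero w C, fun t => supportedOn_eigenForm _ _ _ _, rfl⟩
  · exact exists_smoothFamily_of_form w (memOmegaZero_eigenForm _ _ _ _)
      (supportedOn_eigenForm _ _ _ _) hs

/-- The eigenforms that belong to the fibre of `ℋ_0(X)` at `s`. -/
structure IsEigenIndex (s : I) (n : X.Hyperplane → ℕ) (C : X.Cube) (J : Finset X.Hyperplane) :
    Prop where
  subset : J ⊆ Mid C
  mem_mid : ∀ K, n K ≠ 0 → K ∈ Mid C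
  mem_of_eq_zero : ∀ K ∈ Mid C, n K = 0 → K ∈ J
  ne_zero_or : s ≠ 0 ∨ n = 0

theorem IsEigenIndex.mem_fibre_curlyDSubmodule {w : X.Hyperplane → ℝ} {s : I}
    {n : X.Hyperplane → ℕ} {C : X.Cube} {J : Finset X.Hyperplane} (h : IsEigenIndex s n C J)
    {ξ : X.OmegaL2} (hξ : RepresentsAt (eigenForm ((s : ℝ) • w) n C J) ξ) :
    ξ ∈ X.fibred.fibre (X.curlyDSubmodule w) s := by
  obtain ⟨b, hb, _, hbs⟩ := exists_smoothFamily_eigenForm w s (n := n) (C := C) (J := J)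
    (h.ne_zero_or.imp_right fun h0 => ⟨h0, h.subset.antisymm fun K hK =>
      h.mem_of_eq_zero K hK (by rw [h0]; rfl)⟩)
  exact CubicalComplex.mem_fibre_curlyDSubmodule hb s (hbs ▸ hξ)

theorem IsEigenIndex.mem_fibre_shiftedRange (hX : X.IsCAT0) (hbg : X.BoundedGeometry) {P : V}
    {w : X.Hyperplane → ℝ} {T : X.HilbertModule →ₗ.[C(I, ℂ)] X.HilbertModule} (hT : IsCurlyD P w T)
    {s : I} {n : X.Hyperplane → ℕ} {C : X.Cube} {J : Finset X.Hyperplane} (h : IsEigenIndex s n C J)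
    {a : ℂ} (ha : a = Complex.I ∨ a = -Complex.I) {ξ : X.OmegaL2}
    (hξ : RepresentsAt (eigenForm ((s : ℝ) • w) n C J) ξ) :
    ξ ∈ X.fibred.fibre (FibredModule.shiftedRange T a) s := by
  classical
  -- The cube `B` is cut by exactly the hyperplanes of nonzero frequency, so the whole block of
  -- states is determined by the given eigenform.
  obtain ⟨B, hB, hBS⟩ := exists_above hX P (Finset.filter_subset (fun K => n K ≠ 0) (Mid C))
  have hn : ∀ K, n K ≠ 0 ↔ K ∈ Mid B := fun K => by
    rw [hBS, Finset.mem_filter]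
    exact ⟨fun hK => ⟨h.mem_mid K hK, hK⟩, fun hK => hK.2⟩
  have hτ : (C, J) ∈ eigenStates P B := ⟨hB, h.subset, fun K hK hKB =>
    h.mem_of_eq_zero K hK (by by_contra h'; exact hKB ((hn K).1 h'))⟩
  have hex : ∀ τ : eigenStates P B, ∃ b : I → X.FormField, IsSmoothFamily w b ∧
      (∀ t, SupportedOn {τ.1.1} (b t)) ∧ b s = eigenForm ((s : ℝ) • w) n τ.1.1 τ.1.2 := by
    intro τ
    refine exists_smoothFamily_eigenForm w s (h.ne_zero_or.imp_right fun h0 => ⟨h0, ?_⟩)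
    -- At `s = 0` all frequencies vanish, so `B` is cut by no hyperplane and every state of the
    -- block is of top degree, as the existence of a family requires.
    refine τ.2.2.1.antisymm fun K hK => τ.2.2.2 K hK fun hKB => ?_
    exact (hn K).2 hKB (by rw [h0]; rfl)
  choose b hb hbs hbe using hex
  have : Finite (eigenStates P B) := finite_eigenStates hX hbg P B
  have hspan : Set.range (fun τ : eigenStates P B => b τ s) =
      Set.range fun τ : eigenStates P B => eigenForm ((s : ℝ) • w) n τ.1.1 τ.1.2 :=
    congrArg Set.range (funext hbe)
  refine hT.mem_fibre_shiftedRange hX hb s (fun τ => ?_) ha ⟨(C, J), hτ⟩ ?_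
  · rw [hspan]
    exact curlyD_eigenForm hX hbg w hn τ.2 (hb τ) (hbs τ) (hbe τ)
  · rw [hbe]; exact hξ

end CubicalComplex

/-! ### Totality of the profiles in one variable. -/

namespace CubicalComplex

/-- A real function as an element of `C([0,1], ℂ)`. -/
noncomputable def ofRealFun (g : ℝ → ℝ) (hg : Continuous g) : C(I, ℂ) :=
  ⟨fun t => ((g t : ℝ) : ℂ), by fun_prop⟩

/-- The functions `cos (k π t)` on the unit interval. -/
noncomputable def cosFun (k : ℕ) : C(I, ℂ) :=
  ofRealFun (fun t => Real.cos (k * Real.pi * t)) (by fun_prop)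

theorem cosFun_zero : cosFun 0 = 1 := by
  ext t; simp [cosFun, ofRealFun]

theorem cosFun_mul_cosFun (k l : ℕ) : ∃ m : ℕ,
    cosFun k * cosFun l = (2⁻¹ : ℂ) • cosFun (k + l) + (2⁻¹ : ℂ) • cosFun m := by
  wlog h : l ≤ k generalizing k l
  · obtain ⟨m, hm⟩ := this l k (le_of_not_ge h)
    exact ⟨m, by rw [mul_comm, hm, add_comm l k]⟩
  refine ⟨k - l, ?_⟩
  ext t
  have h1 : Real.cos (k * Real.pi * t) * Real.cos (l * Real.pi * t) =
      2⁻¹ * Real.cos (((k + l : ℕ) : ℝ) * Real.pi * t) +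
        2⁻¹ * Real.cos (((k - l : ℕ) : ℝ) * Real.pi * t) := by
    rw [Nat.cast_sub h, Nat.cast_add, add_mul, add_mul, sub_mul, sub_mul, Real.cos_add,
      Real.cos_sub]
    ring
  change ((Real.cos (k * Real.pi * t) : ℝ) : ℂ) * ((Real.cos (l * Real.pi * t) : ℝ) : ℂ) =
    2⁻¹ * ((Real.cos (((k + l : ℕ) : ℝ) * Real.pi * t) : ℝ) : ℂ) +
      2⁻¹ * ((Real.cos (((k - l : ℕ) : ℝ) * Real.pi * t) : ℝ) : ℂ)
  rw [← Complex.ofReal_mul, h1, Complex.ofReal_add, Complex.ofReal_mul, Complex.ofReal_mul,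
    Complex.ofReal_inv, Complex.ofReal_ofNat]

/-- A subspace of `C(Y, ℂ)` spanned by a set that contains `1`, is closed under multiplication and
conjugation and separates the points is dense. -/
theorem closure_span_eq_top {Y : Type*} [TopologicalSpace Y] [CompactSpace Y] {S : Set C(Y, ℂ)}
    (h1 : (1 : C(Y, ℂ)) ∈ Submodule.span ℂ S)
    (hmul : ∀ f ∈ S, ∀ g ∈ S, f * g ∈ Submodule.span ℂ S)
    (hstar : ∀ f ∈ S, star f ∈ S) (hsep : ∀ x y, x ≠ y → ∃ f ∈ S, f x ≠ f y) :
    (Submodule.span ℂ S).topologicalClosure = ⊤ := by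
  have hm : Submodule.span ℂ S * Submodule.span ℂ S ≤ Submodule.span ℂ S := by
    rw [Submodule.span_mul_span, Submodule.span_le]
    rintro _ ⟨f, hf, g, hg, rfl⟩
    exact hmul f hf g hg
  let A : StarSubalgebra ℂ C(Y, ℂ) :=
    { Submodule.toSubalgebra (Submodule.span ℂ S) h1 fun x y hx hy =>
        hm (Submodule.mul_mem_mul hx hy) with
      star_mem' := by
        intro x hx
        change x ∈ Submodule.span ℂ S at hx
        change star x ∈ Submodule.span ℂ S
        induction hx using Submodule.span_induction with
        | mem x hx => exact Submodule.subset_span (hstar x hx)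
        | zero => rw [star_zero]; exact Submodule.zero_mem _
        | add x y _ _ hx hy => rw [star_add]; exact Submodule.add_mem _ hx hy
        | smul a x _ hx => rw [star_smul]; exact Submodule.smul_mem _ _ hx }
  have hA : A.topologicalClosure = ⊤ := by
    refine ContinuousMap.starSubalgebra_topologicalClosure_eq_top_of_separatesPoints A ?_
    intro x y hxy
    obtain ⟨f, hf, hfx⟩ := hsep x y hxy
    exact ⟨f, ⟨f, Submodule.subset_span hf, rfl⟩, hfx⟩
  refine eq_top_iff.2 fun f _ => ?_
  have hf : f ∈ A.topologicalClosure := by rw [hA]; trivial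
  exact hf

theorem closure_span_cosFun : (Submodule.span ℂ (Set.range cosFun)).topologicalClosure = ⊤ := by
  refine closure_span_eq_top (cosFun_zero ▸ Submodule.subset_span ⟨0, rfl⟩) ?_ ?_ ?_
  · rintro _ ⟨k, rfl⟩ _ ⟨l, rfl⟩
    obtain ⟨m, hm⟩ := cosFun_mul_cosFun k l
    rw [hm]
    exact Submodule.add_mem _ (Submodule.smul_mem _ _ (Submodule.subset_span ⟨_, rfl⟩))
      (Submodule.smul_mem _ _ (Submodule.subset_span ⟨_, rfl⟩))
  · rintro _ ⟨k, rfl⟩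
    refine ⟨k, ?_⟩
    ext t
    exact (Complex.conj_ofReal _).symm
  · intro x y hxy
    refine ⟨_, ⟨1, rfl⟩, fun h => hxy ?_⟩
    have h' : Real.cos ((1 : ℕ) * Real.pi * x) = Real.cos ((1 : ℕ) * Real.pi * y) :=
      Complex.ofReal_injective h
    have hmem : ∀ z : I, ((1 : ℕ) : ℝ) * Real.pi * z ∈ Set.Icc 0 Real.pi := fun z =>
      ⟨by have := z.2.1; positivity, by
        have := mul_le_mul_of_nonneg_left z.2.2 Real.pi_pos.le
        simpa using this⟩
    have h2 := Real.injOn_cos (hmem x) (hmem y) h'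
    have h3 : Real.pi * (x : ℝ) = Real.pi * y := by simpa using h2
    exact Subtype.ext (mul_left_cancel₀ Real.pi_ne_zero h3)

/-- A continuous linear map that sends all `cos (k π t)` into a closed subspace has its range in
that subspace. -/
theorem mem_of_forall_cosFun {F : Type*} [AddCommGroup F] [Module ℂ F] [TopologicalSpace F]
    (L : C(I, ℂ) →L[ℂ] F) {M : Submodule ℂ F} (hM : IsClosed (M : Set F))
    (h : ∀ k, L (cosFun k) ∈ M) (g : C(I, ℂ)) : L g ∈ M := by
  have h1 : Submodule.span ℂ (Set.range cosFun) ≤ M.comap (L : C(I, ℂ) →ₗ[ℂ] F) := by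
    rw [Submodule.span_le]
    rintro _ ⟨k, rfl⟩
    exact h k
  have h2 := Submodule.topologicalClosure_minimal _ h1 (hM.preimage L.continuous)
  rw [closure_span_cosFun] at h2
  exact h2 (Submodule.mem_top (x := g))

/-- The functions `bot n`, for `n > 0`. -/
def botSet : Set C(I, ℂ) := {u | ∃ n : ℕ, n ≠ 0 ∧ ∀ t : I, u t = ((bot n t : ℝ) : ℂ)}

/-- The functions `top v n`. -/
def topSet (v : ℝ) : Set C(I, ℂ) := {u | ∃ n : ℕ, ∀ t : I, u t = ((top v n t : ℝ) : ℂ)}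

/-- Sums of sines vanish at the ends, so they cannot approximate everything uniformly. But `sin(πt)
cos(kπt)` is a combination of sines and the cosines are total, so every continuous function times
`sin(πt)` is reached. -/
theorem sin_mul_mem_closure (g : C(I, ℂ)) :
    ofRealFun (bot 1) (contDiff_bot 1).continuous * g ∈
      (Submodule.span ℂ botSet).topologicalClosure := by
  have hb : ∀ n : ℕ, ofRealFun (bot n) (contDiff_bot n).continuous ∈ Submodule.span ℂ botSet := by
    intro n
    by_cases hn : n = 0
    · have : ofRealFun (bot n) (contDiff_bot n).continuous = 0 := by
        subst hn; ext t; simp [ofRealFun, bot]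
      rw [this]; exact Submodule.zero_mem _
    · exact Submodule.subset_span ⟨n, hn, fun t => rfl⟩
  refine mem_of_forall_cosFun (ContinuousLinearMap.mul ℂ C(I, ℂ)
    (ofRealFun (bot 1) (contDiff_bot 1).continuous)) (Submodule.isClosed_topologicalClosure _)
    (fun k => Submodule.le_topologicalClosure _ ?_) g
  rw [ContinuousLinearMap.mul_apply']
  obtain rfl | ⟨m, rfl⟩ : k = 0 ∨ ∃ m, k = m + 1 := by
    cases k
    · exact Or.inl rfl
    · exact Or.inr ⟨_, rfl⟩
  · rw [cosFun_zero, mul_one]; exact hb 1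
  · have e : ofRealFun (bot 1) (contDiff_bot 1).continuous * cosFun (m + 1) =
        (2⁻¹ : ℂ) • ofRealFun (bot (m + 2)) (contDiff_bot _).continuous -
          (2⁻¹ : ℂ) • ofRealFun (bot m) (contDiff_bot _).continuous := by
      ext t
      have h1 : bot 1 t * Real.cos (((m + 1 : ℕ) : ℝ) * Real.pi * t) =
          2⁻¹ * bot (m + 2) t - 2⁻¹ * bot m t := by
        have e1 : ((m + 2 : ℕ) : ℝ) * Real.pi * t =
            ((m + 1 : ℕ) : ℝ) * Real.pi * t + ((1 : ℕ) : ℝ) * Real.pi * t := by push_cast; ring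
        have e2 : (m : ℝ) * Real.pi * t =
            ((m + 1 : ℕ) : ℝ) * Real.pi * t - ((1 : ℕ) : ℝ) * Real.pi * t := by push_cast; ring
        unfold bot
        rw [e1, e2, Real.sin_add, Real.sin_sub]
        ring
      change ((bot 1 t : ℝ) : ℂ) * ((Real.cos (((m + 1 : ℕ) : ℝ) * Real.pi * t) : ℝ) : ℂ) =
        2⁻¹ * ((bot (m + 2) t : ℝ) : ℂ) - 2⁻¹ * ((bot m t : ℝ) : ℂ)
      rw [← Complex.ofReal_mul, h1, Complex.ofReal_sub, Complex.ofReal_mul, Complex.ofReal_mul,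
        Complex.ofReal_inv, Complex.ofReal_ofNat]
    rw [e]
    exact Submodule.sub_mem _ (Submodule.smul_mem _ _ (hb _)) (Submodule.smul_mem _ _ (hb _))

theorem continuous_IccExtend_coe (g : C(I, ℂ)) :
    Continuous (Set.IccExtend (zero_le_one (α := ℝ)) g) := g.continuous.Icc_extend'

/-- The primitive that vanishes at `0`. -/
noncomputable def primitive : C(I, ℂ) →L[ℂ] C(I, ℂ) :=
  LinearMap.mkContinuous
    { toFun := fun h => ⟨fun t => ∫ u in (0 : ℝ)..t, Set.IccExtend (zero_le_one (α := ℝ)) h u, by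
        have := intervalIntegral.continuous_primitive
          (fun a b => (continuous_IccExtend_coe h).intervalIntegrable (μ := volume) a b) 0
        fun_prop⟩
      map_add' := fun g h => by
        ext t
        exact intervalIntegral.integral_add
          ((continuous_IccExtend_coe g).intervalIntegrable _ _)
          ((continuous_IccExtend_coe h).intervalIntegrable _ _)
      map_smul' := fun a h => by
        ext t
        exact intervalIntegral.integral_smul a _ } 1 fun h => by
    rw [one_mul]
    refine (ContinuousMap.norm_le _ (norm_nonneg _)).2 fun t => ?_
    refine (intervalIntegral.norm_integral_le_of_norm_le_const
      (C := ‖h‖) fun u _ => h.norm_coe_le_norm _).trans ?_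
    rw [sub_zero, abs_of_nonneg t.2.1]
    exact mul_le_of_le_one_right (norm_nonneg _) t.2.2

theorem primitive_apply (h : C(I, ℂ)) (t : I) :
    primitive h t = ∫ u in (0 : ℝ)..t, Set.IccExtend (zero_le_one (α := ℝ)) h u := rfl

theorem primitive_eq_of_hasDerivAt {h : C(I, ℂ)} {G : ℝ → ℂ} {g : ℝ → ℂ}
    (hG : ∀ t, HasDerivAt G (g t) t) (hg : Continuous g) (hgh : ∀ t : I, h t = g t) (t : I) :
    primitive h t = G t - G 0 := by
  rw [primitive_apply, ← intervalIntegral.integral_eq_sub_of_hasDerivAt (fun t _ => hG t)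
    (hg.intervalIntegrable _ _)]
  refine intervalIntegral.integral_congr fun u hu => ?_
  rw [Set.uIcc_of_le t.2.1] at hu
  have hu' : u ∈ Set.Icc (0 : ℝ) 1 := ⟨hu.1, hu.2.trans t.2.2⟩
  rw [Set.IccExtend_of_mem _ _ hu']
  exact hgh ⟨u, hu'⟩

/-- Variation of constants: the primitive `G` of `h` solves `G' + vG = g` with `G(0) = 0`. The
second part gives the integral of `h`, needed to detect a function of nonzero mean. -/
theorem exists_add_smul_primitive_eq (v : ℝ) (g : C(I, ℂ)) : ∃ h : C(I, ℂ),
    h + (v : ℂ) • primitive h = g ∧ primitive h 1 = (Real.exp (-v) : ℂ) *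
      ∫ u in (0 : ℝ)..1, (Real.exp (v * u) : ℂ) * Set.IccExtend (zero_le_one (α := ℝ)) g u := by
  set g' := Set.IccExtend (zero_le_one (α := ℝ)) g with hg'
  have hc : Continuous g' := continuous_IccExtend_coe g
  let G : ℝ → ℂ := fun t => (Real.exp (-v * t) : ℂ) * ∫ u in (0 : ℝ)..t, (Real.exp (v * u) : ℂ) * g' u
  have hG : ∀ t, HasDerivAt G (g' t - v * G t) t := by
    intro t
    have hi : Continuous fun u : ℝ => (Real.exp (v * u) : ℂ) * g' u := by fun_prop
    have h1 := intervalIntegral.integral_hasDerivAt_right (hi.intervalIntegrable 0 t)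
      (hi.stronglyMeasurableAtFilter _ _) hi.continuousAt
    have h2 := (((hasDerivAt_id' t).const_mul (-v)).exp).ofReal_comp
    refine (h2.mul h1).congr_deriv ?_
    have h3 : (Real.exp (-v * t) : ℂ) * (Real.exp (v * t) : ℂ) = 1 := by
      rw [← Complex.ofReal_mul, ← Real.exp_add]; simp
    simp only [G]
    push_cast at h3 ⊢
    linear_combination g' t * h3
  have hGc : Continuous G := continuous_iff_continuousAt.2 fun t => (hG t).continuousAt
  have hG0 : G 0 = 0 := by simp [G]
  let h : C(I, ℂ) := ⟨fun t => g t - v * G t, by fun_prop⟩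
  have hh : ∀ t : I, primitive h t = G t := fun t => by
    rw [primitive_eq_of_hasDerivAt hG (by fun_prop) (fun t => ?_) t, hG0, sub_zero]
    change g t - v * G t = g' t - v * G t
    rw [hg', Set.IccExtend_val]
  refine ⟨h, ?_, ?_⟩
  · ext t
    change (g t - v * G t) + v * primitive h t = g t
    rw [hh]; ring
  · rw [hh]
    simp [G]

theorem cosFun_add_smul_primitive (v : ℝ) {k : ℕ} (hk : k ≠ 0) :
    ((k * Real.pi : ℝ) : ℂ) • (cosFun k + (v : ℂ) • primitive (cosFun k)) =
      ofRealFun (top v k) (contDiff_top v k).continuous ∧ primitive (cosFun k) 1 = 0 := by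
  have hkp : (k : ℝ) * Real.pi ≠ 0 := mul_ne_zero (Nat.cast_ne_zero.2 hk) Real.pi_ne_zero
  have h : ∀ t : I, primitive (cosFun k) t = ((bot k t / (k * Real.pi) : ℝ) : ℂ) := by
    intro t
    rw [primitive_eq_of_hasDerivAt (G := fun t => ((bot k t / (k * Real.pi) : ℝ) : ℂ))
      (g := fun t => ((Real.cos (k * Real.pi * t) : ℝ) : ℂ)) (fun t => ?_) (by fun_prop)
      (fun t => rfl) t, bot_zero_right]
    · simp
    · exact (((hasDerivAt_bot k t).div_const (k * Real.pi)).congr_deriv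
        (by field_simp)).ofReal_comp
  refine ⟨?_, ?_⟩
  · ext t
    change ((k * Real.pi : ℝ) : ℂ) * (((Real.cos (k * Real.pi * t) : ℝ) : ℂ) +
      v * primitive (cosFun k) t) = ((top v k t : ℝ) : ℂ)
    rw [h, ← deriv_bot_add hk]
    have : k * Real.pi * (Real.cos (k * Real.pi * t) + v * (bot k t / (k * Real.pi))) =
      k * Real.pi * Real.cos (k * Real.pi * t) + v * bot k t := by field_simp
    exact_mod_cast this
  · rw [h]
    simp [bot_one_right]

/-- Up to the factor `kπ`, `top v k` is the image of `cos(kπt)` under `R = 1 + v∫`, which is onto.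
The cosines with `k ≥ 1` give the images of all functions of mean zero. The missing dimension comes
from `e^{vt} = R e`, because `e` has positive mean. -/
theorem closure_span_topSet (v : ℝ) : (Submodule.span ℂ (topSet v)).topologicalClosure = ⊤ := by
  set M := (Submodule.span ℂ (topSet v)).topologicalClosure with hM
  have htop : ∀ n, ofRealFun (top v n) (contDiff_top v n).continuous ∈ M := fun n =>
    Submodule.le_topologicalClosure _ (Submodule.subset_span ⟨n, fun t => rfl⟩)
  let R : C(I, ℂ) →L[ℂ] C(I, ℂ) := ContinuousLinearMap.id ℂ _ + (v : ℂ) • primitive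
  let ev1 : C(I, ℂ) →L[ℂ] ℂ := ContinuousMap.evalCLM ℂ 1
  let P : C(I, ℂ) →L[ℂ] C(I, ℂ) :=
    ContinuousLinearMap.id ℂ _ - (ev1.comp primitive).smulRight (1 : C(I, ℂ))
  have hR : ∀ h, R h = h + (v : ℂ) • primitive h := fun h => rfl
  have hP : ∀ h, P h = h - primitive h 1 • (1 : C(I, ℂ)) := fun h => rfl
  have h0 : (0 : ℂ) • (1 : C(I, ℂ)) = 0 := by ext t; exact zero_mul _
  have h1 : ∀ h, R (P h) ∈ M := by
    refine mem_of_forall_cosFun (R.comp P) (Submodule.isClosed_topologicalClosure _) fun k => ?_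
    change R (P (cosFun k)) ∈ M
    by_cases hk : k = 0
    · have e : P (cosFun k) = 0 := by
        subst hk
        rw [hP, cosFun_zero]
        have : primitive (1 : C(I, ℂ)) 1 = 1 := by
          rw [primitive_eq_of_hasDerivAt (G := fun t : ℝ => (t : ℂ)) (g := fun _ => 1)
            (fun t => (hasDerivAt_id' t).ofReal_comp.congr_deriv (by simp)) continuous_const
            (fun t => rfl)]
          simp
        rw [this, one_smul, sub_self]
      rw [e, map_zero]; exact Submodule.zero_mem _
    · obtain ⟨h2, h3⟩ := cosFun_add_smul_primitive v hk
      have hkp : ((k * Real.pi : ℝ) : ℂ) ≠ 0 :=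
        Complex.ofReal_ne_zero.2 (mul_ne_zero (Nat.cast_ne_zero.2 hk) Real.pi_ne_zero)
      rw [hP, h3, h0, sub_zero]
      refine (Submodule.smul_mem_iff _ hkp).1 ?_
      rw [hR, h2]
      exact htop k
  have h2 : ∀ h, primitive h 1 = 0 → R h ∈ M := fun h hh => by
    have := h1 h
    rwa [hP, hh, h0, sub_zero] at this
  refine eq_top_iff.2 fun g _ => ?_
  obtain ⟨h, hh, -⟩ := exists_add_smul_primitive_eq v g
  have htop0 : ofRealFun (top v 0) (contDiff_top v 0).continuous =
      ofRealFun (fun t => Real.exp (v * t)) (by fun_prop) := by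
    ext t; simp [ofRealFun, top]
  have hE := htop 0
  rw [htop0] at hE
  obtain ⟨e, he, he1⟩ := exists_add_smul_primitive_eq v
    (ofRealFun (fun t => Real.exp (v * t)) (by fun_prop))
  have hne : primitive e 1 ≠ 0 := by
    rw [he1]
    have hc : Continuous fun u : ℝ => Real.exp (v * u) * Real.exp (v * u) := by fun_prop
    have e1 : ∫ u in (0 : ℝ)..1, (Real.exp (v * u) : ℂ) * Set.IccExtend (zero_le_one (α := ℝ))
        (ofRealFun (fun t => Real.exp (v * t)) (by fun_prop)) u =
        ((∫ u in (0 : ℝ)..1, Real.exp (v * u) * Real.exp (v * u) : ℝ) : ℂ) := by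
      rw [← intervalIntegral.integral_ofReal]
      refine intervalIntegral.integral_congr fun u hu => ?_
      rw [Set.uIcc_of_le zero_le_one] at hu
      rw [Set.IccExtend_of_mem _ _ hu, Complex.ofReal_mul]
      rfl
    rw [e1]
    refine mul_ne_zero (Complex.ofReal_ne_zero.2 (Real.exp_pos _).ne')
      (Complex.ofReal_ne_zero.2 (ne_of_gt ?_))
    exact intervalIntegral.intervalIntegral_pos_of_pos (hc.intervalIntegrable _ _)
      (fun u => by positivity) one_pos
  -- Subtracting this multiple of `e` gives mean zero, and its image under `R` is a multiple of the
  -- profile `top v 0`.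
  have h3 : R (h - (primitive h 1 / primitive e 1) • e) ∈ M := by
    refine h2 _ ?_
    rw [map_sub, map_smul]
    change primitive h 1 - primitive h 1 / primitive e 1 * primitive e 1 = 0
    rw [div_mul_cancel₀ _ hne, sub_self]
  rw [map_sub, map_smul, hR, hR, hh, he] at h3
  have h4 := Submodule.add_mem _ h3 (Submodule.smul_mem _ (primitive h 1 / primitive e 1) hE)
  rwa [sub_add_cancel] at h4

end CubicalComplex

/-! ### Products of profiles on a cube. -/

namespace CubicalComplex

section Products

variable {ι : Type*}

/-- The projection to the unit cube. -/
noncomputable def clamp (x : ι → ℝ) : ι → I := fun i => Set.projIcc 0 1 zero_le_one (x i)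

theorem continuous_clamp : Continuous (clamp : (ι → ℝ) → ι → I) := by
  unfold clamp
  exact continuous_pi fun i => continuous_projIcc.comp (continuous_apply i)

theorem coe_clamp {x : ι → ℝ} (hx : x ∈ Set.Icc (0 : ι → ℝ) 1) (i : ι) : (clamp x i : ℝ) = x i := by
  rw [clamp, Set.projIcc_of_mem zero_le_one ⟨hx.1 i, hx.2 i⟩]

variable [Fintype ι]

/-- The function `x ↦ ∏ i, u i (x i)` on the cube `[0,1]^ι`. -/
noncomputable def prodFun (u : ι → C(I, ℂ)) : C(ι → I, ℂ) := ⟨fun x => ∏ i, u i (x i), by fun_prop⟩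

theorem prodFun_apply (u : ι → C(I, ℂ)) (x : ι → I) : prodFun u x = ∏ i, u i (x i) := rfl

theorem prodFun_mul (u v : ι → C(I, ℂ)) : prodFun u * prodFun v = prodFun (u * v) := by
  ext x
  exact Finset.prod_mul_distrib.symm

theorem closure_span_prodFun :
    (Submodule.span ℂ (Set.range (prodFun : (ι → C(I, ℂ)) → C(ι → I, ℂ)))).topologicalClosure = ⊤ := by
  classical
  refine closure_span_eq_top (Submodule.subset_span ⟨1, ?_⟩) ?_ ?_ ?_
  · ext x; simp [prodFun_apply]
  · rintro _ ⟨u, rfl⟩ _ ⟨v, rfl⟩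
    exact Submodule.subset_span ⟨u * v, (prodFun_mul u v).symm⟩
  · rintro _ ⟨u, rfl⟩
    refine ⟨star u, ?_⟩
    ext x
    exact (map_prod (starRingEnd ℂ) _ _).symm
  · intro x y hxy
    obtain ⟨i, hi⟩ := Function.ne_iff.1 hxy
    refine ⟨_, ⟨Pi.mulSingle i (ofRealFun id continuous_id), rfl⟩, fun h => hi ?_⟩
    have e : ∀ z : ι → I, prodFun (Pi.mulSingle i (ofRealFun id continuous_id)) z = ((z i : ℝ) : ℂ) := by
      intro z
      rw [prodFun_apply, Finset.prod_eq_single i]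
      · rw [Pi.mulSingle_eq_same]; rfl
      · intro j _ hj
        rw [Pi.mulSingle_eq_of_ne hj]; rfl
      · simp
    rw [e, e] at h
    exact Subtype.ext (Complex.ofReal_injective h)

/-- A closed subspace that contains the products of functions from the sets `Φ i` contains the
products of functions from their closed spans. -/
theorem prodFun_mem_of_mem_closure {M : Submodule ℂ C(ι → I, ℂ)}
    (hM : IsClosed (M : Set C(ι → I, ℂ))) {Φ : ι → Set C(I, ℂ)}
    (h : ∀ u : ι → C(I, ℂ), (∀ i, u i ∈ Φ i) → prodFun u ∈ M) (u : ι → C(I, ℂ))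
    (hu : ∀ i, u i ∈ (Submodule.span ℂ (Φ i)).topologicalClosure) : prodFun u ∈ M := by
  classical
  -- The factors are moved into the closed spans one coordinate at a time. With the others fixed,
  -- the product is linear and continuous in that factor.
  suffices key : ∀ s : Finset ι, ∀ u : ι → C(I, ℂ),
      (∀ i ∈ s, u i ∈ (Submodule.span ℂ (Φ i)).topologicalClosure) → (∀ i ∉ s, u i ∈ Φ i) →
        prodFun u ∈ M from
    key Finset.univ u (fun i _ => hu i) fun i hi => absurd (Finset.mem_univ i) hi
  intro s
  induction s using Finset.induction_on with
  | empty => exact fun u _ hu => h u fun i => hu i (Finset.notMem_empty i)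
  | insert a s ha ih =>
    intro u hu hu'
    let c : C(ι → I, ℂ) := ⟨fun x => ∏ i ∈ Finset.univ.erase a, u i (x i), by fun_prop⟩
    let e : C(ι → I, I) := ⟨fun x => x a, continuous_apply a⟩
    have hprod : ∀ g, prodFun (Function.update u a g) = c * g.comp e := by
      intro g
      ext x
      change ∏ i, Function.update u a g i (x i) = (∏ i ∈ Finset.univ.erase a, u i (x i)) * g (x a)
      rw [← Finset.prod_erase_mul _ _ (Finset.mem_univ a), Function.update_self]
      refine congrArg (· * g (x a)) (Finset.prod_congr rfl fun i hi => ?_)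
      rw [Function.update_of_ne (Finset.ne_of_mem_erase hi)]
    let L : C(I, ℂ) →L[ℂ] C(ι → I, ℂ) :=
      { toFun := fun g => c * g.comp e
        map_add' := fun g g' => by ext x; exact mul_add _ _ _
        map_smul' := fun r g => by ext x; exact mul_left_comm _ _ _
        cont := continuous_const.mul (ContinuousMap.continuous_precomp e) }
    have h1 : Submodule.span ℂ (Φ a) ≤ M.comap (L : C(I, ℂ) →ₗ[ℂ] C(ι → I, ℂ)) := by
      rw [Submodule.span_le]
      intro g hg
      change c * g.comp e ∈ M
      rw [← hprod]
      refine ih _ (fun i hi => ?_) fun i hi => ?_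
      · have : i ≠ a := fun h => ha (h ▸ hi)
        rw [Function.update_of_ne this]
        exact hu i (Finset.mem_insert_of_mem hi)
      · by_cases hia : i = a
        · subst hia; rwa [Function.update_self]
        · rw [Function.update_of_ne hia]
          exact hu' i (by simp [hia, hi])
    have h2 := Submodule.topologicalClosure_minimal _ h1 (hM.preimage L.continuous)
    have h3 : c * (u a).comp e ∈ M := h2 (hu a (Finset.mem_insert_self a s))
    rwa [← hprod, Function.update_eq_self] at h3

/-- The product of `sin (π x_i)` over the indices outside `s`. -/
noncomputable def sinProd (s : Set ι) [DecidablePred (· ∈ s)] (x : ι → ℝ) : ℝ :=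
  ∏ i, if i ∈ s then 1 else bot 1 (x i)

theorem ae_sinProd_ne_zero (s : Set ι) [DecidablePred (· ∈ s)] :
    ∀ᵐ x ∂(volume.restrict (Set.Icc (0 : ι → ℝ) 1)), sinProd s x ≠ 0 := by
  have h : ∀ (i : ι) (c : ℝ), ∀ᵐ x ∂(volume.restrict (Set.Icc (0 : ι → ℝ) 1)), x i ≠ c := by
    intro i c
    refine ae_restrict_of_ae ?_
    exact measure_mono_null (fun x hx => by simpa using hx)
      (Measure.pi_hyperplane (fun _ : ι => (volume : Measure ℝ)) i c)
  have h0 : ∀ᵐ x ∂(volume.restrict (Set.Icc (0 : ι → ℝ) 1)), ∀ i, x i ≠ 0 :=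
    ae_all_iff.2 fun i => h i 0
  have h1 : ∀ᵐ x ∂(volume.restrict (Set.Icc (0 : ι → ℝ) 1)), ∀ i, x i ≠ 1 :=
    ae_all_iff.2 fun i => h i 1
  filter_upwards [h0, h1, ae_restrict_mem measurableSet_Icc] with x hx0 hx1 hx
  refine Finset.prod_ne_zero_iff.2 fun i _ => ?_
  split_ifs
  · exact one_ne_zero
  · have a0 : 0 < x i := lt_of_le_of_ne (hx.1 i) (hx0 i).symm
    have a1 : x i < 1 := lt_of_le_of_ne (hx.2 i) (hx1 i)
    rw [bot, Nat.cast_one, one_mul]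
    exact (Real.sin_pos_of_pos_of_lt_pi (mul_pos Real.pi_pos a0)
      (mul_lt_of_lt_one_right Real.pi_pos a1)).ne'

/-- An integrable function on a cube that is orthogonal to all the products of the functions
`top (v i) n`, for `i ∈ s`, and `bot n`, for `i ∉ s`, vanishes. -/
theorem ae_eq_zero_of_integral_profile (s : Set ι) [DecidablePred (· ∈ s)] (v : ι → ℝ)
    {f : (ι → ℝ) → ℂ} (hf : Integrable f (volume.restrict (Set.Icc (0 : ι → ℝ) 1)))
    (h : ∀ n : ι → ℕ, (∀ i, n i = 0 → i ∈ s) → ∫ x in Set.Icc (0 : ι → ℝ) 1,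
      ((∏ i, if i ∈ s then top (v i) (n i) (x i) else bot (n i) (x i) : ℝ) : ℂ) * f x = 0) :
    f =ᵐ[volume.restrict (Set.Icc (0 : ι → ℝ) 1)] 0 := by
  set μ := volume.restrict (Set.Icc (0 : ι → ℝ) 1) with hμ
  have hint : ∀ g : C(ι → I, ℂ), Integrable (fun x => g (clamp x) * f x) μ := fun g =>
    hf.bdd_mul (c := ‖g‖) (g.continuous.comp continuous_clamp).aestronglyMeasurable
      (ae_of_all _ fun x => g.norm_coe_le_norm _)
  let Λ : C(ι → I, ℂ) →L[ℂ] ℂ := LinearMap.mkContinuous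
    { toFun := fun g => ∫ x, g (clamp x) * f x ∂μ
      map_add' := fun g g' => by
        rw [← integral_add (hint g) (hint g')]
        exact integral_congr_ae (ae_of_all _ fun x => add_mul _ _ _)
      map_smul' := fun a g => by
        rw [RingHom.id_apply, ← integral_smul]
        exact integral_congr_ae (ae_of_all _ fun x => mul_assoc _ _ _) } (∫ x, ‖f x‖ ∂μ) fun g => by
    refine (norm_integral_le_of_norm_le (hf.norm.mul_const ‖g‖) (ae_of_all _ fun x => ?_)).trans ?_
    · rw [norm_mul, mul_comm]
      exact mul_le_mul_of_nonneg_left (g.norm_coe_le_norm _) (norm_nonneg _)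
    · rw [integral_mul_const]
  have hΛ : ∀ g, Λ g = ∫ x, g (clamp x) * f x ∂μ := fun g => rfl
  have hker : IsClosed ((LinearMap.ker (Λ : C(ι → I, ℂ) →ₗ[ℂ] ℂ)) : Set C(ι → I, ℂ)) :=
    isClosed_singleton.preimage Λ.continuous
  have h1 : ∀ u : ι → C(I, ℂ), (∀ i, u i ∈ if i ∈ s then topSet (v i) else botSet) →
      prodFun u ∈ LinearMap.ker (Λ : C(ι → I, ℂ) →ₗ[ℂ] ℂ) := by
    intro u hu
    have hex : ∀ i, ∃ n : ℕ, (n = 0 → i ∈ s) ∧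
        ∀ t : I, u i t = ((if i ∈ s then top (v i) n t else bot n t : ℝ) : ℂ) := by
      intro i
      have hi := hu i
      by_cases his : i ∈ s
      · rw [if_pos his] at hi
        obtain ⟨n, hn⟩ := hi
        exact ⟨n, fun _ => his, fun t => by rw [if_pos his, hn]⟩
      · rw [if_neg his] at hi
        obtain ⟨n, hn0, hn⟩ := hi
        exact ⟨n, fun h => absurd h hn0, fun t => by rw [if_neg his, hn]⟩
    choose n hn hnu using hex
    rw [LinearMap.mem_ker]
    refine Eq.trans ?_ (h n hn)
    refine setIntegral_congr_fun measurableSet_Icc fun x hx => ?_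
    refine congrArg (· * f x) ?_
    rw [prodFun_apply, Complex.ofReal_prod]
    refine Finset.prod_congr rfl fun i _ => ?_
    rw [hnu, coe_clamp hx]
  have h2 := prodFun_mem_of_mem_closure hker h1
  -- Outside `s` only multiples of `sin(πt)` are available, so `m` times `f` is shown to be
  -- orthogonal to all continuous functions. As `m` is nonzero almost everywhere, `f` then vanishes.
  let m : ι → C(I, ℂ) := fun i => if i ∈ s then 1 else ofRealFun (bot 1) (contDiff_bot 1).continuous
  have h3 : ∀ g : ι → C(I, ℂ), prodFun m * prodFun g ∈ LinearMap.ker (Λ : C(ι → I, ℂ) →ₗ[ℂ] ℂ) := by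
    intro g
    rw [prodFun_mul]
    refine h2 _ fun i => ?_
    by_cases his : i ∈ s
    · rw [if_pos his, closure_span_topSet]
      exact Submodule.mem_top
    · rw [if_neg his]
      simp only [m, Pi.mul_apply, if_neg his]
      exact sin_mul_mem_closure _
  have h4 : ∀ F : C(ι → I, ℂ), prodFun m * F ∈ LinearMap.ker (Λ : C(ι → I, ℂ) →ₗ[ℂ] ℂ) := by
    intro F
    have hsub : Submodule.span ℂ (Set.range (prodFun : (ι → C(I, ℂ)) → C(ι → I, ℂ))) ≤
        (LinearMap.ker (Λ : C(ι → I, ℂ) →ₗ[ℂ] ℂ)).comap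
          (ContinuousLinearMap.mul ℂ C(ι → I, ℂ) (prodFun m) : C(ι → I, ℂ) →ₗ[ℂ] C(ι → I, ℂ)) := by
      rw [Submodule.span_le]
      rintro _ ⟨g, rfl⟩
      exact h3 g
    have := Submodule.topologicalClosure_minimal _ hsub
      (hker.preimage (ContinuousLinearMap.mul ℂ C(ι → I, ℂ) (prodFun m)).continuous)
    rw [closure_span_prodFun] at this
    exact this (Submodule.mem_top (x := F))
  have hm : ∀ x ∈ Set.Icc (0 : ι → ℝ) 1, prodFun m (clamp x) = ((sinProd s x : ℝ) : ℂ) := by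
    intro x hx
    rw [prodFun_apply, sinProd, Complex.ofReal_prod]
    refine Finset.prod_congr rfl fun i _ => ?_
    by_cases his : i ∈ s
    · simp [m, his]
    · simp only [m, if_neg his]
      rw [← coe_clamp hx]
      rfl
  have h5 : ∀ᵐ x ∂μ, prodFun m (clamp x) * f x = 0 := by
    refine ae_eq_zero_of_integral_contDiff_smul_eq_zero (hint (prodFun m)).locallyIntegrable
      fun g hg _ => ?_
    let F : C(ι → I, ℂ) := ⟨fun y => ((g fun i => (y i : ℝ) : ℝ) : ℂ), by
      have := hg.continuous
      fun_prop⟩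
    have hF := LinearMap.mem_ker.1 (h4 F)
    refine Eq.trans ?_ hF
    refine setIntegral_congr_fun measurableSet_Icc fun x hx => ?_
    have e : F (clamp x) = ((g x : ℝ) : ℂ) := by
      change ((g fun i => (clamp x i : ℝ) : ℝ) : ℂ) = _
      rw [funext fun i => coe_clamp hx i]
    change g x • (prodFun m (clamp x) * f x) = prodFun m (clamp x) * F (clamp x) * f x
    rw [e, Complex.real_smul]
    ring
  filter_upwards [h5, ae_sinProd_ne_zero s, ae_restrict_mem measurableSet_Icc] with x hx hx' hxI
  rw [hm x hxI] at hx
  exact (mul_eq_zero.1 hx).resolve_left (Complex.ofReal_ne_zero.2 hx')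

end Products

end CubicalComplex

/-! ### Density in the fibres, and the theorem. -/

namespace CubicalComplex

variable {V : Type*} {X : CubicalComplex V}

/-- An element of the Hilbert sum is the limit of the finite sums of its components. -/
theorem mem_closure_of_forall_single_mem (K : Submodule ℂ X.OmegaL2) (η : X.OmegaL2)
    (h : ∀ ξ : X.OmegaL2, ∀ p : X.FormIndex, ξ p = η p → (∀ q, q ≠ p → ξ q = 0) → ξ ∈ K) :
    η ∈ closure (K : Set X.OmegaL2) := by
  classical
  have hs := lp.hasSum_single (E := fun p : X.FormIndex => Lp ℂ 2 (cubeMeasure p.1.1))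
    (p := 2) ENNReal.ofNat_ne_top η
  refine mem_closure_of_tendsto hs (Filter.Eventually.of_forall fun F => ?_)
  refine Submodule.sum_mem _ fun p _ => h _ p (lp.single_apply_self _ _ _) fun q hq => ?_
  exact lp.single_apply_ne _ _ _ hq

theorem inner_eq_of_single {ξ η : X.OmegaL2} {p : X.FormIndex} (h : ∀ q, q ≠ p → ξ q = 0) :
    inner ℂ ξ η = inner ℂ (ξ p) (η p) := by
  rw [lp.inner_eq_tsum, tsum_eq_single p]
  intro q hq
  rw [h q hq, inner_zero_left]

variable [LinearOrder X.Hyperplane]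

theorem RepresentsAt.eq_zero_of_eigenForm {v : X.Hyperplane → ℝ} {n : X.Hyperplane → ℕ}
    {p : X.FormIndex} {ξ : X.OmegaL2} (h : RepresentsAt (eigenForm v n p.1.1 p.1.2) ξ)
    (q : X.FormIndex) (hq : q ≠ p) : ξ q = 0 := by
  have e : eigenForm v n p.1.1 p.1.2 q.1.1 q.1.2 = fun _ => 0 := by
    by_cases hC : q.1.1 = p.1.1
    · have hJ : q.1.2 ≠ p.1.2 := fun hJ => hq (Subtype.ext (Prod.ext hC hJ))
      rw [hC]
      exact eigenForm_of_ne_right _ _ _ _ hJ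
    · exact eigenForm_of_ne_left _ _ _ _ hC
  refine Lp.ext (((h q).trans ?_).trans (Lp.coeFn_zero ℂ 2 (cubeMeasure q.1.1)).symm)
  rw [e]
  rfl

theorem RepresentsAt.inner_eigenForm {v : X.Hyperplane → ℝ} {n : X.Hyperplane → ℕ}
    {p : X.FormIndex} {ξ : X.OmegaL2} (h : RepresentsAt (eigenForm v n p.1.1 p.1.2) ξ)
    (η : X.OmegaL2) : inner ℂ ξ η = ∫ x in Set.Icc (0 : Coord p.1.1) 1,
      ((∏ K : ↥(Mid p.1.1), profile v n p.1.2 K.1 (x K) : ℝ) : ℂ) * η p x := by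
  rw [inner_eq_of_single h.eq_zero_of_eigenForm, L2.inner_def]
  refine integral_congr_ae ?_
  filter_upwards [h p] with x hx
  rw [hx, eigenForm_self, RCLike.inner_apply]
  change η p x * starRingEnd ℂ ((_ : ℝ) : ℂ) = _
  rw [Complex.conj_ofReal, mul_comm]

theorem IsEigenIndex.exists_representsAt (w : X.Hyperplane → ℝ) {s : I} {n : X.Hyperplane → ℕ}
    {C : X.Cube} {J : Finset X.Hyperplane} (h : IsEigenIndex s n C J) :
    ∃ ξ : X.OmegaL2, RepresentsAt (eigenForm ((s : ℝ) • w) n C J) ξ := by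
  obtain ⟨b, hb, _, hbs⟩ := exists_smoothFamily_eigenForm w s (n := n) (C := C) (J := J)
    (h.ne_zero_or.imp_right fun h0 => ⟨h0, h.subset.antisymm fun K hK =>
      h.mem_of_eq_zero K hK (by rw [h0]; rfl)⟩)
  obtain ⟨β, hβ⟩ := hb.exists_represents
  exact ⟨X.fibred.ev s β, hbs ▸ hβ.at s⟩

theorem ae_eq_zero_of_inner_eigenForm {w : X.Hyperplane → ℝ} {s : I} (hs : s ≠ 0) {η : X.OmegaL2}
    (h : ∀ n C J, IsEigenIndex s n C J → ∀ ξ : X.OmegaL2,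
      RepresentsAt (eigenForm ((s : ℝ) • w) n C J) ξ → inner ℂ ξ η = 0) (p : X.FormIndex) :
    η p = 0 := by
  classical
  refine Lp.ext (Filter.EventuallyEq.trans ?_ (Lp.coeFn_zero ℂ 2 (cubeMeasure p.1.1)).symm)
  have hfin : IsFiniteMeasure (cubeMeasure p.1.1) := inferInstance
  refine ae_eq_zero_of_integral_profile {K : ↥(Mid p.1.1) | K.1 ∈ p.1.2}
    (fun K => ((s : ℝ) • w) K.1) ((Lp.memLp (η p)).integrable one_le_two) fun n hn => ?_
  let n' : X.Hyperplane → ℕ := fun K => if hK : K ∈ Mid p.1.1 then n ⟨K, hK⟩ else 0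
  have hn' : ∀ K : ↥(Mid p.1.1), n' K.1 = n K := fun K => dif_pos K.2
  have hidx : IsEigenIndex s n' p.1.1 p.1.2 :=
    { subset := p.2
      mem_mid := fun K hK => by
        by_contra hKC
        exact hK (dif_neg hKC)
      mem_of_eq_zero := fun K hK h0 => hn ⟨K, hK⟩ ((hn' ⟨K, hK⟩).symm.trans h0)
      ne_zero_or := Or.inl hs }
  obtain ⟨ξ, hξ⟩ := hidx.exists_representsAt w
  refine Eq.trans ?_ ((hξ.inner_eigenForm η).symm.trans (h _ _ _ hidx ξ hξ))
  refine setIntegral_congr_fun measurableSet_Icc fun x _ => ?_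
  refine congrArg (fun r : ℝ => (r : ℂ) * η p x) (Finset.prod_congr rfl fun K _ => ?_)
  rw [profile, hn']
  rfl

/-- The eigenforms span a dense subspace of the fibre of `ℋ(X)` at `s`. -/
theorem mem_closure_of_eigenForm_mem (w : X.Hyperplane → ℝ) (s : I) (K : Submodule ℂ X.OmegaL2)
    (hK : ∀ n C J, IsEigenIndex s n C J → ∀ ξ : X.OmegaL2,
      RepresentsAt (eigenForm ((s : ℝ) • w) n C J) ξ → ξ ∈ K) (η : X.OmegaL2)
    (hη : s = 0 → η ∈ X.AL2) : η ∈ closure (K : Set X.OmegaL2) := by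
  by_cases hs : s = 0
  · subst hs
    refine mem_closure_of_forall_single_mem K η fun ξ p hp hq => ?_
    obtain ⟨c, hc⟩ := (hη rfl p).2
    by_cases hJ : p.1.2 = Mid p.1.1
    · have hidx : IsEigenIndex (0 : I) (0 : X.Hyperplane → ℕ) p.1.1 p.1.2 :=
        { subset := p.2
          mem_mid := fun K h => absurd rfl h
          mem_of_eq_zero := fun K h _ => hJ ▸ h
          ne_zero_or := Or.inr rfl }
      obtain ⟨ζ, hζ⟩ := hidx.exists_representsAt w
      -- With `s = 0` and zero frequencies every profile is identically one, so the eigenform is the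
      -- constant top-degree form and spans `A(C)`.
      have e : ξ = c • ζ := by
        refine lp.ext (funext fun q => ?_)
        change ξ q = c • ζ q
        by_cases hqp : q = p
        · subst hqp
          rw [hp]
          refine Lp.ext ?_
          filter_upwards [hc, hζ q, Lp.coeFn_smul c (ζ q)] with x h1 h2 h3
          rw [h1, h3, Pi.smul_apply, h2, eigenForm_self]
          have hprod : (∏ K : ↥(Mid q.1.1), profile ((((0 : I) : ℝ)) • w) 0 q.1.2 K.1 (x K)) = 1 := by
            refine Finset.prod_eq_one fun K _ => ?_
            rw [profile, if_pos (hJ.symm ▸ K.2), top]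
            simp
          change c = c • ((∏ K : ↥(Mid q.1.1), profile ((((0 : I) : ℝ)) • w) 0 q.1.2 K.1 (x K) : ℝ) : ℂ)
          rw [hprod]
          simp
        · rw [hq q hqp, hζ.eq_zero_of_eigenForm q hqp, smul_zero]
      rw [e]
      exact K.smul_mem c (hK _ _ _ hidx ζ hζ)
    · have e : ξ = 0 := by
        refine lp.ext (funext fun q => ?_)
        change ξ q = 0
        by_cases hqp : q = p
        · subst hqp
          rw [hp, (hη rfl q).1 hJ]
        · exact hq q hqp
      rw [e]
      exact K.zero_mem
  -- For `s ≠ 0` all eigenforms are available. A vector orthogonal to them has, on each cube and for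
  -- each multi-index, a coefficient orthogonal to all products of profiles, hence zero.
  · have htop : K.topologicalClosure = ⊤ := by
      rw [Submodule.topologicalClosure_eq_top_iff, eq_bot_iff]
      intro ζ hζ
      refine (Submodule.mem_bot ℂ).2 (lp.ext (funext fun p => ?_))
      refine ae_eq_zero_of_inner_eigenForm (w := w) hs (fun n C J hidx ξ hξ => ?_) p
      exact (Submodule.mem_orthogonal K ζ).1 hζ ξ (hK n C J hidx ξ hξ)
    have h1 : η ∈ K.topologicalClosure := by rw [htop]; exact Submodule.mem_top
    exact h1

/-- Used twice: for the domain of `𝒟` and for the ranges of its shifts. At `s = 0` only vectors of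
`A^*` have to be approximated, as this is where elements of `ℋ(X)` take their values. -/
theorem dense_of_eigenForm_mem (w : X.Hyperplane → ℝ) (R : Submodule C(I, ℂ) X.HilbertModule)
    (hR : ∀ s n C J, IsEigenIndex s n C J → ∀ ξ : X.OmegaL2,
      RepresentsAt (eigenForm ((s : ℝ) • w) n C J) ξ → ξ ∈ X.fibred.fibre R s) :
    Dense (R : Set X.HilbertModule) := by
  refine X.fibred.dense_of_fibre R fun s γ => ?_
  refine mem_closure_of_eigenForm_mem w s _ (hR s) _ fun hs => ?_
  subst hs
  exact γ.2

theorem dense_curlyDSubmodule (w : X.Hyperplane → ℝ) :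
    Dense (X.curlyDSubmodule w : Set X.HilbertModule) :=
  dense_of_eigenForm_mem w _ fun _ _ _ _ h _ hξ => h.mem_fibre_curlyDSubmodule hξ

theorem IsCurlyD.dense_shiftedRange (hX : X.IsCAT0) (hb : X.BoundedGeometry) {P : V}
    {w : X.Hyperplane → ℝ} {T : X.HilbertModule →ₗ.[C(I, ℂ)] X.HilbertModule} (hT : IsCurlyD P w T)
    {a : ℂ} (ha : a = Complex.I ∨ a = -Complex.I) :
    Dense (FibredModule.shiftedRange T a : Set X.HilbertModule) :=
  dense_of_eigenForm_mem w _ fun _ _ _ _ h _ hξ => h.mem_fibre_shiftedRange hX hb hT ha hξ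

end CubicalComplex

theorem mainTheorem7 {V : Type*} (X : CubicalComplex V) (hX : X.IsCAT0) (hb : X.BoundedGeometry)
    [LinearOrder X.Hyperplane] (P : V) (w : X.Hyperplane → ℝ)
    (hw : CubicalComplex.IsWeight w) (hproper : CubicalComplex.IsProperWeight w) :
    (∃! T : X.HilbertModule →ₗ.[C(I, ℂ)] X.HilbertModule, CubicalComplex.IsCurlyD P w T) ∧
    ∀ T : X.HilbertModule →ₗ.[C(I, ℂ)] X.HilbertModule, CubicalComplex.IsCurlyD P w T →
      ∃ S : X.HilbertModule →ₗ.[C(I, ℂ)] X.HilbertModule,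
        IsClosureOf S T ∧ IsRegularOperator S ∧ IsSelfAdjointOperator S := by
  have hd : Dense (CubicalComplex.curlyDDomain w : Set X.HilbertModule) :=
    CubicalComplex.dense_curlyDSubmodule w
  refine ⟨CubicalComplex.existsUnique_isCurlyD hX hb P hd, fun T hT => ?_⟩
  exact CubicalComplex.exists_selfAdjoint_closure T (hT.domain_eq ▸ hd)
    (hT.isSymmetricRelation hX) fun a ha => hT.dense_shiftedRange hX hb ha
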